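/- Let $k,\nu$ be real constants with $\nu\neq 0$, $\nu\neq -1$, and put $c=-(1+\nu)$. Let $U\subset\mathbb R^2$ be a connected open set with coordinates $(x_1,x_2)$, and let $X_1(x_1)$, $X_2(x_2)$, $G(x_1,x_2)$, $H(x_1,x_2)$ be smooth real functions (on the two projections of $U$ and on $U$, respectively). With $F=x_2^2X_1-x_1^2X_2$, consider on $\mathbb R^2\times U$, with coordinates $(\tau,\phi,x_1,x_2)$, $$ g=\frac{(F\,d\tau+G\,d\phi)^2}{(x_1-x_2)HF}+\frac{kH}{(x_1-x_2)^3}\left(\frac{dx_1^2}{X_1}-\frac{dx_2^2}{X_2}-\frac{X_1X_2}{kF}\,d\phi^2\right), $$ and assume that $g$ is a Riemannian metric (so $k>0$, $X_1X_2<0$ and $(x_1-x_2)HF>0$). Put $$ W=\frac{k}{c^2}\frac{(x_1-x_2)H}{F},\quad \psi=\frac{\sqrt k}{c}\tau,\quad y=\frac{c}{\sqrt k}\phi,\quad A=\frac{k}{c^2}\frac{G}{F}\,dy,\quad e^u=\frac{-X_1X_2}{(x_1-x_2)^4}, $$ $$ dx=c\left[\frac{x_1}{X_1}dx_1-\frac{x_2}{X_2}dx_2\right],\qquad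 z=\frac{c\,x_2}{x_2-x_1}+\nu=\frac{\nu x_1+x_2}{x_1-x_2},\qquad \kappa=(d\psi+A)\wedge dz+We^u\,dx\wedge dy, $$ and let $J$ be the almost-complex structure $J^a{}_b=\kappa_{bc}g^{ca}$. Assume that $g$ is conformally Kähler with respect to $J$ with conformal factor $1/z$; that is, $z$ has no zeros, and $z^{-2}g$ is a Kähler metric with complex structure $J$ (equivalently, $J$ is integrable and $d(z^{-2}\kappa)=0$). Orient $\mathbb R^2\times U$ so that $\kappa$ is anti-self-dual, i.e. by the volume form $-\tfrac12\kappa\wedge\kappa$. Then the Weyl tensor $C$ of $g$ satisfies the conformal self-duality equation $*C_{abcd}=C_{abcd}$ on $\mathbb R^2\times U$ if and only if there are real constants $a_0,\dots,a_4$ such that, for all $(x_1,x_2)\in U$, $$ X_1(x_1)=a_0+a_1x_1+a_2x_1^2+a_3x_1^3+a_4x_1^4, $$ $$ X_2(x_2)=a_0\nu^2-a_1\nu x_2+a_2x_2^2-\frac{a_3}{\nu}x_2^3+\frac{a_4}{\nu^2}x_2^4 . $$ -/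

import Mathlib

open scoped ContDiff

noncomputable section

/-! ### Tensor calculus in a coordinate chart of dimension four -/

namespace Chart

/-- Coordinate space; the chart domains are open subsets of it. -/
abbrev Pt : Type := Fin 4 → ℝ

/-- A field of arrays with two indices, such as a metric `g p a b` (both indices down), a 2-form
`η p a b`, or an endomorphism of the tangent bundle `J p a b` (`a` up, `b` down). -/
abbrev Field2 : Type := Pt → Matrix (Fin 4) (Fin 4) ℝ

/-- The partial derivative `∂ᵢ f` at `p`. -/
def pd (i : Fin 4) (f : Pt → ℝ) (p : Pt) : ℝ := fderiv ℝ f p (Pi.single i 1)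

/-- Christoffel symbols `Γᵃ_{bc}` of the Levi-Civita connection of `g`. -/
def christoffel (g : Field2) (p : Pt) (a b c : Fin 4) : ℝ :=
  (1 / 2) * ∑ d, (g p)⁻¹ a d *
    (pd b (fun q => g q d c) p + pd c (fun q => g q d b) p - pd d (fun q => g q b c) p)

/-- The Riemann tensor `Rᵃ_{bcd} = ∂_c Γᵃ_{db} - ∂_d Γᵃ_{cb} + Γᵃ_{ce} Γᵉ_{db} - Γᵃ_{de} Γᵉ_{cb}`. -/
def riemannUp (g : Field2) (p : Pt) (a b c d : Fin 4) : ℝ :=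
  pd c (fun q => christoffel g q a d b) p - pd d (fun q => christoffel g q a c b) p
    + ∑ e, (christoffel g p a c e * christoffel g p e d b
      - christoffel g p a d e * christoffel g p e c b)

/-- The Riemann tensor with all indices down, `R_{abcd} = g_{ae} Rᵉ_{bcd}`. -/
def riemann (g : Field2) (p : Pt) (a b c d : Fin 4) : ℝ :=
  ∑ e, g p a e * riemannUp g p e b c d

/-- The Ricci tensor `R_{bd} = Rᵃ_{bad}`. -/
def ricci (g : Field2) (p : Pt) (b d : Fin 4) : ℝ := ∑ a, riemannUp g p a b a d

/-- The scalar curvature `R = g^{bd} R_{bd}`. -/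
def scalarCurvature (g : Field2) (p : Pt) : ℝ := ∑ b, ∑ d, (g p)⁻¹ b d * ricci g p b d

/-- The Weyl tensor `C_{abcd}` (in dimension four). -/
def weyl (g : Field2) (p : Pt) (a b c d : Fin 4) : ℝ :=
  riemann g p a b c d
    - (1 / 2) * (g p a c * ricci g p b d - g p a d * ricci g p b c
        - g p b c * ricci g p a d + g p b d * ricci g p a c)
    + (scalarCurvature g p / 6) * (g p a c * g p b d - g p a d * g p b c)

/-- The dual Weyl tensor `(*C)_{abcd} = ½ ε_{ab}^{ef} C_{efcd}` for the volume form `ε`. -/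
def dualWeyl (g : Field2) (ε : Pt → Fin 4 → Fin 4 → Fin 4 → Fin 4 → ℝ) (p : Pt)
    (a b c d : Fin 4) : ℝ :=
  (1 / 2) * ∑ e, ∑ f, ∑ r, ∑ s, ε p a b r s * (g p)⁻¹ r e * (g p)⁻¹ s f * weyl g p e f c d

/-- Conformal self-duality `*C = C` of `g` on `D`, for the orientation given by the volume
form `ε`. -/
def IsConformallySelfDualOn (g : Field2) (ε : Pt → Fin 4 → Fin 4 → Fin 4 → Fin 4 → ℝ)
    (D : Set Pt) : Prop :=
  ∀ p ∈ D, ∀ a b c d, dualWeyl g ε p a b c d = weyl g p a b c d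

/-- The Nijenhuis tensor `Nᵃ_{bc}` of an endomorphism field `J`. -/
def nijenhuis (J : Field2) (p : Pt) (a b c : Fin 4) : ℝ :=
  ∑ d, (J p d b * pd d (fun q => J q a c) p - J p d c * pd d (fun q => J q a b) p
    - J p a d * (pd b (fun q => J q d c) p - pd c (fun q => J q d b) p))

/-- The exterior derivative of a 2-form,
`(dη)_{abc} = ∂_a η_{bc} + ∂_b η_{ca} + ∂_c η_{ab}`. -/
def extDeriv2 (η : Field2) (p : Pt) (a b c : Fin 4) : ℝ :=
  pd a (fun q => η q b c) p + pd b (fun q => η q c a) p + pd c (fun q => η q a b) p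

/-- The fundamental form `κ_{ab} = g_{bc} Jᶜ_a`. -/
def fundamentalForm (g J : Field2) : Field2 := fun p =>
  Matrix.of fun a b => ∑ c, g p b c * J p c a

/-- `(g, J)` is a Kähler structure on `D`: `g` is Riemannian, `J` is an almost-complex structure
which is `g`-orthogonal and integrable, and the fundamental form is closed. -/
structure IsKahlerOn (g J : Field2) (D : Set Pt) : Prop where
  posDef : ∀ p ∈ D, (g p).PosDef
  almostComplex : ∀ p ∈ D, J p * J p = -1
  orthogonal : ∀ p ∈ D, (J p).transpose * g p * J p = g p
  integrable : ∀ p ∈ D, ∀ a b c, nijenhuis J p a b c = 0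
  closed : ∀ p ∈ D, ∀ a b c, extDeriv2 (fundamentalForm g J) p a b c = 0

/-- `½ η ∧ η` for a 2-form `η`. -/
def halfWedgeSq (η : Field2) (p : Pt) (a b c d : Fin 4) : ℝ :=
  η p a b * η p c d - η p a c * η p b d + η p a d * η p b c

/-- The wedge product of two covectors, as an antisymmetric matrix. -/
def wedge (α β : Fin 4 → ℝ) : Matrix (Fin 4) (Fin 4) ℝ :=
  Matrix.vecMulVec α β - Matrix.vecMulVec β α

/-- The symmetric square of a covector. -/
def symSq (α : Fin 4 → ℝ) : Matrix (Fin 4) (Fin 4) ℝ := Matrix.vecMulVec α α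

end Chart

/-! ### The Chen–Teo family

The coordinates `(τ, φ, x₁, x₂)` of a point `p` are `(p 0, p 1, p 2, p 3)`. -/

namespace ChenTeo

open Chart

/-- The point `(x₁, x₂)` of the orbit space. -/
def proj (p : Pt) : ℝ × ℝ := (p 2, p 3)

/-- The chart domain over `U`: `τ` and `φ` are unrestricted and `(x₁, x₂) ∈ U`. -/
def domain (U : Set (ℝ × ℝ)) : Set Pt := {p | proj p ∈ U}

/-- The coordinate covectors `dτ, dφ, dx₁, dx₂`. -/
def dτ : Fin 4 → ℝ := ![1, 0, 0, 0]
/-- See `dτ`. -/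
def dφ : Fin 4 → ℝ := ![0, 1, 0, 0]
/-- See `dτ`. -/
def dx₁ : Fin 4 → ℝ := ![0, 0, 1, 0]
/-- See `dτ`. -/
def dx₂ : Fin 4 → ℝ := ![0, 0, 0, 1]

/-- `F = x₂² X₁(x₁) - x₁² X₂(x₂)`. -/
def F (X₁ X₂ : ℝ → ℝ) (x : ℝ × ℝ) : ℝ := x.2 ^ 2 * X₁ x.1 - x.1 ^ 2 * X₂ x.2

/-- The metric of the family, for a constant `k` and functions `X₁(x₁)`, `X₂(x₂)`, `G(x₁, x₂)`,
`H(x₁, x₂)`. -/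
def metric (k : ℝ) (X₁ X₂ : ℝ → ℝ) (G H : ℝ × ℝ → ℝ) : Field2 := fun p =>
  let x := proj p
  (1 / ((x.1 - x.2) * H x * F X₁ X₂ x)) • symSq (F X₁ X₂ x • dτ + G x • dφ)
    + (k * H x / (x.1 - x.2) ^ 3) •
      ((1 / X₁ x.1) • symSq dx₁ - (1 / X₂ x.2) • symSq dx₂
        - (X₁ x.1 * X₂ x.2 / (k * F X₁ X₂ x)) • symSq dφ)

/-- `W = (k / c²) (x₁ - x₂) H / F`. -/
def W (k c : ℝ) (X₁ X₂ : ℝ → ℝ) (H : ℝ × ℝ → ℝ) (x : ℝ × ℝ) : ℝ :=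
  k / c ^ 2 * ((x.1 - x.2) * H x / F X₁ X₂ x)

/-- `e^u = -X₁ X₂ / (x₁ - x₂)⁴`. -/
def expU (X₁ X₂ : ℝ → ℝ) (x : ℝ × ℝ) : ℝ := -(X₁ x.1 * X₂ x.2) / (x.1 - x.2) ^ 4

/-- `z = c x₂ / (x₂ - x₁) + ν`. -/
def z (c ν : ℝ) (x : ℝ × ℝ) : ℝ := c * x.2 / (x.2 - x.1) + ν

/-- `dψ`, where `ψ = (√k / c) τ`. -/
def dψ (k c : ℝ) : Fin 4 → ℝ := (√k / c) • dτ

/-- `dy`, where `y = (c / √k) φ`. -/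
def dy (k c : ℝ) : Fin 4 → ℝ := (c / √k) • dφ

/-- `A = (k / c²) (G / F) dy`. -/
def A (k c : ℝ) (X₁ X₂ : ℝ → ℝ) (G : ℝ × ℝ → ℝ) (x : ℝ × ℝ) : Fin 4 → ℝ :=
  (k / c ^ 2 * (G x / F X₁ X₂ x)) • dy k c

/-- `dx = c [(x₁ / X₁) dx₁ - (x₂ / X₂) dx₂]`. -/
def dx (c : ℝ) (X₁ X₂ : ℝ → ℝ) (x : ℝ × ℝ) : Fin 4 → ℝ :=
  c • ((x.1 / X₁ x.1) • dx₁ - (x.2 / X₂ x.2) • dx₂)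

/-- `dz = c (x₂ dx₁ - x₁ dx₂) / (x₁ - x₂)²`. -/
def dz (c : ℝ) (x : ℝ × ℝ) : Fin 4 → ℝ :=
  (c / (x.1 - x.2) ^ 2) • (x.2 • dx₁ - x.1 • dx₂)

/-- The 2-form `κ = (dψ + A) ∧ dz + W e^u dx ∧ dy`. It equals `β⁰ ∧ β¹ + β² ∧ β³` for the
orthonormal coframe `β⁰ = W^{-1/2} (dψ + A)`, `β¹ = W^{1/2} dz`, `β² = W^{1/2} e^{u/2} dx`,
`β³ = W^{1/2} e^{u/2} dy` of the metric. -/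
def κ (k c : ℝ) (X₁ X₂ : ℝ → ℝ) (G H : ℝ × ℝ → ℝ) : Field2 := fun p =>
  let x := proj p
  wedge (dψ k c + A k c X₁ X₂ G x) (dz c x)
    + (W k c X₁ X₂ H x * expU X₁ X₂ x) • wedge (dx c X₁ X₂ x) (dy k c)

/-- The almost-complex structure `Jᵃ_b = κ_{bc} g^{ca}`. -/
def J (k c : ℝ) (X₁ X₂ : ℝ → ℝ) (G H : ℝ × ℝ → ℝ) : Field2 := fun p =>
  Matrix.of fun a b => ∑ e, κ k c X₁ X₂ G H p b e * (metric k X₁ X₂ G H p)⁻¹ e a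

/-- The volume form `ε = -½ κ ∧ κ = -β⁰ ∧ β¹ ∧ β² ∧ β³` of the metric: the orientation is the
one for which `κ` is anti-self-dual. -/
def volumeForm (k c : ℝ) (X₁ X₂ : ℝ → ℝ) (G H : ℝ × ℝ → ℝ) (p : Pt) (a b d e : Fin 4) : ℝ :=
  -halfWedgeSq (κ k c X₁ X₂ G H) p a b d e

/-- The metric is conformally Kähler on the chart domain over `U`, with respect to the
almost-complex structure `J` and with the conformal factor `Ω = 1 / z`: the metric `z⁻² g` is
Kähler with complex structure `J`. (In particular `z` does not vanish on `U`.) -/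
def IsConformallyKahlerOn (k c ν : ℝ) (X₁ X₂ : ℝ → ℝ) (G H : ℝ × ℝ → ℝ)
    (U : Set (ℝ × ℝ)) : Prop :=
  IsKahlerOn (fun p => ((z c ν (proj p))⁻¹ ^ 2) • metric k X₁ X₂ G H p) (J k c X₁ X₂ G H)
    (domain U)

end ChenTeo

end

noncomputable section

namespace Chart

open Filter Topology

/-! ### Partial derivatives -/

/-! The Weyl tensor with one index raised is conformally invariant, so it may be computed from the
Kähler metric `z⁻² g`. A 2-form is self-dual for the volume form `-½ κ ∧ κ` exactly when its
endomorphism commutes with `J` and is trace-orthogonal to it (`selfDual_iff`). Applied to the Weyl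
tensor of a Kähler metric in real dimension four, this condition says precisely that the scalar
curvature vanishes (`IsKahlerCurvature.weylUp_iff`). In one direction, the trace of `J` against the
Weyl tensor is a multiple of the scalar curvature times the fundamental form. In the other, the
curvature commutes with `J`, and so does the Kulkarni–Nomizu product of `g` with a trace-free
`J`-invariant Ricci tensor. The structure `IsKahlerOn` records integrability and closedness, so the
equality `∇J = 0` has to be derived from them first (`IsKahlerOn.parallel`).

It remains to compute one scalar curvature. It is the contraction of `tr (J R_{cd})` with `J g⁻¹`.
When coordinate `i` is ignorable, `tr (J R_{ai})` is the derivative `∂_a tr (J Γ_i)`, and in this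
chart `J g⁻¹` only pairs ignorable coordinates with the others. Two connection traces therefore
suffice. Closedness of `z⁻² κ` and integrability of `J` eliminate the derivatives of the connection
form `A` from them, leaving functions of `z` and `v = e^u` apart from explicit factors
(`trace_conn₀`, `trace_conn₁`). Writing `P = u_z - 4/z` and `Q = u_x`, scalar-flatness becomes `P_z
+ P (P + 2/z) + e^{-u} Q_x = 0`, that is, `e^{-u} (u_xx + (e^u)_zz) - 6 u_z / z + 12 / z² = 0`; `W`,
`G` and `H` have dropped out.

In the coordinates `x₁`, `x₂`, with `t = ν x₁ + x₂`, this equation is `t² (X₁'' - X₂'') - 6 t (ν X₁'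
- X₂') + 12 (ν² X₁ - X₂) = 0` up to a nonvanishing factor (`curvature_identity`). Three derivatives
in `x₁` collapse it to `t² X₁⁽⁵⁾ = 0`, and `t` has no zeros, so `X₁` is a quartic. The equation and
its first two derivatives then determine `X₂`: it is the polynomial `ν² X₁(-x₂/ν)`. -/

theorem pd_congr {i : Fin 4} {f g : Pt → ℝ} {p : Pt} (h : f =ᶠ[𝓝 p] g) :
    pd i f p = pd i g p := by
  simp only [pd, h.fderiv_eq]

theorem pd_congr_on {i : Fin 4} {f g : Pt → ℝ} {D : Set Pt} (hD : IsOpen D)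
    (h : ∀ q ∈ D, f q = g q) {p : Pt} (hp : p ∈ D) : pd i f p = pd i g p :=
  pd_congr (by filter_upwards [hD.mem_nhds hp] with q hq using h q hq)

theorem pd_const (i : Fin 4) (r : ℝ) (p : Pt) : pd i (fun _ => r) p = 0 := by
  simp [pd]

theorem pd_add {i : Fin 4} {f g : Pt → ℝ} {p : Pt} (hf : DifferentiableAt ℝ f p)
    (hg : DifferentiableAt ℝ g p) : pd i (fun q => f q + g q) p = pd i f p + pd i g p := by
  simp [pd, fderiv_fun_add hf hg]

theorem pd_sub {i : Fin 4} {f g : Pt → ℝ} {p : Pt} (hf : DifferentiableAt ℝ f p)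
    (hg : DifferentiableAt ℝ g p) : pd i (fun q => f q - g q) p = pd i f p - pd i g p := by
  simp [pd, fderiv_fun_sub hf hg]

theorem pd_neg {i : Fin 4} {f : Pt → ℝ} {p : Pt} :
    pd i (fun q => -f q) p = -pd i f p := by
  simp [pd, fderiv_fun_neg]

theorem pd_mul {i : Fin 4} {f g : Pt → ℝ} {p : Pt} (hf : DifferentiableAt ℝ f p)
    (hg : DifferentiableAt ℝ g p) :
    pd i (fun q => f q * g q) p = pd i f p * g p + f p * pd i g p := by
  simp [pd, fderiv_fun_mul hf hg]; ring

theorem pd_const_mul {i : Fin 4} {f : Pt → ℝ} {p : Pt} (r : ℝ) (hf : DifferentiableAt ℝ f p) :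
    pd i (fun q => r * f q) p = r * pd i f p := by
  rw [pd_mul (differentiableAt_const r) hf, pd_const]; ring

theorem pd_inv {i : Fin 4} {f : Pt → ℝ} {p : Pt} (hf : DifferentiableAt ℝ f p) (h0 : f p ≠ 0) :
    pd i (fun q => (f q)⁻¹) p = -pd i f p / f p ^ 2 := by
  have h := (hasDerivAt_inv h0).comp_hasFDerivAt p hf.hasFDerivAt
  have h2 : fderiv ℝ (fun q => (f q)⁻¹) p = _ := h.fderiv
  simp only [pd, h2]
  simp
  ring

theorem pd_div {i : Fin 4} {f g : Pt → ℝ} {p : Pt} (hf : DifferentiableAt ℝ f p)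
    (hg : DifferentiableAt ℝ g p) (h0 : g p ≠ 0) :
    pd i (fun q => f q / g q) p = (pd i f p * g p - f p * pd i g p) / g p ^ 2 := by
  have h := pd_mul (i := i) hf (g := fun q => (g q)⁻¹) (hg.fun_inv h0)
  rw [pd_inv hg h0] at h
  simp only [div_eq_mul_inv] at h ⊢
  rw [h]
  field_simp
  ring

theorem pd_pow {i : Fin 4} {f : Pt → ℝ} {p : Pt} (n : ℕ) (hf : DifferentiableAt ℝ f p) :
    pd i (fun q => f q ^ n) p = n * f p ^ (n - 1) * pd i f p := by
  simp [pd, fderiv_fun_pow n hf]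

theorem pd_sum {ι : Type*} (s : Finset ι) {i : Fin 4} {f : ι → Pt → ℝ} {p : Pt}
    (hf : ∀ j ∈ s, DifferentiableAt ℝ (f j) p) :
    pd i (fun q => ∑ j ∈ s, f j q) p = ∑ j ∈ s, pd i (f j) p := by
  simp [pd, fderiv_fun_sum hf]

theorem pd_coord (i j : Fin 4) (p : Pt) :
    pd i (fun q => q j) p = if j = i then 1 else 0 := by
  have h : fderiv ℝ (fun q : Pt => q j) p = _ := (hasFDerivAt_apply (𝕜 := ℝ) j p).fderiv
  simp [pd, h, Pi.single_apply]

theorem pd_comp {i : Fin 4} {φ : ℝ → ℝ} {f : Pt → ℝ} {p : Pt} (hφ : DifferentiableAt ℝ φ (f p))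
    (hf : DifferentiableAt ℝ f p) : pd i (fun q => φ (f q)) p = deriv φ (f p) * pd i f p := by
  have h : fderiv ℝ (fun q => φ (f q)) p = _ :=
    (hφ.hasDerivAt.comp_hasFDerivAt p hf.hasFDerivAt).fderiv
  simp [pd, h]

section Smooth

variable {D : Set Pt} {f g : Pt → ℝ}

theorem _root_.ContDiffOn.diffAt (hf : ContDiffOn ℝ ∞ f D) (hD : IsOpen D) {p : Pt}
    (hp : p ∈ D) : DifferentiableAt ℝ f p :=
  (hf.differentiableOn (by simp)).differentiableAt (hD.mem_nhds hp)

theorem _root_.ContDiffOn.pd (hf : ContDiffOn ℝ ∞ f D) (hD : IsOpen D) (i : Fin 4) :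
    ContDiffOn ℝ ∞ (pd i f) D :=
  (hf.fderiv_of_isOpen hD (by simp)).clm_apply contDiffOn_const

theorem pd_comm (hf : ContDiffOn ℝ ∞ f D) (hD : IsOpen D) {p : Pt} (hp : p ∈ D) (i j : Fin 4) :
    pd i (pd j f) p = pd j (pd i f) p := by
  have hs : IsSymmSndFDerivAt ℝ f p :=
    (hf.contDiffAt (hD.mem_nhds hp)).isSymmSndFDerivAt (by rw [minSmoothness_of_isRCLikeNormedField]; exact WithTop.coe_le_coe.2 (le_top : (2 : ℕ∞) ≤ ⊤))
  have hd : DifferentiableAt ℝ (fderiv ℝ f) p :=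
    ((hf.fderiv_of_isOpen hD (m := ∞) (by simp)).differentiableOn (by simp)).differentiableAt
      (hD.mem_nhds hp)
  have key : ∀ i j : Fin 4, pd i (pd j f) p
      = fderiv ℝ (fderiv ℝ f) p (Pi.single i 1) (Pi.single j 1) := by
    intro i j
    change fderiv ℝ (fun q => fderiv ℝ f q (Pi.single j 1)) p (Pi.single i 1) = _
    rw [fderiv_clm_apply hd (differentiableAt_const _)]
    simp
  rw [key, key]
  exact hs _ _

end Smooth

/-! ### Functions invariant under a coordinate translation -/

/-- Invariance under translations along the `i`-th coordinate axis. -/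
def Invariant {β : Type*} (i : Fin 4) (f : Pt → β) : Prop :=
  ∀ (t : ℝ) (p : Pt), f (p + Pi.single i t) = f p

/-- The function is constant along the coordinate line. Differentiability is not needed, because
`fderiv` is zero by convention where it fails. -/
theorem Invariant.pd_eq_zero {i : Fin 4} {f : Pt → ℝ} (hf : Invariant i f) (p : Pt) :
    pd i f p = 0 := by
  by_cases hd : DifferentiableAt ℝ f p
  · have h1 : HasDerivAt (fun t : ℝ => p + t • (Pi.single i 1 : Pt)) (Pi.single i 1) 0 := by
      simpa using ((hasDerivAt_id (0 : ℝ)).smul_const (Pi.single i 1 : Pt)).const_add p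
    have h2 : HasDerivAt (fun t : ℝ => f (p + t • (Pi.single i 1 : Pt)))
        (fderiv ℝ f p (Pi.single i 1)) 0 := by
      refine HasFDerivAt.comp_hasDerivAt (0 : ℝ) ?_ h1
      simpa using hd.hasFDerivAt
    have h3 : (fun t : ℝ => f (p + t • (Pi.single i 1 : Pt))) = fun _ => f p := by
      funext t
      rw [← hf t p]
      congr 2
      ext j
      by_cases hj : j = i
      · subst hj; simp
      · simp [hj]
    rw [h3] at h2
    exact h2.unique (hasDerivAt_const _ _)
  · simp [pd, fderiv_zero_of_not_differentiableAt hd]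

theorem Invariant.pd {i : Fin 4} {f : Pt → ℝ} (hf : Invariant i f) (j : Fin 4) :
    Invariant i (pd j f) := by
  intro t p
  have h : (fun q => f (q + Pi.single i t)) = f := funext fun q => hf t q
  have h2 := fderiv_comp_add_right (𝕜 := ℝ) (f := f) (x := p) (Pi.single i t)
  rw [h] at h2
  simp only [Chart.pd, h2]

/-! ### Matrix fields -/

/-- The entrywise partial derivative of a matrix field. -/
def pdM (i : Fin 4) (M : Field2) : Field2 := fun p => Matrix.of fun a b => pd i (fun q => M q a b) p

/-- Entrywise smoothness of a matrix field. -/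
def SmoothField (M : Field2) (D : Set Pt) : Prop := ∀ a b, ContDiffOn ℝ ∞ (fun p => M p a b) D

section Fields

variable {D : Set Pt} {M N : Field2}

theorem pdM_apply (i : Fin 4) (M : Field2) (p : Pt) (a b : Fin 4) :
    pdM i M p a b = pd i (fun q => M q a b) p := rfl

theorem SmoothField.mul (hM : SmoothField M D) (hN : SmoothField N D) :
    SmoothField (fun p => M p * N p) D := by
  intro a b
  simp only [Matrix.mul_apply]
  exact ContDiffOn.sum fun e _ => (hM a e).mul (hN e b)

theorem SmoothField.transpose (hM : SmoothField M D) :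
    SmoothField (fun p => (M p).transpose) D := fun a b => hM b a

theorem SmoothField.det (hM : SmoothField M D) : ContDiffOn ℝ ∞ (fun p => (M p).det) D := by
  simp only [Matrix.det_apply]
  refine ContDiffOn.sum fun σ _ => ?_
  simp only [Units.smul_def, zsmul_eq_mul]
  exact contDiffOn_const.mul (contDiffOn_prod fun i _ => hM _ _)

/-- By Cramer's rule each entry of the inverse is a determinant of smooth entries divided by `det
M`. -/
theorem SmoothField.inv (hM : SmoothField M D) (h0 : ∀ p ∈ D, (M p).det ≠ 0) :
    SmoothField (fun p => (M p)⁻¹) D := by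
  intro a b
  simp only [Matrix.inv_def, Matrix.smul_apply, Ring.inverse_eq_inv', smul_eq_mul,
    Matrix.adjugate_apply]
  refine (hM.det.inv h0).mul (SmoothField.det fun i j => ?_)
  by_cases h : i = b
  · subst h
    simpa using contDiffOn_const
  · simpa [Matrix.updateRow_ne h] using hM i j

theorem pdM_congr_on {i : Fin 4} (hD : IsOpen D) (h : ∀ q ∈ D, M q = N q) {p : Pt}
    (hp : p ∈ D) : pdM i M p = pdM i N p := by
  ext a b
  exact pd_congr_on hD (fun q hq => by rw [h q hq]) hp

theorem pdM_mul (hD : IsOpen D) (hM : SmoothField M D) (hN : SmoothField N D) {p : Pt}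
    (hp : p ∈ D) (i : Fin 4) :
    pdM i (fun q => M q * N q) p = pdM i M p * N p + M p * pdM i N p := by
  ext a b
  simp only [pdM_apply, Matrix.mul_apply, Matrix.add_apply]
  refine (pd_sum Finset.univ (f := fun e q => M q a e * N q e b)
    fun e _ => ((hM a e).diffAt hD hp).fun_mul ((hN e b).diffAt hD hp)).trans ?_
  rw [← Finset.sum_add_distrib]
  exact Finset.sum_congr rfl fun e _ => pd_mul ((hM a e).diffAt hD hp) ((hN e b).diffAt hD hp)

theorem pdM_add (hD : IsOpen D) (hM : SmoothField M D) (hN : SmoothField N D) {p : Pt}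
    (hp : p ∈ D) (i : Fin 4) :
    pdM i (fun q => M q + N q) p = pdM i M p + pdM i N p := by
  ext a b
  exact pd_add ((hM a b).diffAt hD hp) ((hN a b).diffAt hD hp)

theorem pdM_sub (hD : IsOpen D) (hM : SmoothField M D) (hN : SmoothField N D) {p : Pt}
    (hp : p ∈ D) (i : Fin 4) :
    pdM i (fun q => M q - N q) p = pdM i M p - pdM i N p := by
  ext a b
  exact pd_sub ((hM a b).diffAt hD hp) ((hN a b).diffAt hD hp)

theorem pdM_transpose (i : Fin 4) (M : Field2) (p : Pt) :
    pdM i (fun q => (M q).transpose) p = (pdM i M p).transpose := rfl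

theorem pdM_comm (hD : IsOpen D) (hM : SmoothField M D) {p : Pt} (hp : p ∈ D) (i j : Fin 4) :
    pdM i (pdM j M) p = pdM j (pdM i M) p := by
  ext a b
  exact pd_comm (hM a b) hD hp i j

theorem pd_trace (hD : IsOpen D) (hM : SmoothField M D) {p : Pt} (hp : p ∈ D) (i : Fin 4) :
    pd i (fun q => (M q).trace) p = (pdM i M p).trace := by
  simp only [Matrix.trace, Matrix.diag]
  exact pd_sum _ fun a _ => (hM a a).diffAt hD hp

end Fields

end Chart

namespace Chart

/-! ### Pointwise algebra of curvature tensors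

A curvature tensor `Rᵃ_{bcd}` at a point is a family of endomorphisms `R c d`. -/

/-- Endomorphisms of the tangent space, or bilinear forms. -/
abbrev Mat : Type := Matrix (Fin 4) (Fin 4) ℝ

/-- The Kulkarni–Nomizu product `g ∧ P` with the first index raised,
`δᵃ_c P_{bd} - δᵃ_d P_{bc} + g_{bd} Pᵃ_c - g_{bc} Pᵃ_d`. -/
def kulkarni (g P : Mat) (c d : Fin 4) : Mat := Matrix.of fun a b =>
  (1 : Mat) a c * P b d - (1 : Mat) a d * P b c + g b d * (g⁻¹ * P) a c - g b c * (g⁻¹ * P) a d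

/-- The Ricci contraction. -/
def ricM (R : Fin 4 → Fin 4 → Mat) : Mat := Matrix.of fun b d => ∑ a, R a d a b

/-- The scalar contraction. -/
def scal (g : Mat) (R : Fin 4 → Fin 4 → Mat) : ℝ := ∑ b, ∑ d, g⁻¹ b d * ricM R b d

/-- The Schouten tensor. -/
def schouten (g : Mat) (R : Fin 4 → Fin 4 → Mat) : Mat :=
  (1 / 2 : ℝ) • ricM R - (scal g R / 12) • g

/-- The Weyl tensor with its first index raised. -/
def weylUp (g : Mat) (R : Fin 4 → Fin 4 → Mat) (c d : Fin 4) : Mat :=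
  R c d - kulkarni g (schouten g R) c d

theorem kulkarni_add (g P Q : Mat) (c d : Fin 4) :
    kulkarni g (P + Q) c d = kulkarni g P c d + kulkarni g Q c d := by
  ext a b
  simp only [kulkarni, Matrix.mul_add, Matrix.add_apply, Matrix.of_apply]
  ring

/-- The coefficient 2 is `n - 2` for `n = 4`. Together with the factor 6 in `scal_add_kulkarni`, it
makes the Schouten tensor change by exactly `T`. -/
theorem ricM_add_kulkarni {g T : Mat} {R R' : Fin 4 → Fin 4 → Mat} (hdet : IsUnit g.det)
    (h : ∀ c d, R' c d = R c d + kulkarni g T c d) :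
    ricM R' = ricM R + (2 : ℝ) • T + (g⁻¹ * T).trace • g := by
  ext b d
  have h1 : ∑ a, g b a * (g⁻¹ * T) a d = T b d := by
    rw [← Matrix.mul_apply, Matrix.mul_nonsing_inv_cancel_left _ _ hdet]
  simp only [ricM, h, Matrix.of_apply, Matrix.add_apply, Matrix.smul_apply, smul_eq_mul,
    Finset.sum_add_distrib, kulkarni, Finset.sum_sub_distrib, h1, ← Finset.mul_sum,
    Matrix.trace, Matrix.diag]
  simp [Matrix.one_apply]
  ring

theorem scal_add_kulkarni {g T : Mat} {R R' : Fin 4 → Fin 4 → Mat} (hg : g.transpose = g)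
    (hdet : IsUnit g.det) (h : ∀ c d, R' c d = R c d + kulkarni g T c d) :
    scal g R' = scal g R + 6 * (g⁻¹ * T).trace := by
  have hgi : g⁻¹.transpose = g⁻¹ := by rw [Matrix.transpose_nonsing_inv, hg]
  have hs : ∀ P : Mat, ∑ b, ∑ d, g⁻¹ b d * P b d = (g⁻¹ * P).trace := by
    intro P
    simp only [Matrix.trace, Matrix.diag, Matrix.mul_apply]
    rw [Finset.sum_comm]
    refine Finset.sum_congr rfl fun d _ => Finset.sum_congr rfl fun b _ => ?_
    rw [← Matrix.transpose_apply g⁻¹ d b, hgi]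
  simp only [scal, hs, ricM_add_kulkarni hdet h]
  simp [Matrix.mul_add, Matrix.nonsing_inv_mul _ hdet]
  ring

/-- The Weyl tensor is unchanged when a Kulkarni–Nomizu product is added to the curvature and the
metric is rescaled. -/
theorem weylUp_add_kulkarni {g T : Mat} {R R' : Fin 4 → Fin 4 → Mat} {l : ℝ} (hl : l ≠ 0)
    (hg : g.transpose = g) (hdet : IsUnit g.det)
    (h : ∀ c d, R' c d = R c d + kulkarni g T c d) (c d : Fin 4) :
    weylUp (l • g) R' c d = weylUp g R c d := by
  have hinv : (l • g)⁻¹ = l⁻¹ • g⁻¹ := by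
    apply Matrix.inv_eq_left_inv
    simp [Matrix.nonsing_inv_mul _ hdet, hl, smul_smul]
  have hk : ∀ P, kulkarni (l • g) P c d = kulkarni g P c d := by
    intro P
    ext a b
    simp only [kulkarni, hinv, Matrix.of_apply, Matrix.smul_apply, Matrix.smul_mul, smul_eq_mul]
    field_simp
  have hsc : scal (l • g) R' = l⁻¹ * scal g R' := by
    simp only [scal, hinv, Matrix.smul_apply, smul_eq_mul, Finset.mul_sum, mul_assoc]
  have hS : schouten (l • g) R' = schouten g R + T := by
    simp only [schouten, hsc, scal_add_kulkarni hg hdet h, ricM_add_kulkarni hdet h]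
    ext a b
    simp only [Matrix.add_apply, Matrix.sub_apply, Matrix.smul_apply, smul_eq_mul]
    field_simp
    ring
  rw [weylUp, weylUp, hk, hS, kulkarni_add, h]
  abel

/-! ### Self-dual 2-forms on an almost-Hermitian space. -/

section Dual

variable {g J M : Mat}

theorem transpose_mul_metric (hJ : J * J = -1) (ho : J.transpose * g * J = g) :
    J.transpose * g = -(g * J) := by
  have h : J.transpose * g * J * J = g * J := by rw [ho]
  rw [Matrix.mul_assoc _ J J, hJ] at h
  rw [← h]; simp

theorem inv_mul_transpose (hdet : IsUnit g.det) (hJ : J * J = -1)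
    (ho : J.transpose * g * J = g) : g⁻¹ * J.transpose = -(J * g⁻¹) := by
  have h : g⁻¹ * (J.transpose * g) * g⁻¹ = g⁻¹ * -(g * J) * g⁻¹ := by
    rw [transpose_mul_metric hJ ho]
  rw [Matrix.mul_assoc, Matrix.mul_nonsing_inv_cancel_right _ _ hdet, Matrix.mul_neg,
    Matrix.nonsing_inv_mul_cancel_left _ _ hdet] at h
  rw [h, Matrix.neg_mul]

/-- Contracting `-½ κ ∧ κ` with a skew bivector: the last two terms of the wedge square agree after
exchanging `r` and `s`, because `N` is skew. -/
theorem sum_volume_mul {κ N : Mat} (hN : N.transpose = -N) (a b : Fin 4) :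
    ∑ r, ∑ s, -(κ a b * κ r s - κ a r * κ b s + κ a s * κ b r) * N r s
      = -(κ a b * (κ.transpose * N).trace) + 2 * (κ * N * κ.transpose) a b := by
  have h1 : (κ.transpose * N).trace = ∑ r, ∑ s, κ r s * N r s := by
    simp only [Matrix.trace, Matrix.diag, Matrix.mul_apply, Matrix.transpose_apply]
    exact Finset.sum_comm
  have h2 : (κ * N * κ.transpose) a b = ∑ r, ∑ s, κ a r * N r s * κ b s := by
    simp only [Matrix.mul_apply, Matrix.transpose_apply, Finset.sum_mul]
    exact Finset.sum_comm
  have h3 : (κ * N * κ.transpose) a b = ∑ r, ∑ s, -(κ a s * N r s * κ b r) := by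
    rw [h2, Finset.sum_comm]
    refine Finset.sum_congr rfl fun r _ => Finset.sum_congr rfl fun s _ => ?_
    have : N s r = -N r s := congrFun (congrFun hN r) s
    rw [this]; ring
  rw [two_mul]
  nth_rw 1 [h2]
  rw [h3, h1, Finset.mul_sum, ← Finset.sum_neg_distrib, ← Finset.sum_add_distrib,
    ← Finset.sum_add_distrib]
  refine Finset.sum_congr rfl fun r _ => ?_
  rw [Finset.mul_sum, ← Finset.sum_neg_distrib, ← Finset.sum_add_distrib,
    ← Finset.sum_add_distrib]
  exact Finset.sum_congr rfl fun s _ => by ring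

/-- A 2-form is self-dual, for the volume form `-½ κ ∧ κ` of an almost-Hermitian structure, if and
only if it commutes with `J` and is orthogonal to it. -/
theorem selfDual_iff (hg : g.transpose = g) (hdet : IsUnit g.det) (hJ : J * J = -1)
    (ho : J.transpose * g * J = g) (hM : M.transpose = -M) {κ : Mat}
    (hκ : κ = (g * J).transpose) :
    (∀ a b, (1 / 2) * ∑ e, ∑ f, ∑ r, ∑ s,
      -(κ a b * κ r s - κ a r * κ b s + κ a s * κ b r) * g⁻¹ r e * g⁻¹ s f * M e f = M a b) ↔
    ((J * (g⁻¹ * M)).trace = 0 ∧ J * (g⁻¹ * M) = g⁻¹ * M * J) := by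
  have hgi : g⁻¹.transpose = g⁻¹ := by rw [Matrix.transpose_nonsing_inv, hg]
  have hN : (g⁻¹ * M * g⁻¹).transpose = -(g⁻¹ * M * g⁻¹) := by
    simp [Matrix.transpose_mul, hgi, hM, Matrix.mul_assoc]
  have hκ' : κ = -(g * J) := by
    rw [hκ, Matrix.transpose_mul, hg, transpose_mul_metric hJ ho]
  have hsum : ∀ a b, ∑ e, ∑ f, ∑ r, ∑ s,
      -(κ a b * κ r s - κ a r * κ b s + κ a s * κ b r) * g⁻¹ r e * g⁻¹ s f * M e f
      = ∑ r, ∑ s, -(κ a b * κ r s - κ a r * κ b s + κ a s * κ b r) * (g⁻¹ * M * g⁻¹) r s := by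
    intro a b
    have : ∀ r s, (g⁻¹ * M * g⁻¹) r s = ∑ e, ∑ f, g⁻¹ r e * g⁻¹ s f * M e f := by
      intro r s
      simp only [Matrix.mul_apply, Finset.sum_mul]
      rw [Finset.sum_comm]
      refine Finset.sum_congr rfl fun e _ => Finset.sum_congr rfl fun f _ => ?_
      rw [← Matrix.transpose_apply g⁻¹ s f, hgi]; ring
    simp only [this, Finset.mul_sum]
    calc _ = ∑ e, ∑ r, ∑ s, ∑ f,
        -(κ a b * κ r s - κ a r * κ b s + κ a s * κ b r) * (g⁻¹ r e * g⁻¹ s f * M e f) := by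
          refine Finset.sum_congr rfl fun e _ => ?_
          rw [Finset.sum_comm]
          refine Finset.sum_congr rfl fun r _ => ?_
          rw [Finset.sum_comm]
          exact Finset.sum_congr rfl fun s _ => Finset.sum_congr rfl fun f _ => by ring
      _ = _ := by
          rw [Finset.sum_comm]
          refine Finset.sum_congr rfl fun r _ => ?_
          rw [Finset.sum_comm]
  have ht : (κ.transpose * (g⁻¹ * M * g⁻¹)).trace = (J * (g⁻¹ * M)).trace := by
    have : g * J * (g⁻¹ * M * g⁻¹) = g * (J * (g⁻¹ * M) * g⁻¹) := by
      simp only [Matrix.mul_assoc]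
    rw [hκ, Matrix.transpose_transpose, this, Matrix.trace_mul_comm,
      Matrix.nonsing_inv_mul_cancel_right _ _ hdet]
  have hc : κ * (g⁻¹ * M * g⁻¹) * κ.transpose = J.transpose * M * J := by
    rw [hκ, Matrix.transpose_transpose, Matrix.transpose_mul, hg]
    calc _ = J.transpose * (g * g⁻¹) * M * (g⁻¹ * g) * J := by simp only [Matrix.mul_assoc]
      _ = _ := by
        rw [Matrix.mul_nonsing_inv _ hdet, Matrix.nonsing_inv_mul _ hdet, Matrix.mul_one,
          Matrix.mul_one]
  -- With an index raised, so that `m = g⁻¹ M`, the Hodge star is `m ↦ ½ tr(J m) J - J m J`.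
  have hmain : (∀ a b, (1 / 2) * ∑ e, ∑ f, ∑ r, ∑ s,
      -(κ a b * κ r s - κ a r * κ b s + κ a s * κ b r) * g⁻¹ r e * g⁻¹ s f * M e f = M a b) ↔
      g⁻¹ * M = ((J * (g⁻¹ * M)).trace / 2) • J - J * (g⁻¹ * M) * J := by
    simp only [hsum, sum_volume_mul hN, ht, hc]
    have e1 : g⁻¹ * (((J * (g⁻¹ * M)).trace / 2) • (g * J) + J.transpose * M * J)
        = ((J * (g⁻¹ * M)).trace / 2) • J - J * (g⁻¹ * M) * J := by
      have e2 : g⁻¹ * (J.transpose * M * J) = g⁻¹ * J.transpose * (M * J) := by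
        simp only [Matrix.mul_assoc]
      rw [Matrix.mul_add, Matrix.mul_smul, Matrix.nonsing_inv_mul_cancel_left _ _ hdet, e2,
        inv_mul_transpose hdet hJ ho]
      simp only [Matrix.neg_mul, Matrix.mul_assoc, sub_eq_add_neg]
    rw [← e1]
    constructor
    · intro h
      congr 1
      ext a b
      rw [← h a b]
      simp [hκ']
      ring
    · intro h a b
      have h' := congrArg (fun X => g * X) h
      simp only [Matrix.mul_nonsing_inv_cancel_left _ _ hdet] at h'
      conv_rhs => rw [h']
      simp [hκ']
      ring
  rw [hmain]
  generalize g⁻¹ * M = m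
  constructor
  · intro h
    have h1 : J * m = -((J * m).trace / 2) • (1 : Mat) + m * J := by
      have e3 : J * (J * m * J) = J * J * (m * J) := by simp only [Matrix.mul_assoc]
      conv_lhs => rw [h]
      rw [Matrix.mul_sub, Matrix.mul_smul, hJ, e3, hJ]
      simp
    -- Both sides contain the same trace `tr (J m)`, while the identity matrix contributes an extra
    -- `-2 tr (J m)`; hence that trace is zero.
    have h2 := congrArg Matrix.trace h1
    rw [Matrix.trace_add, Matrix.trace_smul, Matrix.trace_mul_comm m J] at h2
    simp at h2
    rw [h2] at h1
    exact ⟨h2, by simpa using h1⟩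
  · rintro ⟨h1, h2⟩
    rw [h1, h2, Matrix.mul_assoc, hJ]
    simp

end Dual

/-! ### Curvature tensors of Kähler type -/

/-- The algebraic properties of the curvature tensor of a Kähler metric. -/
structure IsKahlerCurvature (g J : Mat) (R : Fin 4 → Fin 4 → Mat) : Prop where
  symm : g.transpose = g
  isUnit_det : IsUnit g.det
  sq : J * J = -1
  orthogonal : J.transpose * g * J = g
  antisymm : ∀ c d, R d c = -R c d
  bianchi : ∀ a b c d, R c d a b + R d b a c + R b c a d = 0
  metric : ∀ c d, g * R c d + (R c d).transpose * g = 0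
  comm : ∀ c d, J * R c d = R c d * J

namespace IsKahlerCurvature

variable {g J : Mat} {R : Fin 4 → Fin 4 → Mat}

/-- This is the Ricci form. The Bianchi identity splits the trace into two contractions, and
commuting `J` past the curvature turns each one into a Ricci contraction. -/
theorem trace_mul (h : IsKahlerCurvature g J R) (c d : Fin 4) :
    (J * R c d).trace = (J.transpose * ricM R) c d - (J.transpose * ricM R) d c := by
  have key : ∀ c d, ∑ b, ∑ a, J b a * R b d a c = (J.transpose * ricM R) c d := by
    intro c d
    have h1 : ∀ b, ∑ a, J b a * R b d a c = ∑ e, R b d b e * J e c := by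
      intro b
      rw [← Matrix.mul_apply, ← Matrix.mul_apply, h.comm]
    simp only [h1, Matrix.mul_apply, Matrix.transpose_apply, ricM, Matrix.of_apply,
      Finset.mul_sum]
    rw [Finset.sum_comm]
    exact Finset.sum_congr rfl fun b _ => Finset.sum_congr rfl fun a _ => by ring
  rw [← key, ← key, ← Finset.sum_sub_distrib]
  simp only [Matrix.trace, Matrix.diag, Matrix.mul_apply]
  refine Finset.sum_congr rfl fun b _ => ?_
  rw [← Finset.sum_sub_distrib]
  refine Finset.sum_congr rfl fun a _ => ?_
  have h1 := h.bianchi a b c d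
  have h2 := congrFun (congrFun (h.antisymm b d) a) c
  rw [Matrix.neg_apply] at h2
  linear_combination J b a * h1 - J b a * h2

/-- A `g`-skew endomorphism is conjugate to minus its transpose. -/
theorem trace_eq_zero (h : IsKahlerCurvature g J R) (c d : Fin 4) : (R c d).trace = 0 := by
  have h1 : R c d = -(g⁻¹ * (R c d).transpose * g) := by
    have := h.metric c d
    rw [Matrix.mul_assoc, ← Matrix.mul_neg, ← neg_eq_of_add_eq_zero_right this, neg_neg,
      Matrix.nonsing_inv_mul_cancel_left _ _ h.isUnit_det]
  have h2 := congrArg Matrix.trace h1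
  rw [Matrix.trace_neg, Matrix.trace_mul_comm, Matrix.mul_nonsing_inv_cancel_left _ _ h.isUnit_det,
    Matrix.trace_transpose] at h2
  linarith

/-- Contract the Bianchi identity: the skew part of the Ricci contraction is the trace of `R b d`,
which vanishes. -/
theorem ricM_symm (h : IsKahlerCurvature g J R) : (ricM R).transpose = ricM R := by
  ext b d
  have h1 := h.trace_eq_zero b d
  have h2 : ∑ a, (R a d a b - R a b a d - R b d a a) = 0 := by
    refine Finset.sum_eq_zero fun a _ => ?_
    have h3 := h.bianchi a b a d
    have h4 := congrFun (congrFun (h.antisymm a b) a) d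
    have h5 := congrFun (congrFun (h.antisymm b d) a) a
    rw [Matrix.neg_apply] at h4 h5
    linarith
  simp only [Matrix.trace, Matrix.diag] at h1
  rw [Finset.sum_sub_distrib, Finset.sum_sub_distrib, h1] at h2
  simp only [ricM, Matrix.transpose_apply, Matrix.of_apply]
  linarith

theorem inv_symm (h : IsKahlerCurvature g J R) : g⁻¹.transpose = g⁻¹ := by
  rw [Matrix.transpose_nonsing_inv, h.symm]

/-- The scalar curvature is recovered by contracting the Ricci form with `J g⁻¹`. The two halves of
`trace_mul` contribute equally because `J g⁻¹` is skew, and the sign comes from `J² = -1`. -/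
theorem sum_trace (h : IsKahlerCurvature g J R) :
    ∑ c, ∑ d, (J * g⁻¹) c d * (J * R c d).trace = -2 * scal g R := by
  have ha : (J * g⁻¹).transpose = -(J * g⁻¹) := by
    rw [Matrix.transpose_mul, h.inv_symm, inv_mul_transpose h.isUnit_det h.sq h.orthogonal]
  have e1 : ∑ c, ∑ d, (J * g⁻¹) c d * (J.transpose * ricM R) c d = -scal g R := by
    have : ∑ c, ∑ d, (J * g⁻¹) c d * (J.transpose * ricM R) c d
        = ((J * g⁻¹).transpose * (J.transpose * ricM R)).trace := by
      simp only [Matrix.trace, Matrix.diag, Matrix.mul_apply, Matrix.transpose_apply]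
      rw [Finset.sum_comm]
    have e0 : g⁻¹.transpose * J.transpose * (J.transpose * ricM R)
        = g⁻¹.transpose * (J.transpose * J.transpose) * ricM R := by
      simp only [Matrix.mul_assoc]
    rw [this, Matrix.transpose_mul, e0, ← Matrix.transpose_mul, h.sq]
    simp only [Matrix.transpose_neg, Matrix.transpose_one, Matrix.mul_neg, Matrix.mul_one,
      Matrix.neg_mul, Matrix.trace_neg, scal]
    congr 1
    simp only [Matrix.trace, Matrix.diag, Matrix.mul_apply, Matrix.transpose_apply]
    rw [Finset.sum_comm]
  have e2 : ∑ c, ∑ d, (J * g⁻¹) c d * (J.transpose * ricM R) d c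
      = -∑ c, ∑ d, (J * g⁻¹) c d * (J.transpose * ricM R) c d := by
    rw [Finset.sum_comm, ← Finset.sum_neg_distrib]
    refine Finset.sum_congr rfl fun c _ => ?_
    rw [← Finset.sum_neg_distrib]
    refine Finset.sum_congr rfl fun d _ => ?_
    have := congrFun (congrFun ha c) d
    rw [Matrix.transpose_apply, Matrix.neg_apply] at this
    rw [this]; ring
  simp only [h.trace_mul, mul_sub, Finset.sum_sub_distrib, e2, e1]
  ring

/-- Since `J` is `g`-skew, the two terms containing `g` reproduce the two containing the identity,
whence the factor 2. -/
theorem trace_mul_kulkarni (h : IsKahlerCurvature g J R) (P : Mat) (c d : Fin 4) : (J * kulkarni g P c d).trace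
      = 2 * ((J.transpose * P) c d - (J.transpose * P) d c) := by
  have e : ∀ c d, ∑ b, ∑ a, J b a * (g b d * (g⁻¹ * P) a c) = -(J.transpose * P) d c := by
    intro c d
    have : ∑ b, ∑ a, J b a * (g b d * (g⁻¹ * P) a c)
        = (g.transpose * (J * (g⁻¹ * P))) d c := by
      simp only [Matrix.mul_apply (M := g.transpose), Matrix.mul_apply (M := J), Matrix.transpose_apply,
        Finset.mul_sum]
      exact Finset.sum_congr rfl fun b _ => Finset.sum_congr rfl fun a _ => by ring
    rw [this, h.symm, ← Matrix.mul_assoc, ← Matrix.mul_assoc, ← neg_neg (g * J),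
      ← transpose_mul_metric h.sq h.orthogonal, Matrix.neg_mul, Matrix.neg_mul,
      Matrix.mul_nonsing_inv_cancel_right _ _ h.isUnit_det, Matrix.neg_apply]
  have e' : ∀ c d, ∑ b, ∑ a, J b a * ((1 : Mat) a c * P b d) = (J.transpose * P) c d := by
    intro c d
    simp [Matrix.one_apply, Matrix.mul_apply]
  simp only [Matrix.trace, Matrix.diag, Matrix.mul_apply (M := J), kulkarni, Matrix.of_apply, mul_add,
    mul_sub, Finset.sum_add_distrib, Finset.sum_sub_distrib, e, e']
  ring

/-- The Ricci part of the Schouten tensor cancels the Ricci form exactly in dimension four, so only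
its scalar part survives. -/
theorem trace_mul_weylUp (h : IsKahlerCurvature g J R) (c d : Fin 4) :
    (J * weylUp g R c d).trace = -(scal g R / 3) * (g * J) c d := by
  have hgJ : ∀ c d, (J.transpose * g) c d = -(g * J) c d := by
    intro c d
    rw [transpose_mul_metric h.sq h.orthogonal, Matrix.neg_apply]
  have hgJ' : (g * J) d c = -(g * J) c d := by
    have : (g * J).transpose = -(g * J) := by
      rw [Matrix.transpose_mul, h.symm, transpose_mul_metric h.sq h.orthogonal]
    exact congrFun (congrFun this c) d
  rw [weylUp, Matrix.mul_sub, Matrix.trace_sub, h.trace_mul, h.trace_mul_kulkarni]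
  simp only [schouten, Matrix.mul_sub, Matrix.sub_apply, Matrix.mul_smul, Matrix.smul_apply,
    smul_eq_mul, hgJ, hgJ']
  ring

end IsKahlerCurvature

end Chart

namespace Chart

/-! ### Kulkarni–Nomizu products commuting with a complex structure -/

/-- The standard complex structure. -/
def stdJ : Mat := !![0, 0, -1, 0; 0, 0, 0, -1; 1, 0, 0, 0; 0, 1, 0, 0]

theorem mul_wedge_mul_transpose (E : Mat) (x y : Fin 4 → ℝ) :
    E * wedge x y * E.transpose = wedge (E.mulVec x) (E.mulVec y) := by
  simp only [wedge, Matrix.mul_sub, Matrix.sub_mul, Matrix.mul_vecMulVec, Matrix.vecMulVec_mul,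
    Matrix.vecMul_transpose]

/-- A trace-free complex-linear endomorphism acts trivially on the complex determinant. -/
theorem stdJ_mul_wedge {p : Mat} (hp : stdJ * p = p * stdJ) (h0 : p.trace = 0)
    (h1 : (stdJ * p).trace = 0) (x y : Fin 4 → ℝ) :
    stdJ * (wedge x (p.mulVec y) + wedge (p.mulVec x) y) * stdJ.transpose
      = wedge x (p.mulVec y) + wedge (p.mulVec x) y := by
  have e : ∀ i j, (stdJ * p) i j = (p * stdJ) i j := fun i j => by rw [hp]
  have e00 := e 0 0
  have e01 := e 0 1
  have e02 := e 0 2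
  have e03 := e 0 3
  have e10 := e 1 0
  have e11 := e 1 1
  have e12 := e 1 2
  have e13 := e 1 3
  simp [Matrix.mul_apply, stdJ, Fin.sum_univ_four] at e00 e01 e02 e03 e10 e11 e12 e13
  simp [Matrix.trace, Matrix.diag, Fin.sum_univ_four] at h0
  simp [Matrix.trace, Matrix.diag, Matrix.mul_apply, stdJ, Fin.sum_univ_four] at h1
  have h11 : p 1 1 = -p 0 0 := by linarith
  have h31 : p 3 1 = -p 2 0 := by linarith
  have hm : ∀ z j, p.mulVec z j = p j 0 * z 0 + p j 1 * z 1 + p j 2 * z 2 + p j 3 * z 3 := by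
    intro z j
    simp only [Matrix.mulVec, dotProduct, Fin.sum_univ_four]
  have hA : ∀ i j, (wedge x (p.mulVec y) + wedge (p.mulVec x) y) i j
      = x i * p.mulVec y j - p.mulVec y i * x j + (p.mulVec x i * y j - y i * p.mulVec x j) :=
    fun i j => rfl
  have h02 : p 0 2 = -p 2 0 := by linarith
  have h03 : p 0 3 = -p 2 1 := by linarith
  have h12 : p 1 2 = -p 3 0 := by linarith
  have h13 : p 1 3 = p 2 0 := by linarith
  have h22 : p 2 2 = p 0 0 := by linarith
  have h23 : p 2 3 = p 0 1 := by linarith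
  have h32 : p 3 2 = p 1 0 := by linarith
  have h33 : p 3 3 = -p 0 0 := by linarith
  have hw : ∀ A : Mat, stdJ * A * stdJ.transpose = !![A 2 2, A 2 3, -A 2 0, -A 2 1;
      A 3 2, A 3 3, -A 3 0, -A 3 1; -A 0 2, -A 0 3, A 0 0, A 0 1;
      -A 1 2, -A 1 3, A 1 0, A 1 1] := by
    intro A
    ext i j
    fin_cases i <;> fin_cases j <;>
      simp [Matrix.mul_apply, stdJ, Fin.sum_univ_four, Matrix.vecMul, dotProduct]
  rw [hw]
  ext i j
  fin_cases i <;> fin_cases j <;>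
    simp [-Matrix.add_apply, hA, hm, h11, h31, h02, h03, h12, h13, h22, h23, h32, h33] <;> ring

/-- In terms of `π = g⁻¹ P`, the product is the derivation extension of `π` applied to the bivector
`e_c ∧ e_d`, with an index lowered. This is the form to which `stdJ_mul_wedge` applies. -/
theorem kulkarni_eq_wedge {g π : Mat} (hg : g.transpose = g) (hdet : IsUnit g.det) (c d : Fin 4) :
    kulkarni g (g * π) c d
      = (wedge (Pi.single c 1) (π.mulVec (Pi.single d 1))
        + wedge (π.mulVec (Pi.single c 1)) (Pi.single d 1)) * g := by
  have h1 : ∀ b d, ∑ e, π e d * g e b = (g * π) b d := by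
    intro b d
    rw [Matrix.mul_apply]
    refine Finset.sum_congr rfl fun e _ => ?_
    have : g e b = g b e := congrFun (congrFun hg b) e
    rw [this, mul_comm]
  have h2 : ∀ b d, g d b = g b d := fun b d => congrFun (congrFun hg b) d
  ext a b
  simp only [kulkarni, Matrix.nonsing_inv_mul_cancel_left _ _ hdet, Matrix.of_apply, wedge,
    Matrix.add_mul, Matrix.sub_mul, Matrix.add_apply, Matrix.sub_apply]
  simp only [Matrix.mul_apply, Matrix.vecMulVec_apply, Matrix.mulVec_single_one, Matrix.col_apply,
    mul_assoc, ← Finset.mul_sum]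
  simp only [Matrix.mul_apply] at h1
  simp only [h1, Pi.single_apply, ite_mul, one_mul, zero_mul, Finset.sum_ite_eq',
    Finset.mem_univ, if_true, Matrix.one_apply, h2 b d, h2 b c]
  ring

/-- A complex structure interchanging the first two and the last two coordinates. -/
def IsOffDiagonal (J : Mat) : Prop :=
  (J 0 0 = 0 ∧ J 0 1 = 0 ∧ J 1 0 = 0 ∧ J 1 1 = 0) ∧
    (J 2 2 = 0 ∧ J 2 3 = 0 ∧ J 3 2 = 0 ∧ J 3 3 = 0)

/-- The frame is `e₀, e₁, J e₀, J e₁`. The block shape makes it a basis: `J² = -1` says that the two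
off-diagonal blocks are inverse to each other up to sign. -/
theorem IsOffDiagonal.exists_frame {J : Mat} (h : IsOffDiagonal J) (hJ : J * J = -1) :
    ∃ E E' : Mat, E * E' = 1 ∧ J * E = E * stdJ := by
  obtain ⟨⟨h00, h01, h10, h11⟩, h22, h23, h32, h33⟩ := h
  have e : ∀ i j, (J * J) i j = (-1 : Mat) i j := fun i j => by rw [hJ]
  simp only [Matrix.mul_apply, Fin.sum_univ_four] at e
  refine ⟨!![1, 0, 0, 0; 0, 1, 0, 0; 0, 0, J 2 0, J 2 1; 0, 0, J 3 0, J 3 1],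
    !![1, 0, 0, 0; 0, 1, 0, 0; 0, 0, -J 0 2, -J 0 3; 0, 0, -J 1 2, -J 1 3], ?_, ?_⟩
  · have e22 := e 2 2
    have e23 := e 2 3
    have e32 := e 3 2
    have e33 := e 3 3
    simp [h22, h23, h32, h33] at e22 e23 e32 e33
    ext i j
    fin_cases i <;> fin_cases j <;> simp [Matrix.mul_apply, Fin.sum_univ_four] <;> linarith
  · have e00 := e 0 0
    have e01 := e 0 1
    have e10 := e 1 0
    have e11 := e 1 1
    simp [h00, h01, h10, h11] at e00 e01 e10 e11
    ext i j
    fin_cases i <;> fin_cases j <;>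
      simp [Matrix.mul_apply, Fin.sum_univ_four, stdJ, *]

/-- In a frame where `J` is standard, the trace-free complex-linear `π` kills the complex
determinant, so it sends every bivector to a `J`-invariant one. Lowering an index turns invariance
of the bivector into commutation with `J`. -/
theorem kulkarni_comm {g J π : Mat} (hg : g.transpose = g) (hdet : IsUnit g.det)
    (hJ : J * J = -1) (ho : J.transpose * g * J = g) (hoff : IsOffDiagonal J)
    (hπ : J * π = π * J) (h0 : π.trace = 0) (h1 : (J * π).trace = 0) (c d : Fin 4) :
    J * kulkarni g (g * π) c d = kulkarni g (g * π) c d * J := by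
  obtain ⟨E, E', hE, hJE⟩ := hoff.exists_frame hJ
  have hE' : E' * E = 1 := mul_eq_one_comm.1 hE
  have hEJ : E' * J = stdJ * E' := by
    calc E' * J = E' * (J * E) * E' := by rw [Matrix.mul_assoc, Matrix.mul_assoc, hE, Matrix.mul_one]
      _ = E' * E * stdJ * E' := by rw [hJE]; simp only [Matrix.mul_assoc]
      _ = stdJ * E' := by rw [hE', Matrix.one_mul]
  set p := E' * π * E with hp
  have hpE : E * p = π * E := by
    rw [hp, ← Matrix.mul_assoc, ← Matrix.mul_assoc, hE, Matrix.one_mul]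
  have hcomm : stdJ * p = p * stdJ := by
    calc stdJ * p = stdJ * E' * (π * E) := by rw [hp]; simp only [Matrix.mul_assoc]
      _ = E' * (J * π) * E := by rw [← hEJ]; simp only [Matrix.mul_assoc]
      _ = E' * π * (J * E) := by rw [hπ]; simp only [Matrix.mul_assoc]
      _ = p * stdJ := by rw [hJE, hp]; simp only [Matrix.mul_assoc]
  have ht0 : p.trace = 0 := by
    rw [hp, Matrix.trace_mul_comm, ← Matrix.mul_assoc, hE, Matrix.one_mul, h0]
  have ht1 : (stdJ * p).trace = 0 := by
    have : stdJ * p = E' * (J * π) * E := by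
      calc stdJ * p = stdJ * E' * (π * E) := by rw [hp]; simp only [Matrix.mul_assoc]
        _ = E' * (J * π) * E := by rw [← hEJ]; simp only [Matrix.mul_assoc]
    rw [this, Matrix.trace_mul_comm, ← Matrix.mul_assoc, hE, Matrix.one_mul, h1]
  have hw : ∀ x y : Fin 4 → ℝ, J * (wedge x (π.mulVec y) + wedge (π.mulVec x) y) * J.transpose
      = wedge x (π.mulVec y) + wedge (π.mulVec x) y := by
    intro x y
    have hx : ∀ x : Fin 4 → ℝ, x = E.mulVec (E'.mulVec x) := fun x => by
      rw [Matrix.mulVec_mulVec, hE, Matrix.one_mulVec]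
    have hb : wedge x (π.mulVec y) + wedge (π.mulVec x) y
        = E * (wedge (E'.mulVec x) (p.mulVec (E'.mulVec y))
          + wedge (p.mulVec (E'.mulVec x)) (E'.mulVec y)) * E.transpose := by
      rw [Matrix.mul_add, Matrix.add_mul, mul_wedge_mul_transpose, mul_wedge_mul_transpose,
        Matrix.mulVec_mulVec _ E p, Matrix.mulVec_mulVec _ E p, hpE, ← Matrix.mulVec_mulVec,
        ← Matrix.mulVec_mulVec, ← hx, ← hx]
    rw [hb]
    conv_rhs => rw [← stdJ_mul_wedge hcomm ht0 ht1]
    have hJE' : E.transpose * J.transpose = stdJ.transpose * E.transpose := by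
      rw [← Matrix.transpose_mul, hJE, Matrix.transpose_mul]
    generalize wedge (E'.mulVec x) (p.mulVec (E'.mulVec y))
          + wedge (p.mulVec (E'.mulVec x)) (E'.mulVec y) = A
    calc J * (E * A * E.transpose) * J.transpose = J * E * A * (E.transpose * J.transpose) := by
          simp only [Matrix.mul_assoc]
      _ = E * (stdJ * A * stdJ.transpose) * E.transpose := by
          rw [hJE, hJE']; simp only [Matrix.mul_assoc]
  rw [kulkarni_eq_wedge hg hdet]
  generalize hA : wedge (Pi.single c 1) (π.mulVec (Pi.single d 1))
        + wedge (π.mulVec (Pi.single c 1)) (Pi.single d 1) = A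
  have hwA : J * A * J.transpose = A := by rw [← hA]; exact hw _ _
  have hgJ : g * J = -(J.transpose * g) := by rw [transpose_mul_metric hJ ho, neg_neg]
  have hJA : A * J.transpose = -(J * A) := by
    calc A * J.transpose = -(J * J) * A * J.transpose := by rw [hJ]; simp
      _ = -(J * (J * A * J.transpose)) := by simp only [Matrix.mul_assoc, Matrix.neg_mul]
      _ = -(J * A) := by rw [hwA]
  rw [Matrix.mul_assoc, hgJ, Matrix.mul_neg, ← Matrix.mul_assoc A, hJA]
  simp [Matrix.mul_assoc]

/-! ### The Ricci and Weyl tensors of a curvature tensor of Kähler type. -/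

namespace IsKahlerCurvature

variable {g J : Mat} {R : Fin 4 → Fin 4 → Mat}

theorem lower_antisymm (h : IsKahlerCurvature g J R) (a b c d : Fin 4) :
    (g * R c d) b a = -(g * R c d) a b := by
  have h1 : (g * R c d).transpose = -(g * R c d) := by
    rw [Matrix.transpose_mul, h.symm]
    exact eq_neg_of_add_eq_zero_right (h.metric c d)
  exact congrFun (congrFun h1 a) b

theorem lower_antisymm' (h : IsKahlerCurvature g J R) (a b c d : Fin 4) :
    (g * R d c) a b = -(g * R c d) a b := by
  rw [h.antisymm c d, Matrix.mul_neg, Matrix.neg_apply]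

theorem lower_bianchi (h : IsKahlerCurvature g J R) (a b c d : Fin 4) :
    (g * R c d) a b + (g * R d b) a c + (g * R b c) a d = 0 := by
  simp only [Matrix.mul_apply, ← Finset.sum_add_distrib, ← mul_add, h.bianchi, mul_zero,
    Finset.sum_const_zero]

/-- The usual octahedron argument: four instances of the Bianchi identity are combined using the two
skew-symmetries. -/
theorem pair_symm (h : IsKahlerCurvature g J R) (a b c d : Fin 4) :
    (g * R c d) a b = (g * R a b) c d := by
  have b1 := h.lower_bianchi a b c d
  have b2 := h.lower_bianchi b c d a
  have b3 := h.lower_bianchi c d a b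
  have b4 := h.lower_bianchi d a b c
  have s := h.lower_antisymm
  have s' := h.lower_antisymm'
  linarith [s a b c d, s a b d c, s b c a d, s b c d a, s c d a b, s c d b a, s a c d b, s a c b d,
    s a d b c, s a d c b, s b d a c, s b d c a, s' a b c d, s' a c b d, s' a d b c, s' b c a d,
    s' b d a c, s' c d a b, s' b a c d, s' c a b d, s' d a b c, s' c b a d, s' d b a c, s' d c a b]

/-- Pair symmetry transfers commutation with `J` from the endomorphism indices to the 2-form
indices. -/
theorem sum_mul_right (h : IsKahlerCurvature g J R) (c d : Fin 4) :
    ∑ e, J e d • R c e = -∑ e, J e c • R e d := by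
  have h1 : g * ∑ e, J e d • R c e = g * -∑ e, J e c • R e d := by
    ext a b
    have h2 : (J.transpose * (g * R a b)) c d = -((g * R a b) * J) c d := by
      rw [← Matrix.mul_assoc, transpose_mul_metric h.sq h.orthogonal, Matrix.neg_mul,
        Matrix.mul_assoc, h.comm, Matrix.neg_apply, Matrix.mul_assoc]
    simp only [Matrix.mul_apply (M := J.transpose), Matrix.mul_apply (N := J),
      Matrix.transpose_apply, h.pair_symm _ _ a b] at h2
    simp only [Matrix.mul_neg, Matrix.mul_sum, Matrix.mul_smul, Matrix.neg_apply,
      Matrix.sum_apply, Matrix.smul_apply, smul_eq_mul]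
    rw [h2, neg_neg]
    exact Finset.sum_congr rfl fun e _ => mul_comm _ _
  have h3 := congrArg (fun X => g⁻¹ * X) h1
  simpa only [Matrix.nonsing_inv_mul_cancel_left _ _ h.isUnit_det] using h3

/-- This is `J`-invariance of the Ricci tensor: `J` is moved across the 2-form indices by
`sum_mul_right` and then through the endomorphism. -/
theorem ricM_mul (h : IsKahlerCurvature g J R) : ricM R * J = -(J.transpose * ricM R) := by
  ext b d
  have h1 : ∀ a, ∑ e, J e d * R a e a b = -∑ e, J e a * R e d a b := by
    intro a
    have := congrFun (congrFun (h.sum_mul_right a d) a) b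
    simpa [Matrix.sum_apply] using this
  have h2 : ∀ e, ∑ a, J e a * R e d a b = ∑ f, R e d e f * J f b := by
    intro e
    rw [← Matrix.mul_apply, ← Matrix.mul_apply, h.comm]
  simp only [Matrix.neg_apply, Matrix.mul_apply, Matrix.transpose_apply, ricM, Matrix.of_apply,
    Finset.sum_mul, Finset.mul_sum]
  rw [Finset.sum_comm]
  have h3 : ∑ a, ∑ e, R a e a b * J e d = -∑ a, ∑ e, J e a * R e d a b := by
    rw [← Finset.sum_neg_distrib]
    refine Finset.sum_congr rfl fun a _ => ?_
    rw [← h1]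
    exact Finset.sum_congr rfl fun e _ => mul_comm _ _
  rw [h3, Finset.sum_comm, Finset.sum_congr rfl fun e _ => h2 e, Finset.sum_comm]
  congr 1
  exact Finset.sum_congr rfl fun e _ => Finset.sum_congr rfl fun f _ => mul_comm _ _

/-- For a Kähler curvature tensor, the Weyl tensor commutes with `J` and is orthogonal to it if
and only if the scalar curvature vanishes. -/
theorem weylUp_iff (h : IsKahlerCurvature g J R) (hoff : IsOffDiagonal J) :
    (∀ c d, (J * weylUp g R c d).trace = 0 ∧ J * weylUp g R c d = weylUp g R c d * J) ↔
      scal g R = 0 := by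
  constructor
  · intro hw
    by_contra hs
    have h1 : g * J = 0 := by
      ext c d
      have := (hw c d).1
      rw [h.trace_mul_weylUp] at this
      simpa [hs] using this
    have h2 : J = 0 := by
      rw [← Matrix.nonsing_inv_mul_cancel_left g J h.isUnit_det, h1, Matrix.mul_zero]
    have h3 := h.sq
    rw [h2] at h3
    have := congrFun (congrFun h3 0) 0
    simp at this
  · intro hs c d
    refine ⟨by rw [h.trace_mul_weylUp, hs]; simp, ?_⟩
    -- With zero scalar curvature the Schouten tensor is half the Ricci tensor; its raised form
    -- commutes with `J` and is trace-free, as `kulkarni_comm` requires.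
    have hS : schouten g R = g * ((1 / 2 : ℝ) • (g⁻¹ * ricM R)) := by
      rw [schouten, hs, Matrix.mul_smul, Matrix.mul_nonsing_inv_cancel_left _ _ h.isUnit_det]
      simp
    have hc : J * (g⁻¹ * ricM R) = g⁻¹ * ricM R * J := by
      rw [Matrix.mul_assoc, h.ricM_mul, Matrix.mul_neg, ← Matrix.mul_assoc, ← Matrix.mul_assoc,
        inv_mul_transpose h.isUnit_det h.sq h.orthogonal, Matrix.neg_mul, neg_neg]
    have ht : (g⁻¹ * ricM R).trace = 0 := by
      rw [← hs, scal]
      simp only [Matrix.trace, Matrix.diag, Matrix.mul_apply]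
      refine Finset.sum_congr rfl fun a _ => Finset.sum_congr rfl fun b _ => ?_
      have : ricM R b a = ricM R a b := congrFun (congrFun h.ricM_symm a) b
      rw [this]
    -- Transposing shows that this trace equals its own negative, since `J g⁻¹` is skew and the
    -- Ricci tensor is symmetric.
    have ht' : (J * (g⁻¹ * ricM R)).trace = 0 := by
      have h1 : (J * (g⁻¹ * ricM R)).trace = -(J * (g⁻¹ * ricM R)).trace := by
        conv_lhs => rw [← Matrix.trace_transpose, ← Matrix.mul_assoc, Matrix.transpose_mul,
          Matrix.transpose_mul, h.ricM_symm, h.inv_symm,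
          inv_mul_transpose h.isUnit_det h.sq h.orthogonal, Matrix.mul_neg, Matrix.trace_neg,
          Matrix.trace_mul_comm, Matrix.mul_assoc]
      linarith
    rw [weylUp, Matrix.mul_sub, Matrix.sub_mul, h.comm, hS,
      kulkarni_comm h.symm h.isUnit_det h.sq h.orthogonal hoff]
    · simp [hc]
    · simp [ht]
    · simp [ht']

end IsKahlerCurvature

end Chart

namespace Chart

/-! ### The Levi-Civita connection and its curvature -/

/-- The connection matrices `(Γ_c)ᵃ_b = Γᵃ_{cb}`. -/
def conn (g : Field2) (c : Fin 4) : Field2 := fun p => Matrix.of fun a b => christoffel g p a c b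

/-- The curvature matrices `(R_{cd})ᵃ_b = Rᵃ_{bcd}`. -/
def curv (g : Field2) (p : Pt) (c d : Fin 4) : Mat := Matrix.of fun a b => riemannUp g p a b c d

/-- A smooth pseudo-Riemannian metric on an open set. -/
structure IsMetricOn (g : Field2) (D : Set Pt) : Prop where
  isOpen : IsOpen D
  smooth : SmoothField g D
  symm : ∀ p ∈ D, (g p).transpose = g p
  isUnit_det : ∀ p ∈ D, IsUnit (g p).det

theorem curv_eq (g : Field2) (p : Pt) (c d : Fin 4) :
    curv g p c d = pdM c (conn g d) p - pdM d (conn g c) p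
      + (conn g c p * conn g d p - conn g d p * conn g c p) := by
  ext a b
  simp only [curv, riemannUp, Matrix.of_apply, Matrix.add_apply, Matrix.sub_apply,
    Matrix.mul_apply, pdM_apply, conn, Finset.sum_sub_distrib]

theorem curv_antisymm (g : Field2) (p : Pt) (c d : Fin 4) : curv g p d c = -curv g p c d := by
  rw [curv_eq, curv_eq]; abel

theorem Invariant.entry {i : Fin 4} {g : Field2} (hi : Invariant i g) (b c : Fin 4) :
    Invariant i fun q => g q b c :=
  fun t q => congrFun (congrFun (hi t q) b) c

namespace IsMetricOn

variable {g : Field2} {D : Set Pt} {p : Pt}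

theorem pd_symm (h : IsMetricOn g D) (hp : p ∈ D) (i a b : Fin 4) :
    pd i (fun q => g q a b) p = pd i (fun q => g q b a) p :=
  pd_congr_on h.isOpen (fun q hq => congrFun (congrFun (h.symm q hq) b) a) hp

theorem conn_symm (h : IsMetricOn g D) (hp : p ∈ D) (a b c : Fin 4) :
    conn g c p a b = conn g b p a c := by
  simp only [conn, christoffel, Matrix.of_apply]
  congr 1
  refine Finset.sum_congr rfl fun d _ => ?_
  rw [h.pd_symm hp d b c]; ring

theorem smooth_conn (h : IsMetricOn g D) (c : Fin 4) : SmoothField (conn g c) D := by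
  intro a b
  have hi := h.smooth.inv fun p hp => (h.isUnit_det p hp).ne_zero
  simp only [conn, christoffel, Matrix.of_apply]
  refine contDiffOn_const.mul (ContDiffOn.sum fun d _ => (hi a d).mul ?_)
  exact (((h.smooth d b).pd h.isOpen c).add ((h.smooth d c).pd h.isOpen b)).sub
    ((h.smooth c b).pd h.isOpen d)

theorem lower_conn (h : IsMetricOn g D) (hp : p ∈ D) (a b c : Fin 4) :
    (g p * conn g c p) a b = (1 / 2) * (pd c (fun q => g q a b) p + pd b (fun q => g q a c) p
      - pd a (fun q => g q c b) p) := by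
  have h1 : conn g c p = (g p)⁻¹ * Matrix.of fun d b => (1 / 2) * (pd c (fun q => g q d b) p
      + pd b (fun q => g q d c) p - pd d (fun q => g q c b) p) := by
    ext a b
    simp only [conn, christoffel, Matrix.of_apply, Matrix.mul_apply, Finset.mul_sum]
    exact Finset.sum_congr rfl fun d _ => by ring
  rw [h1, Matrix.mul_nonsing_inv_cancel_left _ _ (h.isUnit_det p hp), Matrix.of_apply]

theorem pd_metric (h : IsMetricOn g D) (hp : p ∈ D) (a b c : Fin 4) :
    pd c (fun q => g q a b) p = (g p * conn g c p) a b + (g p * conn g c p) b a := by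
  rw [h.lower_conn hp, h.lower_conn hp, h.pd_symm hp b a c, h.pd_symm hp a b c,
    h.pd_symm hp c b a]
  ring

theorem pdM_metric (h : IsMetricOn g D) (hp : p ∈ D) (c : Fin 4) :
    pdM c g p = g p * conn g c p + (conn g c p).transpose * g p := by
  have : (conn g c p).transpose * g p = (g p * conn g c p).transpose := by
    rw [Matrix.transpose_mul, h.symm p hp]
  rw [this]
  ext a b
  exact h.pd_metric hp a b c

/-- Symmetry of the Christoffel symbols in their lower indices makes the derivative terms and the
quadratic terms cancel in pairs. -/
theorem curv_bianchi (h : IsMetricOn g D) (hp : p ∈ D) (a b c d : Fin 4) :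
    curv g p c d a b + curv g p d b a c + curv g p b c a d = 0 := by
  have hs : ∀ i a b c, pdM i (conn g c) p a b = pdM i (conn g b) p a c := fun i a b c =>
    pd_congr_on h.isOpen (fun q hq => h.conn_symm hq a b c) hp
  have hm : ∀ A : Mat, ∀ a b c, (A * conn g c p) a b = (A * conn g b p) a c := by
    intro A a b c
    simp only [Matrix.mul_apply]
    exact Finset.sum_congr rfl fun e _ => by rw [h.conn_symm hp]
  simp only [curv_eq, Matrix.add_apply, Matrix.sub_apply]
  linarith [hs c a b d, hs d a b c, hs b a c d, hm (conn g c p) a b d, hm (conn g d p) a b c,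
    hm (conn g b p) a c d]

/-- This is the integrability condition of `∂_c g = g Γ_c + Γ_cᵀ g`: the second partial derivatives
of `g` commute. -/
theorem curv_metric (h : IsMetricOn g D) (hp : p ∈ D) (c d : Fin 4) :
    g p * curv g p c d + (curv g p c d).transpose * g p = 0 := by
  have h2 : ∀ c d, pdM c (pdM d g) p = (g p * conn g c p + (conn g c p).transpose * g p) *
      conn g d p + g p * pdM c (conn g d) p + ((pdM c (conn g d) p).transpose * g p
      + (conn g d p).transpose * (g p * conn g c p + (conn g c p).transpose * g p)) := by
    intro c d
    rw [pdM_congr_on h.isOpen (fun q hq => h.pdM_metric hq d) hp,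
      pdM_add h.isOpen (h.smooth.mul (h.smooth_conn d))
        ((h.smooth_conn d).transpose.mul h.smooth) hp,
      pdM_mul h.isOpen h.smooth (h.smooth_conn d) hp,
      pdM_mul h.isOpen (h.smooth_conn d).transpose h.smooth hp, pdM_transpose,
      h.pdM_metric hp]
  have h3 := pdM_comm h.isOpen h.smooth hp c d
  rw [h2, h2, ← sub_eq_zero] at h3
  rw [← h3, curv_eq]
  simp only [Matrix.transpose_add, Matrix.transpose_sub, Matrix.transpose_mul]
  noncomm_ring

/-- A parallel endomorphism field commutes with the curvature. -/
theorem comm_curv (h : IsMetricOn g D) {J : Field2} (hJ : SmoothField J D)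
    (hpar : ∀ p ∈ D, ∀ c, pdM c J p = J p * conn g c p - conn g c p * J p) (hp : p ∈ D)
    (c d : Fin 4) : J p * curv g p c d = curv g p c d * J p := by
  have h2 : ∀ c d, pdM c (pdM d J) p = (J p * conn g c p - conn g c p * J p) * conn g d p
      + J p * pdM c (conn g d) p - (pdM c (conn g d) p * J p
      + conn g d p * (J p * conn g c p - conn g c p * J p)) := by
    intro c d
    rw [pdM_congr_on h.isOpen (fun q hq => hpar q hq d) hp,
      pdM_sub h.isOpen (hJ.mul (h.smooth_conn d)) ((h.smooth_conn d).mul hJ) hp,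
      pdM_mul h.isOpen hJ (h.smooth_conn d) hp, pdM_mul h.isOpen (h.smooth_conn d) hJ hp,
      hpar p hp]
  have h3 := pdM_comm h.isOpen hJ hp c d
  rw [h2, h2, ← sub_eq_zero] at h3
  rw [← sub_eq_zero, ← h3, curv_eq]
  noncomm_ring

/-- For translation-invariant data, the trace of a parallel endomorphism against the curvature is
a derivative. -/
theorem trace_curv (h : IsMetricOn g D) {J : Field2} (hJ : SmoothField J D)
    (hpar : ∀ p ∈ D, ∀ c, pdM c J p = J p * conn g c p - conn g c p * J p) (hp : p ∈ D)
    {i : Fin 4} (hi : Invariant i g) (a : Fin 4) :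
    (J p * curv g p a i).trace = pd a (fun q => (J q * conn g i q).trace) p := by
  have h1 : pdM i (conn g a) p = 0 := by
    ext b c
    refine Invariant.pd_eq_zero (fun t q => ?_) p
    have hpd : ∀ j b c, pd j (fun q => g q b c) (q + Pi.single i t) = pd j (fun q => g q b c) q :=
      fun j b c => Invariant.pd (f := fun q => g q b c) (hi.entry b c) j t q
    simp only [conn, christoffel, Matrix.of_apply, hpd, hi t q]
  rw [pd_trace h.isOpen (hJ.mul (h.smooth_conn i)) hp, pdM_mul h.isOpen hJ (h.smooth_conn i) hp,
    hpar p hp, curv_eq, h1]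
  -- By cyclicity of the trace, the commutator term in the curvature equals the term produced by
  -- differentiating the parallel `J`.
  have h2 : (conn g a p * J p * conn g i p).trace = (J p * conn g i p * conn g a p).trace := by
    rw [Matrix.mul_assoc, Matrix.trace_mul_comm]
  simp only [Matrix.mul_add, Matrix.mul_sub, Matrix.sub_mul, Matrix.trace_add, Matrix.trace_sub,
    h2, ← Matrix.mul_assoc, Matrix.mul_zero, Matrix.trace_zero]
  ring

/-- The trace of `J` against the connection in an invariant direction. -/
theorem trace_conn (h : IsMetricOn g D) {J : Field2} (hp : p ∈ D) {i : Fin 4}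
    (hi : Invariant i g) (ha : (J p * (g p)⁻¹).transpose = -(J p * (g p)⁻¹)) :
    (J p * conn g i p).trace
      = ∑ b, ∑ d, (J p * (g p)⁻¹) b d * pd b (fun q => g q d i) p := by
  have h0 : ∀ b c, pd i (fun q => g q b c) p = 0 := fun b c =>
    Invariant.pd_eq_zero (f := fun q => g q b c) (hi.entry b c) p
  have h1 : conn g i p = (g p)⁻¹ * Matrix.of fun d b => (1 / 2) * (pd b (fun q => g q d i) p
      - pd d (fun q => g q i b) p) := by
    ext a b
    simp only [conn, christoffel, Matrix.of_apply, Matrix.mul_apply, Finset.mul_sum, h0]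
    exact Finset.sum_congr rfl fun d _ => by ring
  rw [h1, ← Matrix.mul_assoc]
  generalize hN : J p * (g p)⁻¹ = N at ha ⊢
  have h2 : (N * Matrix.of fun d b => (1 / 2) * (pd b (fun q => g q d i) p
      - pd d (fun q => g q i b) p)).trace = (1 / 2) * (∑ b, ∑ d, N b d * pd b (fun q => g q d i) p
      - ∑ b, ∑ d, N b d * pd d (fun q => g q i b) p) := by
    simp only [Matrix.trace, Matrix.diag, Matrix.mul_apply, Matrix.of_apply, Finset.mul_sum,
      ← Finset.sum_sub_distrib]
    exact Finset.sum_congr rfl fun b _ => Finset.sum_congr rfl fun d _ => by ring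
  have h3 : ∑ b, ∑ d, N b d * pd d (fun q => g q i b) p
      = -∑ b, ∑ d, N b d * pd b (fun q => g q d i) p := by
    rw [Finset.sum_comm, ← Finset.sum_neg_distrib]
    refine Finset.sum_congr rfl fun b _ => ?_
    rw [← Finset.sum_neg_distrib]
    refine Finset.sum_congr rfl fun d _ => ?_
    have := congrFun (congrFun ha b) d
    rw [Matrix.transpose_apply, Matrix.neg_apply] at this
    rw [this, h.pd_symm hp b i d]; ring
  rw [h2, h3]; ring

end IsMetricOn

/-- The Weyl tensor in terms of the algebraic Weyl tensor. -/
theorem weyl_eq {g : Field2} {p : Pt} (hdet : IsUnit (g p).det)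
    (a b c d : Fin 4) : weyl g p a b c d = (g p * weylUp (g p) (curv g p) c d) a b := by
  have hric : ∀ b d, ricM (curv g p) b d = ricci g p b d := fun b d => rfl
  have hsc : scal (g p) (curv g p) = scalarCurvature g p := rfl
  have hk : ∀ P : Mat, (g p * kulkarni (g p) P c d) a b = g p a c * P b d - g p a d * P b c
      + g p b d * P a c - g p b c * P a d := by
    intro P
    have h1 : ∀ c, ∑ e, g p a e * ((g p)⁻¹ * P) e c = P a c := by
      intro c
      rw [← Matrix.mul_apply, Matrix.mul_nonsing_inv_cancel_left _ _ hdet]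
    rw [← h1 c, ← h1 d]
    simp only [Matrix.mul_apply (M := g p), kulkarni, Matrix.of_apply, Matrix.one_apply, mul_add,
      mul_sub, Finset.sum_add_distrib, Finset.sum_sub_distrib, ite_mul, one_mul, zero_mul,
      mul_ite, mul_zero, Finset.sum_ite_eq', Finset.mem_univ, if_true, Finset.mul_sum]
    congr 2
    · congr 1
      exact funext fun e => by ring
    · exact funext fun e => by ring
  have hr : (g p * curv g p c d) a b = riemann g p a b c d := by
    simp only [Matrix.mul_apply, curv, Matrix.of_apply, riemann]
  rw [weylUp, Matrix.mul_sub, Matrix.sub_apply, hk, hr]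
  simp only [schouten, Matrix.sub_apply, Matrix.smul_apply, smul_eq_mul, hric, hsc, weyl]
  ring

end Chart

namespace Chart

/-! ### Conformal changes of the metric -/

section Conformal

variable {g : Field2} {D : Set Pt} {p : Pt} {u : Pt → ℝ}

/-- The differential of `u`. -/
def grad (u : Pt → ℝ) (p : Pt) : Fin 4 → ℝ := fun c => pd c u p

/-- The gradient vector of `u`. -/
def gradUp (g : Field2) (u : Pt → ℝ) (p : Pt) : Fin 4 → ℝ := (g p)⁻¹.mulVec (grad u p)

/-- The difference `δᵃ_b u_c + δᵃ_c u_b - g_{cb} uᵃ` of the connections of `e^{2u} g` and `g`. -/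
def connDiff (g : Field2) (u : Pt → ℝ) (c : Fin 4) : Field2 := fun p => Matrix.of fun a b =>
  (1 : Mat) a b * grad u p c + (1 : Mat) a c * grad u p b - g p c b * gradUp g u p a

/-- The tensor `-∇∇u + du ⊗ du - ½ |du|² g`. -/
def confTensor (g : Field2) (u : Pt → ℝ) (p : Pt) : Mat := Matrix.of fun b d =>
  -(pd d (pd b u) p - (Matrix.vecMul (grad u p) (conn g d p)) b) + grad u p b * grad u p d
    - (1 / 2) * (grad u p ⬝ᵥ gradUp g u p) * g p b d

/-- The relation `∂l = 2 l ∂u` replaces `l = e^{2u}`, so no exponential enters and the sign of `l`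
is immaterial. -/
theorem IsMetricOn.conn_conformal (h : IsMetricOn g D) (hp : p ∈ D) {l : Pt → ℝ}
    (hl : ContDiffOn ℝ ∞ l D) (hl0 : l p ≠ 0) (hu : ∀ c, pd c l p = 2 * l p * pd c u p)
    (c : Fin 4) :
    conn (fun q => l q • g q) c p = conn g c p + connDiff g u c p := by
  have hinv : (l p • g p)⁻¹ = (l p)⁻¹ • (g p)⁻¹ := by
    apply Matrix.inv_eq_left_inv
    simp [Matrix.nonsing_inv_mul _ (h.isUnit_det p hp), hl0, smul_smul]
  have hpd : ∀ i a b, pd i (fun q => l q * g q a b) p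
      = 2 * l p * pd i u p * g p a b + l p * pd i (fun q => g q a b) p := by
    intro i a b
    rw [← hu]
    exact pd_mul (hl.diffAt h.isOpen hp) ((h.smooth a b).diffAt h.isOpen hp)
  have h1 : ∀ a b, ∑ d, (g p)⁻¹ a d * g p d b = (1 : Mat) a b := by
    intro a b
    rw [← Matrix.mul_apply, Matrix.nonsing_inv_mul _ (h.isUnit_det p hp)]
  ext a b
  have key : ∀ d, (l p)⁻¹ * (g p)⁻¹ a d * (pd c (fun q => l q * g q d b) p
      + pd b (fun q => l q * g q d c) p - pd d (fun q => l q * g q c b) p)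
      = (g p)⁻¹ a d * (pd c (fun q => g q d b) p + pd b (fun q => g q d c) p
          - pd d (fun q => g q c b) p)
        + 2 * (pd c u p * ((g p)⁻¹ a d * g p d b) + pd b u p * ((g p)⁻¹ a d * g p d c)
          - g p c b * ((g p)⁻¹ a d * pd d u p)) := by
    intro d
    rw [hpd, hpd, hpd]
    field_simp
    ring
  simp only [conn, christoffel, Matrix.of_apply, Matrix.add_apply, hinv, Matrix.smul_apply,
    smul_eq_mul, key, Finset.sum_add_distrib, Finset.sum_sub_distrib, ← Finset.mul_sum, h1,
    connDiff, gradUp, Matrix.mulVec, dotProduct, grad]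
  ring

theorem mul_connDiff (A : Mat) (a b d : Fin 4) :
    (A * connDiff g u d p) a b = A a b * grad u p d + A a d * grad u p b
      - g p d b * A.mulVec (gradUp g u p) a := by
  have : ∀ e, A a e * ((1 : Mat) e b * grad u p d + (1 : Mat) e d * grad u p b
      - g p d b * gradUp g u p e) = grad u p d * (A a e * (1 : Mat) e b)
      + grad u p b * (A a e * (1 : Mat) e d) - g p d b * (A a e * gradUp g u p e) := fun e => by
    ring
  simp only [Matrix.mul_apply, connDiff, Matrix.of_apply, this, Finset.sum_add_distrib,
    Finset.sum_sub_distrib, ← Finset.mul_sum, Matrix.mulVec, dotProduct]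
  rw [← Matrix.mul_apply, ← Matrix.mul_apply, Matrix.mul_one]
  ring

theorem connDiff_mul (A : Mat) (a b d : Fin 4) :
    (connDiff g u d p * A) a b = A a b * grad u p d
      + (1 : Mat) a d * (Matrix.vecMul (grad u p) A) b - gradUp g u p a * (g p * A) d b := by
  have : ∀ e, ((1 : Mat) a e * grad u p d + (1 : Mat) a d * grad u p e
      - g p d e * gradUp g u p a) * A e b = grad u p d * ((1 : Mat) a e * A e b)
      + (1 : Mat) a d * (grad u p e * A e b) - gradUp g u p a * (g p d e * A e b) := fun e => by
    ring
  simp only [Matrix.mul_apply, connDiff, Matrix.of_apply, this, Finset.sum_add_distrib,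
    Finset.sum_sub_distrib, ← Finset.mul_sum, Matrix.vecMul, dotProduct]
  rw [← Matrix.mul_apply, Matrix.one_mul]
  ring

theorem mulVec_gradUp (hdet : IsUnit (g p).det) : (g p).mulVec (gradUp g u p) = grad u p := by
  rw [gradUp, Matrix.mulVec_mulVec, Matrix.mul_nonsing_inv _ hdet, Matrix.one_mulVec]

theorem connDiff_mulVec (hdet : IsUnit (g p).det) (c a : Fin 4) :
    (connDiff g u c p).mulVec (gradUp g u p) a
      = (1 : Mat) a c * (grad u p ⬝ᵥ gradUp g u p) := by
  have h1 : (g p).mulVec (gradUp g u p) c = grad u p c := congrFun (mulVec_gradUp hdet) c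
  have : ∀ e, ((1 : Mat) a e * grad u p c + (1 : Mat) a c * grad u p e
      - g p c e * gradUp g u p a) * gradUp g u p e = grad u p c * ((1 : Mat) a e * gradUp g u p e)
      + (1 : Mat) a c * (grad u p e * gradUp g u p e)
      - gradUp g u p a * (g p c e * gradUp g u p e) := fun e => by ring
  have h2 : ∑ e, (1 : Mat) a e * gradUp g u p e = gradUp g u p a :=
    congrFun (Matrix.one_mulVec (gradUp g u p)) a
  have h3 : ∑ e, g p c e * gradUp g u p e = grad u p c := h1
  simp only [Matrix.mulVec, dotProduct, connDiff, Matrix.of_apply, this, Finset.sum_add_distrib,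
    Finset.sum_sub_distrib, ← Finset.mul_sum, h2, h3]
  ring

theorem IsMetricOn.smooth_gradUp (h : IsMetricOn g D) (hu : ContDiffOn ℝ ∞ u D) (a : Fin 4) :
    ContDiffOn ℝ ∞ (fun p => gradUp g u p a) D := by
  have hi := h.smooth.inv fun p hp => (h.isUnit_det p hp).ne_zero
  simp only [gradUp, Matrix.mulVec, dotProduct, grad]
  exact ContDiffOn.sum fun d _ => (hi a d).mul (hu.pd h.isOpen d)

theorem IsMetricOn.smooth_connDiff (h : IsMetricOn g D) (hu : ContDiffOn ℝ ∞ u D) (c : Fin 4) :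
    SmoothField (connDiff g u c) D := by
  intro a b
  simp only [connDiff, Matrix.of_apply, grad]
  exact ((contDiffOn_const.mul (hu.pd h.isOpen c)).add
    (contDiffOn_const.mul (hu.pd h.isOpen b))).sub ((h.smooth c b).mul (h.smooth_gradUp hu a))

theorem IsMetricOn.pdM_connDiff (h : IsMetricOn g D) (hp : p ∈ D) (hu : ContDiffOn ℝ ∞ u D)
    (c d a b : Fin 4) : pdM c (connDiff g u d) p a b
      = (1 : Mat) a b * pd c (pd d u) p + (1 : Mat) a d * pd c (pd b u) p
        - (pd c (fun q => g q d b) p * gradUp g u p a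
          + g p d b * pd c (fun q => gradUp g u q a) p) := by
  have d1 : ∀ e, DifferentiableAt ℝ (pd e u) p := fun e => (hu.pd h.isOpen e).diffAt h.isOpen hp
  have d2 := (h.smooth d b).diffAt h.isOpen hp
  have d3 := (h.smooth_gradUp hu a).diffAt h.isOpen hp
  simp only [pdM_apply, connDiff, Matrix.of_apply, grad]
  refine (pd_sub (((d1 d).const_mul _).fun_add ((d1 b).const_mul _)) (d2.fun_mul d3)).trans ?_
  congr 1
  · refine (pd_add ((d1 d).const_mul _) ((d1 b).const_mul _)).trans ?_
    rw [pd_const_mul _ (d1 d), pd_const_mul _ (d1 b)]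
  · exact pd_mul d2 d3

/-- The gradient vector differentiates to the raised Hessian. -/
theorem IsMetricOn.hessian_raise (h : IsMetricOn g D) (hp : p ∈ D) (hu : ContDiffOn ℝ ∞ u D)
    (a d : Fin 4) : ((g p)⁻¹ * Matrix.of fun b d => pd d (pd b u) p
        - (Matrix.vecMul (grad u p) (conn g d p)) b) a d
      = pd d (fun q => gradUp g u q a) p + (conn g d p).mulVec (gradUp g u p) a := by
  have hg1 := mulVec_gradUp (u := u) (h.isUnit_det p hp)
  have key : ∀ b d, pd d (pd b u) p - (Matrix.vecMul (grad u p) (conn g d p)) b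
      = ∑ e, g p b e * (pd d (fun q => gradUp g u q e) p
        + (conn g d p).mulVec (gradUp g u p) e) := by
    intro b d
    -- Differentiate `du = g (grad u)`; the derivative of `g` is expressed through the connection.
    have h1 : pd d (pd b u) p = pd d (fun q => ∑ e, g q b e * gradUp g u q e) p := by
      refine pd_congr_on h.isOpen (fun q hq => ?_) hp
      exact (congrFun (mulVec_gradUp (u := u) (h.isUnit_det q hq)) b).symm
    have d2 := fun e => (h.smooth b e).diffAt h.isOpen hp
    have d3 := fun e => (h.smooth_gradUp hu e).diffAt h.isOpen hp
    rw [h1, pd_sum _ fun e _ => (d2 e).fun_mul (d3 e)]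
    have h2 : ∀ e, pd d (fun q => g q b e * gradUp g u q e) p
        = (g p * conn g d p) b e * gradUp g u p e + gradUp g u p e * (g p * conn g d p) e b
          + g p b e * pd d (fun q => gradUp g u q e) p := by
      intro e
      rw [pd_mul (d2 e) (d3 e), h.pd_metric hp]; ring
    have h3 : ∑ e, (g p * conn g d p) b e * gradUp g u p e
        = ∑ e, g p b e * (conn g d p).mulVec (gradUp g u p) e := by
      change (g p * conn g d p).mulVec (gradUp g u p) b
        = (g p).mulVec ((conn g d p).mulVec (gradUp g u p)) b
      rw [Matrix.mulVec_mulVec]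
    have h4 : ∑ e, gradUp g u p e * (g p * conn g d p) e b
        = (Matrix.vecMul (grad u p) (conn g d p)) b := by
      change Matrix.vecMul (gradUp g u p) (g p * conn g d p) b = _
      rw [← Matrix.vecMul_vecMul, ← hg1]
      conv_rhs => rw [← h.symm p hp, Matrix.mulVec_transpose]
    simp only [h2, Finset.sum_add_distrib, h3, h4, mul_add]
    ring
  rw [Matrix.mul_apply]
  simp only [Matrix.of_apply, key]
  have := congrFun (Matrix.mulVec_mulVec (fun e => pd d (fun q => gradUp g u q e) p
        + (conn g d p).mulVec (gradUp g u p) e) (g p)⁻¹ (g p)) a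
  rw [Matrix.nonsing_inv_mul _ (h.isUnit_det p hp), Matrix.one_mulVec] at this
  exact this

/-- Adding `S` to the connection changes the curvature by the antisymmetrised covariant derivative
of `S` plus `[S_c, S_d]`. For `S = connDiff`, the Hessian of `u` comes from the former and the terms
quadratic in `du` from the bracket; together they assemble into a single Kulkarni–Nomizu product. -/
theorem IsMetricOn.curv_conformal (h : IsMetricOn g D) {l : Pt → ℝ}
    (hl : ContDiffOn ℝ ∞ l D) (hl0 : ∀ p ∈ D, l p ≠ 0) (hu : ContDiffOn ℝ ∞ u D)
    (hlu : ∀ p ∈ D, ∀ c, pd c l p = 2 * l p * pd c u p) (hp : p ∈ D) (c d : Fin 4) :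
    curv (fun q => l q • g q) p c d = curv g p c d + kulkarni (g p) (confTensor g u p) c d := by
  have hdet := h.isUnit_det p hp
  have e1 : ∀ c d, pdM c (conn (fun q => l q • g q) d) p
      = pdM c (conn g d) p + pdM c (connDiff g u d) p := by
    intro c d
    rw [pdM_congr_on h.isOpen (fun q hq => h.conn_conformal hq hl (hl0 q hq) (hlu q hq) d) hp,
      pdM_add h.isOpen (h.smooth_conn d) (h.smooth_connDiff hu d) hp]
  have e2 : curv (fun q => l q • g q) p c d - curv g p c d
      = pdM c (connDiff g u d) p - pdM d (connDiff g u c) p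
        + (conn g c p * connDiff g u d p - connDiff g u d p * conn g c p)
        - (conn g d p * connDiff g u c p - connDiff g u c p * conn g d p)
        + (connDiff g u c p * connDiff g u d p - connDiff g u d p * connDiff g u c p) := by
    rw [curv_eq, curv_eq, e1, e1, h.conn_conformal hp hl (hl0 p hp) (hlu p hp),
      h.conn_conformal hp hl (hl0 p hp) (hlu p hp)]
    noncomm_ring
  rw [← sub_eq_iff_eq_add', e2]
  have hraise : ∀ a d, ((g p)⁻¹ * confTensor g u p) a d
      = -(pd d (fun q => gradUp g u q a) p + (conn g d p).mulVec (gradUp g u p) a)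
        + gradUp g u p a * grad u p d
        - (1 / 2) * (grad u p ⬝ᵥ gradUp g u p) * (1 : Mat) a d := by
    intro a d
    rw [← h.hessian_raise hp hu, ← Matrix.nonsing_inv_mul _ hdet]
    simp only [confTensor, Matrix.mul_apply, Matrix.of_apply, gradUp, Matrix.mulVec,
      Finset.mul_sum]
    simp only [dotProduct, ← Finset.sum_neg_distrib, Finset.sum_mul]
    rw [← Finset.sum_add_distrib, ← Finset.sum_sub_distrib]
    refine Finset.sum_congr rfl fun e _ => ?_
    ring
  ext a b
  have hs : ∀ a b c, (g p * conn g c p) a b = (g p * conn g b p) a c := by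
    intro a b c
    simp only [Matrix.mul_apply]
    exact Finset.sum_congr rfl fun e _ => by rw [h.conn_symm hp]
  have hgs : ∀ a b, g p a b = g p b a := fun a b => congrFun (congrFun (h.symm p hp) b) a
  simp only [Matrix.add_apply, Matrix.sub_apply, mul_connDiff, connDiff_mul, connDiff_mulVec hdet,
    h.pdM_connDiff hp hu, kulkarni, Matrix.of_apply, hraise]
  have hS : ∀ a b c, connDiff g u c p a b = (1 : Mat) a b * grad u p c
      + (1 : Mat) a c * grad u p b - g p c b * gradUp g u p a := fun a b c => rfl
  have hT : ∀ b d, confTensor g u p b d = -(pd d (pd b u) p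
      - (Matrix.vecMul (grad u p) (conn g d p)) b) + grad u p b * grad u p d
      - (1 / 2) * (grad u p ⬝ᵥ gradUp g u p) * g p b d := fun b d => rfl
  simp only [hS, hT, h.pd_metric hp, hgs b c, hgs b d, hgs d c, pd_comm hu h.isOpen hp d c,
    h.conn_symm hp a d c]
  rw [hs d b c, hs c b d, hs b d c]
  ring

/-- The Weyl tensor is conformally invariant. -/
theorem IsMetricOn.weylUp_conformal (h : IsMetricOn g D) {l : Pt → ℝ}
    (hl : ContDiffOn ℝ ∞ l D) (hl0 : ∀ p ∈ D, l p ≠ 0) (hu : ContDiffOn ℝ ∞ u D)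
    (hlu : ∀ p ∈ D, ∀ c, pd c l p = 2 * l p * pd c u p) (hp : p ∈ D) (c d : Fin 4) :
    weylUp (l p • g p) (curv (fun q => l q • g q) p) c d = weylUp (g p) (curv g p) c d :=
  weylUp_add_kulkarni (hl0 p hp) (h.symm p hp) (h.isUnit_det p hp)
    (h.curv_conformal hl hl0 hu hlu hp) c d

end Conformal

/-! ### Kähler metrics -/

section Kahler

variable {g J : Field2} {D : Set Pt} {p : Pt}

/-- With a torsion-free connection, both `dκ` and the Nijenhuis tensor can be written with `∇` in
place of `∂`. Together they force `∇κ`, and hence `∇J`, to vanish. -/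
theorem IsKahlerOn.parallel (hK : IsKahlerOn g J D) (h : IsMetricOn g D) (hJ : SmoothField J D)
    (hp : p ∈ D) (c : Fin 4) : pdM c J p = J p * conn g c p - conn g c p * J p := by
  have hsq := hK.almostComplex p hp
  have hJg : ∀ q ∈ D, (J q).transpose * g q = -(g q * J q) := fun q hq =>
    transpose_mul_metric (hK.almostComplex q hq) (hK.orthogonal q hq)
  have hs := h.conn_symm hp
  -- `K c` is the covariant derivative `∇_c J`, and `B c = g K c` is that of the bilinear form `g
  -- J`.
  set K : Fin 4 → Mat := fun c => pdM c J p - (J p * conn g c p - conn g c p * J p) with hKdef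
  have hpd : ∀ c, pdM c J p = K c + (J p * conn g c p - conn g c p * J p) := fun c =>
    (sub_add_cancel _ _).symm
  set B : Fin 4 → Mat := fun c => g p * K c with hB
  -- the form `κ_{ab} = (g J)_{ba}` and its covariant derivative
  have hpgJ : ∀ c, pdM c (fun q => g q * J q) p
      = (conn g c p).transpose * (g p * J p) + g p * J p * conn g c p + B c := by
    intro c
    rw [pdM_mul h.isOpen h.smooth hJ hp, h.pdM_metric hp, hpd, hB]
    noncomm_ring
  have hgJt : ∀ q ∈ D, (g q * J q).transpose = -(g q * J q) := by
    intro q hq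
    rw [Matrix.transpose_mul, h.symm q hq, hJg q hq]
  have hBanti : ∀ c a b, B c b a = -B c a b := by
    intro c a b
    have h1 : (pdM c (fun q => g q * J q) p).transpose = -pdM c (fun q => g q * J q) p := by
      rw [← pdM_transpose, pdM_congr_on h.isOpen hgJt hp]
      ext a b
      exact pd_neg
    rw [hpgJ] at h1
    have h2 : (B c).transpose = -B c := by
      simp only [Matrix.transpose_add, Matrix.transpose_mul (conn g c p).transpose,
        Matrix.transpose_mul (g p * J p), hgJt p hp, Matrix.transpose_transpose] at h1
      simp only [Matrix.neg_mul, Matrix.mul_neg] at h1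
      have h3 := eq_sub_of_add_eq' h1
      rw [h3]; abel
    exact congrFun (congrFun h2 a) b
  have hBJ : ∀ c, g p * J p * K c = -((J p).transpose * B c) := by
    intro c
    rw [hB, ← Matrix.mul_assoc, hJg p hp, Matrix.neg_mul, neg_neg]
  have hclosed : ∀ x y z, B x z y + B y x z + B z y x = 0 := by
    intro x y z
    have h1 := hK.closed p hp x y z
    have h2 : ∀ a b c, pd a (fun q => fundamentalForm g J q b c) p
        = pdM a (fun q => g q * J q) p c b := fun a b c => rfl
    rw [extDeriv2, h2, h2, h2, hpgJ, hpgJ, hpgJ] at h1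
    have h3 : ∀ a b c, (g p * J p * conn g c p) a b = (g p * J p * conn g b p) a c := by
      intro a b c
      simp only [Matrix.mul_apply (N := conn g c p), Matrix.mul_apply (N := conn g b p)]
      exact Finset.sum_congr rfl fun e _ => by rw [hs]
    have h4 : ∀ a b c, ((conn g c p).transpose * (g p * J p)) a b
        = -(g p * J p * conn g c p) b a := by
      intro a b c
      have : (conn g c p).transpose * (g p * J p) = -(g p * J p * conn g c p).transpose := by
        rw [Matrix.transpose_mul, hgJt p hp, Matrix.mul_neg, neg_neg]
      rw [this]; rfl
    simp only [Matrix.add_apply, h4] at h1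
    linarith [h3 y z x, h3 z x y, h3 x y z]
  -- The Nijenhuis equation in terms of `∇J`; all Christoffel terms cancel by symmetry.
  have hN : ∀ a b c, ∑ d, J p d b * K d a c - ∑ d, J p d c * K d a b
      - (J p * K b) a c + (J p * K c) a b = 0 := by
    intro a b c
    have h1 := hK.integrable p hp a b c
    have h2 : ∀ i a b, pd i (fun q => J q a b) p
        = K i a b + ((J p * conn g i p) a b - (conn g i p * J p) a b) :=
      fun i a b => congrFun (congrFun (hpd i) a) b
    have h3 : ∀ b c, ∑ d, J p d b * (J p * conn g d p) a c = (J p * conn g c p * J p) a b := by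
      intro b c
      rw [Matrix.mul_apply]
      refine Finset.sum_congr rfl fun d _ => ?_
      rw [mul_comm]
      congr 1
      simp only [Matrix.mul_apply]
      exact Finset.sum_congr rfl fun e _ => by rw [hs]
    have h4 : ∑ d, J p d b * (conn g d p * J p) a c = ∑ d, J p d c * (conn g d p * J p) a b := by
      simp only [Matrix.mul_apply, Finset.mul_sum]
      rw [Finset.sum_comm]
      exact Finset.sum_congr rfl fun d _ => Finset.sum_congr rfl fun e _ => by rw [hs]; ring
    have h5 : ∀ b c, ∑ d, J p a d * ((J p * conn g b p) d c - (conn g b p * J p) d c)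
        = (J p * J p * conn g b p) a c - (J p * conn g b p * J p) a c := by
      intro b c
      rw [Matrix.mul_assoc, Matrix.mul_assoc, Matrix.mul_apply, Matrix.mul_apply,
        ← Finset.sum_sub_distrib]
      exact Finset.sum_congr rfl fun d _ => by ring
    have h6 : (J p * J p * conn g b p) a c = (J p * J p * conn g c p) a b := by
      simp only [Matrix.mul_apply (N := conn g c p), Matrix.mul_apply (N := conn g b p)]
      exact Finset.sum_congr rfl fun e _ => by rw [hs]
    simp only [nijenhuis, h2] at h1
    have h7 : ∀ b c, (J p * K b) a c = ∑ d, J p a d * K b d c := fun b c => Matrix.mul_apply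
    have h8 : ∑ d, (J p d b * (K d a c + ((J p * conn g d p) a c - (conn g d p * J p) a c))
        - J p d c * (K d a b + ((J p * conn g d p) a b - (conn g d p * J p) a b))
        - J p a d * ((K b d c + ((J p * conn g b p) d c - (conn g b p * J p) d c))
          - (K c d b + ((J p * conn g c p) d b - (conn g c p * J p) d b))))
        = ∑ d, J p d b * K d a c + ∑ d, J p d b * (J p * conn g d p) a c
          - ∑ d, J p d b * (conn g d p * J p) a c
          - (∑ d, J p d c * K d a b + ∑ d, J p d c * (J p * conn g d p) a b
          - ∑ d, J p d c * (conn g d p * J p) a b)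
          - (∑ d, J p a d * K b d c
            + ∑ d, J p a d * ((J p * conn g b p) d c - (conn g b p * J p) d c)
            - ∑ d, J p a d * K c d b
            - ∑ d, J p a d * ((J p * conn g c p) d b - (conn g c p * J p) d b)) := by
      simp only [← Finset.sum_add_distrib, ← Finset.sum_sub_distrib]
      exact Finset.sum_congr rfl fun d _ => by ring
    rw [h8, h3, h3, h4, h5, h5, h6] at h1
    rw [h7, h7]
    linarith
  have hb : ∀ b c e, ∑ d, J p d b * B d e c - ∑ d, J p d c * B d e b
      - ∑ d, J p d e * B d c b = 0 := by
    intro b c e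
    have h1 : ∑ a, g p e a * (∑ d, J p d b * K d a c - ∑ d, J p d c * K d a b
      - (J p * K b) a c + (J p * K c) a b) = 0 :=
      Finset.sum_eq_zero fun a _ => by rw [hN, mul_zero]
    have h2 : ∀ b c, ∑ a, g p e a * ∑ d, J p d b * K d a c = ∑ d, J p d b * B d e c := by
      intro b c
      simp only [hB, Matrix.mul_apply, Finset.mul_sum]
      rw [Finset.sum_comm]
      exact Finset.sum_congr rfl fun d _ => Finset.sum_congr rfl fun a _ => by ring
    have h3 : ∀ b c, ∑ a, g p e a * (J p * K b) a c = -∑ m, J p m e * B b m c := by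
      intro b c
      rw [← Matrix.mul_apply, ← Matrix.mul_assoc, hBJ, Matrix.neg_apply, Matrix.mul_apply]
      rfl
    simp only [mul_add, mul_sub, Finset.sum_add_distrib, Finset.sum_sub_distrib, h2, h3] at h1
    -- Closedness moves the contraction with `J` from a form index to the differentiation index.
    have h4 : ∑ m, J p m e * B b m c - ∑ m, J p m e * B c m b = -∑ d, J p d e * B d c b := by
      rw [← Finset.sum_sub_distrib, ← Finset.sum_neg_distrib]
      refine Finset.sum_congr rfl fun m _ => ?_
      linear_combination J p m e * hclosed b c m - J p m e * hBanti c m b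
    linarith
  -- Write `T(x; y, z)` for `∑ J^d_x B_d(y, z)`, which is skew in `y, z`. Adding two permuted copies
  -- of `hb` leaves `2 T(c; b, e) = 0`.
  have hb0 : ∀ c e b, ∑ d, J p d c * B d b e = 0 := by
    intro c e b
    have h1 := hb b c e
    have h2 := hb c e b
    have hanti : ∀ x y z, ∑ d, J p d x * B d y z = -∑ d, J p d x * B d z y := by
      intro x y z
      rw [← Finset.sum_neg_distrib]
      exact Finset.sum_congr rfl fun d _ => by rw [hBanti d z y, mul_neg]
    linarith [hanti c b e, hanti e c b, hanti b c e]
  -- Contracting once more with `J` and using `J² = -1` removes the `J` on the differentiation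
  -- index.
  have hB0 : ∀ x, B x = 0 := by
    intro x
    ext b e
    have h1 : ∑ c, J p c x * ∑ d, J p d c * B d b e = 0 :=
      Finset.sum_eq_zero fun c _ => by rw [hb0, mul_zero]
    have h2 : ∑ c, J p c x * ∑ d, J p d c * B d b e = ∑ d, (J p * J p) d x * B d b e := by
      simp only [Matrix.mul_apply, Finset.mul_sum, Finset.sum_mul]
      rw [Finset.sum_comm]
      exact Finset.sum_congr rfl fun d _ => Finset.sum_congr rfl fun c _ => by ring
    rw [h2, hsq] at h1
    simpa [Matrix.one_apply] using h1
  have hK0 : K c = 0 := by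
    have h1 := hB0 c
    rw [← Matrix.nonsing_inv_mul_cancel_left (g p) (K c) (h.isUnit_det p hp)]
    change (g p)⁻¹ * B c = 0
    rw [h1, Matrix.mul_zero]
  rw [hpd, hK0, zero_add]

theorem IsKahlerOn.kahlerCurvature (hK : IsKahlerOn g J D) (h : IsMetricOn g D)
    (hJ : SmoothField J D) (hp : p ∈ D) : IsKahlerCurvature (g p) (J p) (curv g p) where
  symm := h.symm p hp
  isUnit_det := h.isUnit_det p hp
  sq := hK.almostComplex p hp
  orthogonal := hK.orthogonal p hp
  antisymm := curv_antisymm g p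
  bianchi := h.curv_bianchi hp
  metric := h.curv_metric hp
  comm := h.comm_curv hJ (fun _ hq => hK.parallel h hJ hq) hp

end Kahler

end Chart

namespace Chart

/-! ### Self-duality of conformally Kähler metrics -/

section Criterion

variable {g J : Field2} {D : Set Pt} {p : Pt} {l u : Pt → ℝ}

theorem IsMetricOn.smul (h : IsMetricOn g D) (hl : ContDiffOn ℝ ∞ l D) (hl0 : ∀ p ∈ D, l p ≠ 0) :
    IsMetricOn (fun p => l p • g p) D where
  isOpen := h.isOpen
  smooth a b := hl.mul (h.smooth a b)
  symm p hp := by rw [Matrix.transpose_smul, h.symm p hp]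
  isUnit_det p hp := by
    rw [Matrix.det_smul]
    exact ((hl0 p hp).isUnit.pow _).mul (h.isUnit_det p hp)

theorem IsMetricOn.weyl_antisymm (h : IsMetricOn g D) (hp : p ∈ D) (a b c d : Fin 4) :
    weyl g p b a c d = -weyl g p a b c d := by
  have h1 : riemann g p b a c d = -riemann g p a b c d := by
    have h2 := h.curv_metric hp c d
    have h3 : (curv g p c d).transpose * g p = (g p * curv g p c d).transpose := by
      rw [Matrix.transpose_mul, h.symm p hp]
    rw [h3] at h2
    have h4 := congrFun (congrFun h2 a) b
    simp only [Matrix.add_apply, Matrix.transpose_apply, Matrix.zero_apply] at h4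
    have h5 : ∀ a b, (g p * curv g p c d) a b = riemann g p a b c d := fun a b => by
      simp only [Matrix.mul_apply, curv, Matrix.of_apply, riemann]
    rw [h5, h5] at h4
    linarith
  simp only [weyl, h1]
  ring

/-- A conformally Kähler metric in dimension four is self-dual, for the orientation opposite to
that of the complex structure, if and only if the Kähler metric is scalar-flat. -/
theorem selfDual_iff_scal_eq_zero (h : IsMetricOn g D) (hl : ContDiffOn ℝ ∞ l D)
    (hl0 : ∀ p ∈ D, l p ≠ 0) (hu : ContDiffOn ℝ ∞ u D)
    (hlu : ∀ p ∈ D, ∀ c, pd c l p = 2 * l p * pd c u p)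
    (hK : IsKahlerOn (fun p => l p • g p) J D) (hJ : SmoothField J D) (hp : p ∈ D)
    (hoff : IsOffDiagonal (J p)) {η : Field2} (hη : η p = (g p * J p).transpose) :
    (∀ a b c d, dualWeyl g (fun p a b d e => -halfWedgeSq η p a b d e) p a b c d
      = weyl g p a b c d) ↔ scal (l p • g p) (curv (fun q => l q • g q) p) = 0 := by
  have hdet := h.isUnit_det p hp
  have hsq := hK.almostComplex p hp
  have ho : (J p).transpose * g p * J p = g p := by
    have h1 := hK.orthogonal p hp
    simp only [Matrix.mul_smul, Matrix.smul_mul] at h1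
    have h2 := congrArg (fun A => (l p)⁻¹ • A) h1
    simpa only [smul_smul, inv_mul_cancel₀ (hl0 p hp), one_smul] using h2
  rw [← (hK.kahlerCurvature (h.smul hl hl0) hJ hp).weylUp_iff hoff]
  have hM : ∀ c d, (Matrix.of fun a b => weyl g p a b c d)
      = g p * weylUp (g p) (curv g p) c d := by
    intro c d
    ext a b
    exact weyl_eq hdet a b c d
  have hiff : ∀ c d, (∀ a b, dualWeyl g (fun p a b d e => -halfWedgeSq η p a b d e) p a b c d
      = weyl g p a b c d) ↔ ((J p * weylUp (g p) (curv g p) c d).trace = 0 ∧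
        J p * weylUp (g p) (curv g p) c d = weylUp (g p) (curv g p) c d * J p) := by
    intro c d
    have h1 := selfDual_iff (M := Matrix.of fun a b => weyl g p a b c d) (h.symm p hp) hdet hsq ho
      (by ext a b; exact h.weyl_antisymm hp a b c d) hη
    rw [hM, Matrix.nonsing_inv_mul_cancel_left _ _ hdet] at h1
    rw [← h1, ← hM]
    rfl
  have hwc := h.weylUp_conformal hl hl0 hu hlu hp
  constructor
  · intro hw c d
    have := (hiff c d).1 fun a b => hw a b c d
    simpa only [hwc] using this
  · intro hw a b c d
    refine (hiff c d).2 ?_ a b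
    simpa only [hwc] using hw c d

/-- The scalar curvature of a Kähler metric that is invariant in the first two coordinates. -/
theorem IsKahlerOn.scal_eq (hK : IsKahlerOn g J D) (h : IsMetricOn g D) (hJ : SmoothField J D)
    (hp : p ∈ D) (hi0 : Invariant 0 g) (hi1 : Invariant 1 g)
    (hN : IsOffDiagonal (J p * (g p)⁻¹)) {m₀ m₁ : Pt → ℝ}
    (hm₀ : ∀ q ∈ D, (J q * conn g 0 q).trace = m₀ q)
    (hm₁ : ∀ q ∈ D, (J q * conn g 1 q).trace = m₁ q) :
    scal (g p) (curv g p) = -((J p * (g p)⁻¹) 2 0 * pd 2 m₀ p + (J p * (g p)⁻¹) 3 0 * pd 3 m₀ p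
      + (J p * (g p)⁻¹) 2 1 * pd 2 m₁ p + (J p * (g p)⁻¹) 3 1 * pd 3 m₁ p) := by
  have hC := hK.kahlerCurvature h hJ hp
  have hpar : ∀ q ∈ D, ∀ c, pdM c J q = J q * conn g c q - conn g c q * J q :=
    fun _ hq => hK.parallel h hJ hq
  have h0 : ∀ a, (J p * curv g p a 0).trace = pd a m₀ p := fun a => by
    rw [h.trace_curv hJ hpar hp hi0]
    exact pd_congr_on h.isOpen hm₀ hp
  have h1 : ∀ a, (J p * curv g p a 1).trace = pd a m₁ p := fun a => by
    rw [h.trace_curv hJ hpar hp hi1]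
    exact pd_congr_on h.isOpen hm₁ hp
  have ht : ∀ c d, (J p * curv g p d c).trace = -(J p * curv g p c d).trace := fun c d => by
    rw [curv_antisymm, Matrix.mul_neg, Matrix.trace_neg]
  have ha : ∀ b d, (J p * (g p)⁻¹) b d = -(J p * (g p)⁻¹) d b := by
    have : (J p * (g p)⁻¹).transpose = -(J p * (g p)⁻¹) := by
      rw [Matrix.transpose_mul, hC.inv_symm,
        inv_mul_transpose hC.isUnit_det hC.sq hC.orthogonal]
    exact fun b d => congrFun (congrFun this d) b
  have hs := hC.sum_trace
  -- Only pairs with one ignorable and one other index survive in `sum_trace`. Each pair is counted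
  -- twice, which cancels the 2 in `-2 scal`.
  obtain ⟨⟨n00, n01, n10, n11⟩, n22, n23, n32, n33⟩ := hN
  simp only [Fin.sum_univ_four, n00, n01, n10, n11, n22, n23, n32, n33, ha 0 2, ha 0 3, ha 1 2,
    ha 1 3, ht 2 0, ht 2 1, ht 3 0, ht 3 1, h0, h1] at hs
  linarith

end Criterion

end Chart

namespace Chart

/-! ### A toric ansatz for conformally Kähler metrics -/

/-- A metric `g = w⁻¹ (dψ + α dy)² + w (dz² + v (dx² + dy²))`, together with the almost-complex
structure of the 2-form `(dψ + α dy) ∧ dz + w v dx ∧ dy`, where `dψ` and `r² dy` are `r` times the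
first two coordinate covectors and `dz`, `dx` involve only the last two, which are
`g`-orthogonal. -/
structure ToricAnsatz (g J : Field2) (D : Set Pt) (r : ℝ)
    (w α v z x₂ x₃ z₂ z₃ γ₂ γ₃ : Pt → ℝ) : Prop where
  isOpen : IsOpen D
  r_ne : r ≠ 0
  inv_g₀ : Invariant 0 g
  inv_g₁ : Invariant 1 g
  inv_J₀ : Invariant 0 J
  inv_J₁ : Invariant 1 J
  inv_z₀ : Invariant 0 z
  inv_z₁ : Invariant 1 z
  smooth_w : ContDiffOn ℝ ∞ w D
  smooth_α : ContDiffOn ℝ ∞ α D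
  smooth_v : ContDiffOn ℝ ∞ v D
  smooth_z : ContDiffOn ℝ ∞ z D
  smooth_x₂ : ContDiffOn ℝ ∞ x₂ D
  smooth_x₃ : ContDiffOn ℝ ∞ x₃ D
  smooth_γ₂ : ContDiffOn ℝ ∞ γ₂ D
  smooth_γ₃ : ContDiffOn ℝ ∞ γ₃ D
  w_ne : ∀ p ∈ D, w p ≠ 0
  v_ne : ∀ p ∈ D, v p ≠ 0
  z_ne : ∀ p ∈ D, z p ≠ 0
  γ₂_ne : ∀ p ∈ D, γ₂ p ≠ 0
  γ₃_ne : ∀ p ∈ D, γ₃ p ≠ 0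
  dz₂ : ∀ p ∈ D, pd 2 z p = z₂ p
  dz₃ : ∀ p ∈ D, pd 3 z p = z₃ p
  dx₂ : ∀ p ∈ D, pd 3 x₂ p = 0
  dx₃ : ∀ p ∈ D, pd 2 x₃ p = 0
  norm_z : ∀ p ∈ D, w p * (z₂ p ^ 2 / γ₂ p + z₃ p ^ 2 / γ₃ p) = 1
  inner_zx : ∀ p ∈ D, z₂ p * x₂ p / γ₂ p + z₃ p * x₃ p / γ₃ p = 0
  norm_x : ∀ p ∈ D, w p * v p * (x₂ p ^ 2 / γ₂ p + x₃ p ^ 2 / γ₃ p) = 1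
  g_eq : ∀ p ∈ D, g p = !![r ^ 2 / w p, α p / w p, 0, 0;
    α p / w p, (α p ^ 2 / w p + w p * v p) / r ^ 2, 0, 0; 0, 0, γ₂ p, 0; 0, 0, 0, γ₃ p]
  J_eq : ∀ p ∈ D, J p = !![0, 0, -(w p * z₂ p + α p * x₂ p) / r, -(w p * z₃ p + α p * x₃ p) / r;
    0, 0, r * x₂ p, r * x₃ p;
    r * z₂ p / γ₂ p, (α p * z₂ p - w p * v p * x₂ p) / (γ₂ p * r), 0, 0;
    r * z₃ p / γ₃ p, (α p * z₃ p - w p * v p * x₃ p) / (γ₃ p * r), 0, 0]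

namespace ToricAnsatz

variable {g J : Field2} {D : Set Pt} {r : ℝ} {w α v z x₂ x₃ z₂ z₃ γ₂ γ₃ : Pt → ℝ} {p : Pt}

/-- The conformally rescaled metric `z⁻² g`. -/
abbrev resc (z : Pt → ℝ) (g : Field2) : Field2 := fun p => (z p)⁻¹ ^ 2 • g p

theorem smooth_z₂ (h : ToricAnsatz g J D r w α v z x₂ x₃ z₂ z₃ γ₂ γ₃) : ContDiffOn ℝ ∞ z₂ D :=
  (h.smooth_z.pd h.isOpen 2).congr fun p hp => (h.dz₂ p hp).symm

theorem smooth_z₃ (h : ToricAnsatz g J D r w α v z x₂ x₃ z₂ z₃ γ₂ γ₃) : ContDiffOn ℝ ∞ z₃ D :=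
  (h.smooth_z.pd h.isOpen 3).congr fun p hp => (h.dz₃ p hp).symm

theorem pd_z_comm (h : ToricAnsatz g J D r w α v z x₂ x₃ z₂ z₃ γ₂ γ₃) (hp : p ∈ D) :
    pd 3 z₂ p = pd 2 z₃ p := by
  rw [← pd_congr_on h.isOpen h.dz₂ hp, ← pd_congr_on h.isOpen h.dz₃ hp,
    pd_comm h.smooth_z h.isOpen hp]

theorem smooth_J (h : ToricAnsatz g J D r w α v z x₂ x₃ z₂ z₃ γ₂ γ₃) : SmoothField J D := by
  have hz₂ := h.smooth_z₂
  have hz₃ := h.smooth_z₃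
  have hw := h.smooth_w
  have hα := h.smooth_α
  have hv := h.smooth_v
  have hx₂ := h.smooth_x₂
  have hx₃ := h.smooth_x₃
  have hγ₂ := h.smooth_γ₂
  have hγ₃ := h.smooth_γ₃
  have hr := h.r_ne
  intro a b
  refine ContDiffOn.congr (f := fun p => (!![0, 0, -(w p * z₂ p + α p * x₂ p) / r,
    -(w p * z₃ p + α p * x₃ p) / r; 0, 0, r * x₂ p, r * x₃ p;
    r * z₂ p / γ₂ p, (α p * z₂ p - w p * v p * x₂ p) / (γ₂ p * r), 0, 0;
    r * z₃ p / γ₃ p, (α p * z₃ p - w p * v p * x₃ p) / (γ₃ p * r), 0, 0] : Mat) a b) ?_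
    fun p hp => by rw [h.J_eq p hp]
  have e1 : ∀ p ∈ D, γ₂ p * r ≠ 0 := fun p hp => mul_ne_zero (h.γ₂_ne p hp) hr
  have e2 : ∀ p ∈ D, γ₃ p * r ≠ 0 := fun p hp => mul_ne_zero (h.γ₃_ne p hp) hr
  fin_cases a <;> fin_cases b <;> simp <;> first
    | exact contDiffOn_const
    | exact ((hα.mul hx₂).neg.add (hw.mul hz₂).neg).div_const _
    | exact ((hα.mul hx₃).neg.add (hw.mul hz₃).neg).div_const _
    | exact contDiffOn_const.mul hx₂
    | exact contDiffOn_const.mul hx₃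
    | exact (contDiffOn_const.mul hz₂).div hγ₂ h.γ₂_ne
    | exact (contDiffOn_const.mul hz₃).div hγ₃ h.γ₃_ne
    | exact ((hα.mul hz₂).sub ((hw.mul hv).mul hx₂)).div (hγ₂.mul contDiffOn_const) e1
    | exact ((hα.mul hz₃).sub ((hw.mul hv).mul hx₃)).div (hγ₃.mul contDiffOn_const) e2

/-- The relations expressing that `(z₃, -z₂)` and `(-x₃, x₂)` are dual to `dx`, `dz`. -/
theorem dual_frame (h : ToricAnsatz g J D r w α v z x₂ x₃ z₂ z₃ γ₂ γ₃) (hp : p ∈ D) :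
    ∃ δ ≠ 0, z₃ p = δ * (w p * v p * x₂ p / γ₂ p) ∧ z₂ p = -δ * (w p * v p * x₃ p / γ₃ p) ∧
      x₃ p = -δ * (w p * z₂ p / γ₂ p) ∧ x₂ p = δ * (w p * z₃ p / γ₃ p) := by
  have hw := h.w_ne p hp
  have hv := h.v_ne p hp
  have h2 := h.γ₂_ne p hp
  have h3 := h.γ₃_ne p hp
  have n1 := h.norm_z p hp
  have n2 := h.inner_zx p hp
  have n3 := h.norm_x p hp
  have e1 : z₃ p = (x₂ p * z₃ p - x₃ p * z₂ p) * (w p * v p * x₂ p / γ₂ p) := by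
    linear_combination (-z₃ p) * n3 + (w p * v p * x₃ p) * n2
  have e2 : z₂ p = -(x₂ p * z₃ p - x₃ p * z₂ p) * (w p * v p * x₃ p / γ₃ p) := by
    linear_combination (-z₂ p) * n3 + (w p * v p * x₂ p) * n2
  have e3 : x₃ p = -(x₂ p * z₃ p - x₃ p * z₂ p) * (w p * z₂ p / γ₂ p) := by
    linear_combination (-x₃ p) * n1 + (w p * z₃ p) * n2
  have e4 : x₂ p = (x₂ p * z₃ p - x₃ p * z₂ p) * (w p * z₃ p / γ₃ p) := by
    linear_combination (-x₂ p) * n1 + (w p * z₂ p) * n2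
  refine ⟨x₂ p * z₃ p - x₃ p * z₂ p, fun h0 => ?_, e1, e2, e3, e4⟩
  rw [h0] at e1 e2
  rw [e1, e2] at n1
  simp at n1

/-- The 2-form `z⁻² κ` is closed. -/
theorem closed_eq (h : ToricAnsatz g J D r w α v z x₂ x₃ z₂ z₃ γ₂ γ₃)
    (hK : IsKahlerOn (resc z g) J D) (hp : p ∈ D) :
    v p * (x₂ p / γ₂ p * pd 2 α p + x₃ p / γ₃ p * pd 3 α p)
      = 2 / z p * v p - (z₂ p / γ₂ p * (pd 2 w p * v p + w p * pd 2 v p)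
        + z₃ p / γ₃ p * (pd 3 w p * v p + w p * pd 3 v p)) := by
  have hr := h.r_ne
  have h1 := hK.closed p hp 1 2 3
  have f1 : ∀ q ∈ D, fundamentalForm (resc z g) J q 2 3 = 0 := by
    intro q hq
    simp [fundamentalForm, h.g_eq q hq, h.J_eq q hq, Fin.sum_univ_four]
  have f2 : ∀ q ∈ D, fundamentalForm (resc z g) J q 3 1
      = (z q)⁻¹ ^ 2 * (w q * v q * x₃ q - α q * z₃ q) * r⁻¹ := by
    intro q hq
    have := h.w_ne q hq
    simp [fundamentalForm, h.g_eq q hq, h.J_eq q hq, Fin.sum_univ_four]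
    field_simp
    ring
  have f3 : ∀ q ∈ D, fundamentalForm (resc z g) J q 1 2
      = (z q)⁻¹ ^ 2 * (α q * z₂ q - w q * v q * x₂ q) * r⁻¹ := by
    intro q hq
    have := h.γ₂_ne q hq
    simp [fundamentalForm, h.g_eq q hq, h.J_eq q hq, Fin.sum_univ_four]
    field_simp
  have hz := h.z_ne p hp
  have dz₂ := h.smooth_z₂.diffAt h.isOpen hp
  have dz₃ := h.smooth_z₃.diffAt h.isOpen hp
  have dw := h.smooth_w.diffAt h.isOpen hp
  have dα := h.smooth_α.diffAt h.isOpen hp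
  have dv := h.smooth_v.diffAt h.isOpen hp
  have dz := h.smooth_z.diffAt h.isOpen hp
  have dx₂ := h.smooth_x₂.diffAt h.isOpen hp
  have dx₃ := h.smooth_x₃.diffAt h.isOpen hp
  rw [extDeriv2, pd_congr_on h.isOpen f1 hp, pd_congr_on h.isOpen f2 hp,
    pd_congr_on h.isOpen f3 hp, pd_const] at h1
  simp (disch := first | assumption | fun_prop (disch := assumption)) only
    [pd_mul, pd_sub, pd_pow, pd_inv, pd_const, h.dx₂ p hp, h.dx₃ p hp, h.dz₂ p hp, h.dz₃ p hp,
    h.pd_z_comm hp] at h1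
  obtain ⟨δ, hδ, e1, e2, e3, e4⟩ := h.dual_frame hp
  have hw := h.w_ne p hp
  have hv := h.v_ne p hp
  have hγ₂ := h.γ₂_ne p hp
  have hγ₃ := h.γ₃_ne p hp
  -- This is `dα ∧ dz - d(wv) ∧ dx - (2/z) w v dx ∧ dz = 0` on the last two coordinates. The
  -- relations of `dual_frame` then convert the wedges with `dz` and `dx` into inner products.
  have key : pd 2 α p * z₃ p - pd 3 α p * z₂ p + (pd 3 w p * v p + w p * pd 3 v p) * x₂ p
      - (pd 2 w p * v p + w p * pd 2 v p) * x₃ p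
      - 2 / z p * (w p * v p) * (x₂ p * z₃ p - x₃ p * z₂ p) = 0 := by
    norm_num at h1
    field_simp at h1 ⊢
    linear_combination (-1) * h1
  have hD : x₂ p * z₃ p - x₃ p * z₂ p = δ := by
    linear_combination z₃ p * e4 - z₂ p * e3 + δ * h.norm_z p hp
  have hmain : δ * w p * (v p * (x₂ p / γ₂ p * pd 2 α p + x₃ p / γ₃ p * pd 3 α p)
      - (2 / z p * v p - (z₂ p / γ₂ p * (pd 2 w p * v p + w p * pd 2 v p)
        + z₃ p / γ₃ p * (pd 3 w p * v p + w p * pd 3 v p)))) = 0 := by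
    linear_combination key - pd 2 α p * e1 + pd 3 α p * e2
      - (pd 3 w p * v p + w p * pd 3 v p) * e4 + (pd 2 w p * v p + w p * pd 2 v p) * e3
      + 2 / z p * (w p * v p) * hD
  exact sub_eq_zero.1 ((mul_eq_zero.1 hmain).resolve_left (mul_ne_zero hδ hw))

/-- The integrability of `J` for the two invariant directions. -/
theorem integrable_eq (h : ToricAnsatz g J D r w α v z x₂ x₃ z₂ z₃ γ₂ γ₃)
    (hK : IsKahlerOn (resc z g) J D) (hp : p ∈ D) :
    z₂ p / γ₂ p * pd 2 α p + z₃ p / γ₃ p * pd 3 α p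
      = v p * (x₂ p / γ₂ p * pd 2 w p + x₃ p / γ₃ p * pd 3 w p) := by
  have hr := h.r_ne
  have hw := h.w_ne p hp
  have hγ₂ := h.γ₂_ne p hp
  have hγ₃ := h.γ₃_ne p hp
  have j0 : ∀ a b, pd 0 (fun q => J q a b) p = 0 := fun a b => (h.inv_J₀.entry a b).pd_eq_zero p
  have j1 : ∀ a b, pd 1 (fun q => J q a b) p = 0 := fun a b => (h.inv_J₁.entry a b).pd_eq_zero p
  have n2 := hK.integrable p hp 2 0 1
  have n3 := hK.integrable p hp 3 0 1
  simp only [nijenhuis, Fin.sum_univ_four, j0, j1] at n2 n3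
  have dJ : ∀ a b, DifferentiableAt ℝ (fun q => J q a b) p := fun a b =>
    (h.smooth_J a b).diffAt h.isOpen hp
  have dz₂ := h.smooth_z₂.diffAt h.isOpen hp
  have dz₃ := h.smooth_z₃.diffAt h.isOpen hp
  have dw := h.smooth_w.diffAt h.isOpen hp
  have dα := h.smooth_α.diffAt h.isOpen hp
  have r0 : ∀ q ∈ D, z₂ q * J q 2 0 + z₃ q * J q 3 0 = r * (w q)⁻¹ := by
    intro q hq
    have e := h.norm_z q hq
    have := h.w_ne q hq
    have := h.γ₂_ne q hq
    have := h.γ₃_ne q hq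
    rw [h.J_eq q hq]
    simp
    field_simp at e ⊢
    linear_combination e
  have r1 : ∀ q ∈ D, z₂ q * J q 2 1 + z₃ q * J q 3 1 = r⁻¹ * (α q * (w q)⁻¹) := by
    intro q hq
    have e := h.norm_z q hq
    have e' := h.inner_zx q hq
    have := h.w_ne q hq
    have := h.γ₂_ne q hq
    have := h.γ₃_ne q hq
    rw [h.J_eq q hq]
    simp
    field_simp at e e' ⊢
    linear_combination α q * e - w q ^ 2 * v q * e'
  have c : ∀ i b, pd i (fun q => z₂ q * J q 2 b + z₃ q * J q 3 b) p
      = pd i z₂ p * J p 2 b + z₂ p * pd i (fun q => J q 2 b) p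
        + (pd i z₃ p * J p 3 b + z₃ p * pd i (fun q => J q 3 b) p) := by
    intro i b
    rw [pd_add (dz₂.fun_mul (dJ 2 b)) (dz₃.fun_mul (dJ 3 b)), pd_mul dz₂ (dJ 2 b),
      pd_mul dz₃ (dJ 3 b)]
  have c0 : ∀ i, pd i (fun q => r * (w q)⁻¹) p = r * (-pd i w p / w p ^ 2) := by
    intro i
    rw [pd_const_mul _ (dw.fun_inv hw), pd_inv dw hw]
  have c1 : ∀ i, pd i (fun q => r⁻¹ * (α q * (w q)⁻¹)) p
      = r⁻¹ * (pd i α p * (w p)⁻¹ + α p * (-pd i w p / w p ^ 2)) := by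
    intro i
    rw [pd_const_mul _ (dα.fun_mul (dw.fun_inv hw)), pd_mul dα (dw.fun_inv hw), pd_inv dw hw]
  have s0 : ∀ i, _ := fun i => (c i 0).symm.trans ((pd_congr_on h.isOpen r0 hp).trans (c0 i))
  have s1 : ∀ i, _ := fun i => (c i 1).symm.trans ((pd_congr_on h.isOpen r1 hp).trans (c1 i))
  -- Since `J` is invariant, `N(∂₀, ∂₁)` is the bracket of the vector fields `J∂₀` and `J∂₁`, which
  -- therefore commute. As `dz` is closed, `J∂₀` applied to `dz(J∂₁) = α/(r w)` equals `J∂₁` applied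
  -- to `dz(J∂₀) = r/w`.
  have key : J p 2 0 * (r⁻¹ * (pd 2 α p * (w p)⁻¹ + α p * (-pd 2 w p / w p ^ 2)))
      + J p 3 0 * (r⁻¹ * (pd 3 α p * (w p)⁻¹ + α p * (-pd 3 w p / w p ^ 2)))
      - J p 2 1 * (r * (-pd 2 w p / w p ^ 2)) - J p 3 1 * (r * (-pd 3 w p / w p ^ 2)) = 0 := by
    have hc := h.pd_z_comm hp
    linear_combination z₂ p * n2 + z₃ p * n3 - J p 2 0 * s1 2 - J p 3 0 * s1 3
      + J p 2 1 * s0 2 + J p 3 1 * s0 3 + (J p 3 0 * J p 2 1 - J p 2 0 * J p 3 1) * hc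
  rw [h.J_eq p hp] at key
  simp at key
  field_simp at key ⊢
  apply mul_left_cancel₀ hw
  linear_combination key

/-- Verified by multiplying the claimed matrix by the metric, which avoids inverting the metric
explicitly. -/
theorem J_mul_inv (h : ToricAnsatz g J D r w α v z x₂ x₃ z₂ z₃ γ₂ γ₃)
    (hdet : IsUnit (resc z g p).det) (hp : p ∈ D) : J p * (resc z g p)⁻¹
      = z p ^ 2 • !![0, 0, -(w p * z₂ p + α p * x₂ p) / (γ₂ p * r),
          -(w p * z₃ p + α p * x₃ p) / (γ₃ p * r);
        0, 0, r * x₂ p / γ₂ p, r * x₃ p / γ₃ p;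
        (w p * z₂ p + α p * x₂ p) / (γ₂ p * r), -(r * x₂ p / γ₂ p), 0, 0;
        (w p * z₃ p + α p * x₃ p) / (γ₃ p * r), -(r * x₃ p / γ₃ p), 0, 0] := by
  have hr := h.r_ne
  have hw := h.w_ne p hp
  have hz := h.z_ne p hp
  have hγ₂ := h.γ₂_ne p hp
  have hγ₃ := h.γ₃_ne p hp
  have key : ∀ N : Mat, N * resc z g p = J p → J p * (resc z g p)⁻¹ = N := by
    intro N hN
    rw [← hN, Matrix.mul_nonsing_inv_cancel_right _ _ hdet]
  apply key
  rw [h.J_eq p hp]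
  simp only [resc, h.g_eq p hp, Matrix.smul_mul, Matrix.mul_smul, smul_smul]
  have : z p ^ 2 * (z p)⁻¹ ^ 2 = 1 := by field_simp
  rw [mul_comm] at this
  rw [this, one_smul]
  ext i j
  fin_cases i <;> fin_cases j <;> simp [Matrix.mul_apply, Fin.sum_univ_four] <;> field_simp <;>
    ring

end ToricAnsatz

end Chart

/-! ### Connection traces and scalar curvature of the toric ansatz. -/

namespace Chart

namespace ToricAnsatz

variable {g J : Field2} {D : Set Pt} {r : ℝ} {w α v z x₂ x₃ z₂ z₃ γ₂ γ₃ : Pt → ℝ} {p : Pt}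

theorem invariant_resc₀ (h : ToricAnsatz g J D r w α v z x₂ x₃ z₂ z₃ γ₂ γ₃) :
    Invariant 0 (resc z g) := fun t q => by
  simp only [resc, h.inv_z₀ t q, h.inv_g₀ t q]

theorem invariant_resc₁ (h : ToricAnsatz g J D r w α v z x₂ x₃ z₂ z₃ γ₂ γ₃) :
    Invariant 1 (resc z g) := fun t q => by
  simp only [resc, h.inv_z₁ t q, h.inv_g₁ t q]

theorem smooth_factor (h : ToricAnsatz g J D r w α v z x₂ x₃ z₂ z₃ γ₂ γ₃) :
    ContDiffOn ℝ ∞ (fun p => (z p)⁻¹ ^ 2) D := (h.smooth_z.inv h.z_ne).pow 2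

theorem pd_entry (h : ToricAnsatz g J D r w α v z x₂ x₃ z₂ z₃ γ₂ γ₃) (hp : p ∈ D) (i : Fin 4) :
    (pd i (fun q => resc z g q 0 0) p = r ^ 2 * (-2 * pd i z p / (z p ^ 3 * w p)
        - pd i w p / (z p ^ 2 * w p ^ 2))) ∧
    (pd i (fun q => resc z g q 0 1) p = pd i α p / (z p ^ 2 * w p)
        - 2 * pd i z p * α p / (z p ^ 3 * w p) - α p * pd i w p / (z p ^ 2 * w p ^ 2)) ∧
    (pd i (fun q => resc z g q 1 0) p = pd i α p / (z p ^ 2 * w p)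
        - 2 * pd i z p * α p / (z p ^ 3 * w p) - α p * pd i w p / (z p ^ 2 * w p ^ 2)) ∧
    (pd i (fun q => resc z g q 1 1) p = (2 * α p * pd i α p / (z p ^ 2 * w p)
        - 2 * pd i z p * (α p ^ 2 / w p + w p * v p) / z p ^ 3
        - α p ^ 2 * pd i w p / (z p ^ 2 * w p ^ 2)
        + (pd i w p * v p + w p * pd i v p) / z p ^ 2) / r ^ 2) := by
  have hr := h.r_ne
  have hw := h.w_ne p hp
  have hz := h.z_ne p hp
  have dw := h.smooth_w.diffAt h.isOpen hp
  have dα := h.smooth_α.diffAt h.isOpen hp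
  have dv := h.smooth_v.diffAt h.isOpen hp
  have dz := h.smooth_z.diffAt h.isOpen hp
  have e00 : ∀ q ∈ D, resc z g q 0 0 = (z q)⁻¹ ^ 2 * (r ^ 2 * (w q)⁻¹) := by
    intro q hq
    simp [h.g_eq q hq, div_eq_mul_inv]
  have e01 : ∀ q ∈ D, resc z g q 0 1 = (z q)⁻¹ ^ 2 * (α q * (w q)⁻¹) := by
    intro q hq
    simp [h.g_eq q hq, div_eq_mul_inv]
  have e10 : ∀ q ∈ D, resc z g q 1 0 = (z q)⁻¹ ^ 2 * (α q * (w q)⁻¹) := by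
    intro q hq
    simp [h.g_eq q hq, div_eq_mul_inv]
  have e11 : ∀ q ∈ D, resc z g q 1 1
      = (z q)⁻¹ ^ 2 * ((r ^ 2)⁻¹ * (α q ^ 2 * (w q)⁻¹ + w q * v q)) := by
    intro q hq
    simp [h.g_eq q hq, div_eq_mul_inv]
    exact Or.inl (mul_comm _ _)
  rw [pd_congr_on h.isOpen e00 hp, pd_congr_on h.isOpen e01 hp, pd_congr_on h.isOpen e10 hp,
    pd_congr_on h.isOpen e11 hp]
  simp (disch := first | assumption | fun_prop (disch := assumption)) only
    [pd_const_mul, pd_mul, pd_add, pd_pow, pd_inv]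
  refine ⟨?_, ?_, ?_, ?_⟩ <;> push_cast <;> field_simp <;> ring

/-- An instance of `trace_conn`: the derivatives in the two ignorable directions vanish, leaving the
lower-left block of `J ĝ⁻¹`, where `ĝ` is the rescaled metric. -/
theorem sum_pd (h : ToricAnsatz g J D r w α v z x₂ x₃ z₂ z₃ γ₂ γ₃)
    (hK : IsKahlerOn (resc z g) J D) (hg : IsMetricOn g D) (hp : p ∈ D) {i : Fin 4}
    (hi : Invariant i (resc z g)) :
    (J p * conn (resc z g) i p).trace
      = z p ^ 2 * ((w p * z₂ p + α p * x₂ p) / (γ₂ p * r) * pd 2 (fun q => resc z g q 0 i) p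
        + (w p * z₃ p + α p * x₃ p) / (γ₃ p * r) * pd 3 (fun q => resc z g q 0 i) p
        - r * x₂ p / γ₂ p * pd 2 (fun q => resc z g q 1 i) p
        - r * x₃ p / γ₃ p * pd 3 (fun q => resc z g q 1 i) p) := by
  have hĝ := hg.smul h.smooth_factor fun p hp => pow_ne_zero 2 (inv_ne_zero (h.z_ne p hp))
  have hdet := hĝ.isUnit_det p hp
  have hC := hK.kahlerCurvature hĝ h.smooth_J hp
  have ha : (J p * (resc z g p)⁻¹).transpose = -(J p * (resc z g p)⁻¹) := by
    rw [Matrix.transpose_mul, hC.inv_symm, inv_mul_transpose hC.isUnit_det hC.sq hC.orthogonal]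
  rw [hĝ.trace_conn hp hi ha, h.J_mul_inv hdet hp]
  have j0 : ∀ a b, pd 0 (fun q => resc z g q a b) p = 0 := fun a b =>
    (h.invariant_resc₀.entry a b).pd_eq_zero p
  have j1 : ∀ a b, pd 1 (fun q => resc z g q a b) p = 0 := fun a b =>
    (h.invariant_resc₁.entry a b).pd_eq_zero p
  simp only [Fin.sum_univ_four, j0, j1]
  simp
  ring

/-- Closedness trades `⟨dx, dα⟩` for derivatives of `w` and `v`; the `dw` terms then cancel. With `v
= e^u`, the bracket is `u_z - 4/z`. -/
theorem trace_conn₀ (h : ToricAnsatz g J D r w α v z x₂ x₃ z₂ z₃ γ₂ γ₃)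
    (hK : IsKahlerOn (resc z g) J D) (hg : IsMetricOn g D) (hp : p ∈ D) :
    (J p * conn (resc z g) 0 p).trace = r * (w p)⁻¹ *
      (w p / v p * (z₂ p / γ₂ p * pd 2 v p + z₃ p / γ₃ p * pd 3 v p) - 4 / z p) := by
  have hr := h.r_ne
  have hw := h.w_ne p hp
  have hv := h.v_ne p hp
  have hz := h.z_ne p hp
  have hγ₂ := h.γ₂_ne p hp
  have hγ₃ := h.γ₃_ne p hp
  have k1 := h.closed_eq hK hp
  have n1 := h.norm_z p hp
  have n2 := h.inner_zx p hp
  obtain ⟨a1, -, a2, -⟩ := h.pd_entry hp 2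
  obtain ⟨b1, -, b2, -⟩ := h.pd_entry hp 3
  rw [h.sum_pd hK hg hp h.invariant_resc₀, a1, a2, b1, b2, h.dz₂ p hp, h.dz₃ p hp]
  have e : ∀ A B : ℝ, v p * w p * A = v p * w p * B → A = B := fun A B hAB =>
    mul_left_cancel₀ (mul_ne_zero hv hw) hAB
  apply e
  trans (r * (-2 * v p / z p * (w p * (z₂ p ^ 2 / γ₂ p + z₃ p ^ 2 / γ₃ p))
      - v p * (z₂ p / γ₂ p * pd 2 w p + z₃ p / γ₃ p * pd 3 w p)
      - v p * (x₂ p / γ₂ p * pd 2 α p + x₃ p / γ₃ p * pd 3 α p)))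
  · field_simp
    ring
  · rw [n1, k1]
    field_simp
    ring

/-- Closedness removes `⟨dx, dα⟩` as before, and integrability makes `⟨dz, dα⟩` cancel against `v
⟨dx, dw⟩`. The new last term is `u_x` for `v = e^u`. -/
theorem trace_conn₁ (h : ToricAnsatz g J D r w α v z x₂ x₃ z₂ z₃ γ₂ γ₃)
    (hK : IsKahlerOn (resc z g) J D) (hg : IsMetricOn g D) (hp : p ∈ D) :
    (J p * conn (resc z g) 1 p).trace = r⁻¹ * (α p * (w p)⁻¹ *
      (w p / v p * (z₂ p / γ₂ p * pd 2 v p + z₃ p / γ₃ p * pd 3 v p) - 4 / z p)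
        - w p * (x₂ p / γ₂ p * pd 2 v p + x₃ p / γ₃ p * pd 3 v p)) := by
  have hr := h.r_ne
  have hw := h.w_ne p hp
  have hv := h.v_ne p hp
  have hz := h.z_ne p hp
  have hγ₂ := h.γ₂_ne p hp
  have hγ₃ := h.γ₃_ne p hp
  have k1 := h.closed_eq hK hp
  have k2 := h.integrable_eq hK hp
  have n1 := h.norm_z p hp
  have n2 := h.inner_zx p hp
  obtain ⟨-, a1, -, a2⟩ := h.pd_entry hp 2
  obtain ⟨-, b1, -, b2⟩ := h.pd_entry hp 3
  rw [h.sum_pd hK hg hp h.invariant_resc₁, a1, a2, b1, b2, h.dz₂ p hp, h.dz₃ p hp]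
  have e : ∀ A B : ℝ, v p * w p * r * A = v p * w p * r * B → A = B := fun A B hAB =>
    mul_left_cancel₀ (mul_ne_zero (mul_ne_zero hv hw) hr) hAB
  apply e
  trans (α p * (-2 * v p / z p * (w p * (z₂ p ^ 2 / γ₂ p + z₃ p ^ 2 / γ₃ p))
      - v p * (z₂ p / γ₂ p * pd 2 w p + z₃ p / γ₃ p * pd 3 w p)
      - v p * (x₂ p / γ₂ p * pd 2 α p + x₃ p / γ₃ p * pd 3 α p))
      + 2 * w p ^ 2 * v p ^ 2 / z p * (z₂ p * x₂ p / γ₂ p + z₃ p * x₃ p / γ₃ p)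
      + v p * w p * (z₂ p / γ₂ p * pd 2 α p + z₃ p / γ₃ p * pd 3 α p)
      - v p * w p * (v p * (x₂ p / γ₂ p * pd 2 w p + x₃ p / γ₃ p * pd 3 w p))
      - v p * w p * (w p * (x₂ p / γ₂ p * pd 2 v p + x₃ p / γ₃ p * pd 3 v p)))
  · field_simp
    ring
  · rw [n1, n2, k1, k2]
    field_simp
    ring

/-- The scalar curvature of the rescaled metric. -/
theorem scal_eq (h : ToricAnsatz g J D r w α v z x₂ x₃ z₂ z₃ γ₂ γ₃)
    (hK : IsKahlerOn (resc z g) J D) (hg : IsMetricOn g D) {P Q : Pt → ℝ}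
    (hP : ∀ p ∈ D, P p = w p / v p * (z₂ p / γ₂ p * pd 2 v p + z₃ p / γ₃ p * pd 3 v p) - 4 / z p)
    (hQ : ∀ p ∈ D, Q p = w p * (x₂ p / γ₂ p * pd 2 v p + x₃ p / γ₃ p * pd 3 v p))
    (hp : p ∈ D) (dP : DifferentiableAt ℝ P p) (dQ : DifferentiableAt ℝ Q p) :
    scal (resc z g p) (curv (resc z g) p) = -(z p ^ 2 / w p) *
      (w p * (z₂ p / γ₂ p * pd 2 P p + z₃ p / γ₃ p * pd 3 P p) + P p * (P p + 2 / z p)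
        + w p * (x₂ p / γ₂ p * pd 2 Q p + x₃ p / γ₃ p * pd 3 Q p)) := by
  have hr := h.r_ne
  have hw := h.w_ne p hp
  have hv := h.v_ne p hp
  have hz := h.z_ne p hp
  have hγ₂ := h.γ₂_ne p hp
  have hγ₃ := h.γ₃_ne p hp
  have dw := h.smooth_w.diffAt h.isOpen hp
  have dα := h.smooth_α.diffAt h.isOpen hp
  have hĝ := hg.smul h.smooth_factor fun p hp => pow_ne_zero 2 (inv_ne_zero (h.z_ne p hp))
  have hdet := hĝ.isUnit_det p hp
  have hN := h.J_mul_inv hdet hp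
  have hm₀ : ∀ q ∈ D, (J q * conn (resc z g) 0 q).trace = r * (w q)⁻¹ * P q := by
    intro q hq
    rw [h.trace_conn₀ hK hg hq, hP q hq]
  have hm₁ : ∀ q ∈ D, (J q * conn (resc z g) 1 q).trace
      = r⁻¹ * (α q * (w q)⁻¹ * P q - Q q) := by
    intro q hq
    rw [h.trace_conn₁ hK hg hq, hP q hq, hQ q hq]
  have hoff : IsOffDiagonal (J p * (resc z g p)⁻¹) := by
    rw [hN]
    simp [IsOffDiagonal]
  rw [hK.scal_eq hĝ h.smooth_J hp h.invariant_resc₀ h.invariant_resc₁ hoff hm₀ hm₁, hN]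
  simp (disch := first | assumption | fun_prop (disch := assumption)) only
    [pd_const_mul, pd_mul, pd_sub, pd_inv]
  have k1 := h.closed_eq hK hp
  have hP' := hP p hp
  -- Closedness rewritten through `P`: this is the only combination of derivatives of `α` left in
  -- the scalar curvature, and its `dw` part cancels the remaining derivatives of `w`.
  have k3 : x₂ p / γ₂ p * pd 2 α p + x₃ p / γ₃ p * pd 3 α p
      = -2 / z p - P p - (z₂ p / γ₂ p * pd 2 w p + z₃ p / γ₃ p * pd 3 w p) := by
    rw [hP']
    apply mul_left_cancel₀ hv
    rw [k1]
    field_simp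
    ring
  trans -(z p ^ 2) * ((z₂ p / γ₂ p * pd 2 P p + z₃ p / γ₃ p * pd 3 P p)
    - P p / w p * (z₂ p / γ₂ p * pd 2 w p + z₃ p / γ₃ p * pd 3 w p)
    - P p / w p * (x₂ p / γ₂ p * pd 2 α p + x₃ p / γ₃ p * pd 3 α p)
    + (x₂ p / γ₂ p * pd 2 Q p + x₃ p / γ₃ p * pd 3 Q p))
  · simp
    field_simp
    ring
  · rw [k3]
    field_simp
    ring

end ToricAnsatz

end Chart

/-! ### The Chen–Teo metrics as instances of the toric ansatz. -/

namespace ChenTeo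

open Chart

/-- A Chen–Teo type metric on the chart domain over `U` that is conformally Kähler. -/
structure IsConformallyKahlerFamily (k c ν : ℝ) (X₁ X₂ : ℝ → ℝ) (G H : ℝ × ℝ → ℝ)
    (U : Set (ℝ × ℝ)) : Prop where
  c_ne : c ≠ 0
  isOpen : IsOpen U
  smooth_X₁ : ContDiffOn ℝ ∞ X₁ (Prod.fst '' U)
  smooth_X₂ : ContDiffOn ℝ ∞ X₂ (Prod.snd '' U)
  smooth_G : ContDiffOn ℝ ∞ G U
  smooth_H : ContDiffOn ℝ ∞ H U
  posDef : ∀ p ∈ domain U, (metric k X₁ X₂ G H p).PosDef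
  kahler : IsConformallyKahlerOn k c ν X₁ X₂ G H U

section Entries

variable (k c : ℝ) (X₁ X₂ : ℝ → ℝ) (G H : ℝ × ℝ → ℝ) (p : Pt)

theorem metric_eq : metric k X₁ X₂ G H p =
    !![1 / ((p 2 - p 3) * H (proj p) * F X₁ X₂ (proj p)) * F X₁ X₂ (proj p) ^ 2,
      1 / ((p 2 - p 3) * H (proj p) * F X₁ X₂ (proj p)) * (F X₁ X₂ (proj p) * G (proj p)), 0, 0;
      1 / ((p 2 - p 3) * H (proj p) * F X₁ X₂ (proj p)) * (F X₁ X₂ (proj p) * G (proj p)),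
      1 / ((p 2 - p 3) * H (proj p) * F X₁ X₂ (proj p)) * G (proj p) ^ 2
        - k * H (proj p) / (p 2 - p 3) ^ 3 * (X₁ (p 2) * X₂ (p 3) / (k * F X₁ X₂ (proj p))), 0, 0;
      0, 0, k * H (proj p) / (p 2 - p 3) ^ 3 * (1 / X₁ (p 2)), 0;
      0, 0, 0, -(k * H (proj p) / (p 2 - p 3) ^ 3 * (1 / X₂ (p 3)))] := by
  ext i j
  fin_cases i <;> fin_cases j <;>
    simp [-mul_eq_mul_left_iff, -mul_eq_mul_right_iff, metric, symSq, dτ, dφ, dx₁, dx₂, proj] <;> ring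

theorem kappa_eq : κ k c X₁ X₂ G H p =
    !![0, 0, √k / c * (c / (p 2 - p 3) ^ 2 * p 3), -(√k / c * (c / (p 2 - p 3) ^ 2 * p 2));
      0, 0, k / c ^ 2 * (G (proj p) / F X₁ X₂ (proj p)) * (c / √k) * (c / (p 2 - p 3) ^ 2 * p 3)
        - W k c X₁ X₂ H (proj p) * expU X₁ X₂ (proj p) * (c * (p 2 / X₁ (p 2)) * (c / √k)),
      -(k / c ^ 2 * (G (proj p) / F X₁ X₂ (proj p)) * (c / √k) * (c / (p 2 - p 3) ^ 2 * p 2))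
        + W k c X₁ X₂ H (proj p) * expU X₁ X₂ (proj p) * (c * (p 3 / X₂ (p 3)) * (c / √k));
      -(√k / c * (c / (p 2 - p 3) ^ 2 * p 3)),
      -(k / c ^ 2 * (G (proj p) / F X₁ X₂ (proj p)) * (c / √k) * (c / (p 2 - p 3) ^ 2 * p 3))
        + W k c X₁ X₂ H (proj p) * expU X₁ X₂ (proj p) * (c * (p 2 / X₁ (p 2)) * (c / √k)), 0, 0;
      √k / c * (c / (p 2 - p 3) ^ 2 * p 2),
      k / c ^ 2 * (G (proj p) / F X₁ X₂ (proj p)) * (c / √k) * (c / (p 2 - p 3) ^ 2 * p 2)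
        - W k c X₁ X₂ H (proj p) * expU X₁ X₂ (proj p) * (c * (p 3 / X₂ (p 3)) * (c / √k)),
      0, 0] := by
  ext i j
  fin_cases i <;> fin_cases j <;>
    simp [-mul_eq_mul_left_iff, -mul_eq_mul_right_iff, κ, wedge, dψ, dy, A, dx, dz, dτ, dφ,
      dx₁, dx₂, proj] <;> ring

/-- The definition reads `Jᵀ = κ g⁻¹`, so a candidate for `J` can be checked without inverting the
metric. -/
theorem J_eq_of_kappa {Jx : Mat} {p : Pt} (hdet : IsUnit (metric k X₁ X₂ G H p).det)
    (h : κ k c X₁ X₂ G H p = Jx.transpose * metric k X₁ X₂ G H p) :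
    J k c X₁ X₂ G H p = Jx := by
  have : J k c X₁ X₂ G H p
      = (κ k c X₁ X₂ G H p * (metric k X₁ X₂ G H p)⁻¹).transpose := by
    ext a b
    simp only [J, Matrix.of_apply, Matrix.transpose_apply, Matrix.mul_apply]
  rw [this, h, Matrix.mul_nonsing_inv_cancel_right _ _ hdet, Matrix.transpose_transpose]

end Entries

theorem proj_add_single (i : Fin 4) (hi : i = 0 ∨ i = 1) (t : ℝ) (p : Pt) :
    proj (p + Pi.single i t) = proj p := by
  rcases hi with rfl | rfl <;> simp [proj]

/-- The nondegeneracy conditions at a point. -/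
structure Nondeg (k c ν : ℝ) (X₁ X₂ : ℝ → ℝ) (H : ℝ × ℝ → ℝ) (p : Pt) : Prop where
  k_pos : 0 < k
  sub_ne : p 2 - p 3 ≠ 0
  H_ne : H (proj p) ≠ 0
  F_ne : F X₁ X₂ (proj p) ≠ 0
  X₁_ne : X₁ (p 2) ≠ 0
  X₂_ne : X₂ (p 3) ≠ 0
  z_ne : z c ν (proj p) ≠ 0

namespace IsConformallyKahlerFamily

variable {k c ν : ℝ} {X₁ X₂ : ℝ → ℝ} {G H : ℝ × ℝ → ℝ} {U : Set (ℝ × ℝ)} {p : Pt}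

/-- All of this is forced by the diagonal entries of the two positive definite metrics. -/
theorem nondeg (h : IsConformallyKahlerFamily k c ν X₁ X₂ G H U) (hp : p ∈ domain U) :
    Nondeg k c ν X₁ X₂ H p := by
  have hg := h.posDef p hp
  have h0 := hg.diag_pos (i := 0)
  have h2 := hg.diag_pos (i := 2)
  have h3 := hg.diag_pos (i := 3)
  have hz := (h.kahler.posDef p hp).diag_pos (i := 0)
  rw [metric_eq] at h0 h2 h3
  simp at h0 h2 h3
  -- Division by zero gives zero, so each degenerate case would make a diagonal entry vanish. For
  -- `z` the entry comes from the rescaled metric.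
  have sub_ne : p 2 - p 3 ≠ 0 := by
    intro e; rw [e] at h0; simp at h0
  have H_ne : H (proj p) ≠ 0 := by
    intro e; rw [e] at h0; simp at h0
  have F_ne : F X₁ X₂ (proj p) ≠ 0 := by
    intro e; rw [e] at h0; simp at h0
  have X₁_ne : X₁ (p 2) ≠ 0 := by
    intro e; rw [e] at h2; simp at h2
  have X₂_ne : X₂ (p 3) ≠ 0 := by
    intro e; rw [e] at h3; simp at h3
  have z_ne : z c ν (proj p) ≠ 0 := by
    intro e
    simp [e] at hz
  refine ⟨?_, sub_ne, H_ne, F_ne, X₁_ne, X₂_ne, z_ne⟩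
  -- Positivity of `k` comes from `k F² = x₂² (k F X₁) + x₁² (-k F X₂)`, where both bracketed
  -- factors are products of diagonal entries and squares.
  have hF : F X₁ X₂ (proj p) = p 3 ^ 2 * X₁ (p 2) - p 2 ^ 2 * X₂ (p 3) := rfl
  have e1 : 0 < k * F X₁ X₂ (proj p) * X₁ (p 2) := by
    have h4 := mul_pos (mul_pos h0 h2) (show 0 < ((p 2 - p 3) ^ 2 * X₁ (p 2)) ^ 2 by positivity)
    have e : k * F X₁ X₂ (proj p) * X₁ (p 2) = (F X₁ X₂ (proj p))⁻¹ * ((H (proj p))⁻¹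
        * (p 2 - p 3)⁻¹) * F X₁ X₂ (proj p) ^ 2 * (k * H (proj p) / (p 2 - p 3) ^ 3
        * (X₁ (p 2))⁻¹) * ((p 2 - p 3) ^ 2 * X₁ (p 2)) ^ 2 := by
      generalize p 2 - p 3 = s at *
      field_simp
    rwa [e]
  have e2 : 0 < -(k * F X₁ X₂ (proj p) * X₂ (p 3)) := by
    have h4 := mul_pos (mul_pos h0 (neg_pos.2 h3))
      (show 0 < ((p 2 - p 3) ^ 2 * X₂ (p 3)) ^ 2 by positivity)
    have e : -(k * F X₁ X₂ (proj p) * X₂ (p 3)) = (F X₁ X₂ (proj p))⁻¹ * ((H (proj p))⁻¹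
        * (p 2 - p 3)⁻¹) * F X₁ X₂ (proj p) ^ 2 * -(k * H (proj p) / (p 2 - p 3) ^ 3
        * (X₂ (p 3))⁻¹) * ((p 2 - p 3) ^ 2 * X₂ (p 3)) ^ 2 := by
      generalize p 2 - p 3 = s at *
      field_simp
    rwa [e]
  have k_ne : k ≠ 0 := by
    intro e; rw [e] at e1; simp at e1
  have e3 : 0 ≤ k * F X₁ X₂ (proj p) ^ 2 := by
    have : k * F X₁ X₂ (proj p) ^ 2 = p 3 ^ 2 * (k * F X₁ X₂ (proj p) * X₁ (p 2))
        + p 2 ^ 2 * -(k * F X₁ X₂ (proj p) * X₂ (p 3)) := by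
      rw [sq (F X₁ X₂ (proj p))]
      nth_rw 2 [hF]
      ring
    rw [this]
    positivity
  exact lt_of_le_of_ne (nonneg_of_mul_nonneg_left e3 (by positivity)) k_ne.symm

theorem contDiff_proj : ContDiff ℝ ∞ proj :=
  (contDiff_apply ℝ ℝ (2 : Fin 4)).prodMk (contDiff_apply ℝ ℝ (3 : Fin 4))

theorem isOpen_domain (h : IsConformallyKahlerFamily k c ν X₁ X₂ G H U) : IsOpen (domain U) :=
  h.isOpen.preimage contDiff_proj.continuous

theorem contDiffOn_X₁ (h : IsConformallyKahlerFamily k c ν X₁ X₂ G H U) :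
    ContDiffOn ℝ ∞ (fun p : Pt => X₁ (p 2)) (domain U) :=
  h.smooth_X₁.comp (contDiff_apply ℝ ℝ (2 : Fin 4)).contDiffOn fun _ hp => ⟨_, hp, rfl⟩

theorem contDiffOn_X₂ (h : IsConformallyKahlerFamily k c ν X₁ X₂ G H U) :
    ContDiffOn ℝ ∞ (fun p : Pt => X₂ (p 3)) (domain U) :=
  h.smooth_X₂.comp (contDiff_apply ℝ ℝ (3 : Fin 4)).contDiffOn fun _ hp => ⟨_, hp, rfl⟩

theorem contDiffOn_G (h : IsConformallyKahlerFamily k c ν X₁ X₂ G H U) :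
    ContDiffOn ℝ ∞ (fun p : Pt => G (proj p)) (domain U) :=
  h.smooth_G.comp contDiff_proj.contDiffOn fun _ hp => hp

theorem contDiffOn_H (h : IsConformallyKahlerFamily k c ν X₁ X₂ G H U) :
    ContDiffOn ℝ ∞ (fun p : Pt => H (proj p)) (domain U) :=
  h.smooth_H.comp contDiff_proj.contDiffOn fun _ hp => hp

theorem contDiffOn_coord (i : Fin 4) : ContDiffOn ℝ ∞ (fun p : Pt => p i) (domain U) :=
  (contDiff_apply ℝ ℝ i).contDiffOn

theorem contDiffOn_F (h : IsConformallyKahlerFamily k c ν X₁ X₂ G H U) :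
    ContDiffOn ℝ ∞ (fun p : Pt => F X₁ X₂ (proj p)) (domain U) :=
  (((contDiffOn_coord 3).pow 2).mul h.contDiffOn_X₁).sub
    (((contDiffOn_coord 2).pow 2).mul h.contDiffOn_X₂)

theorem contDiffOn_sub : ContDiffOn ℝ ∞ (fun p : Pt => p 2 - p 3) (domain U) :=
  (contDiffOn_coord 2).sub (contDiffOn_coord 3)

theorem z_proj (hc : c = -(1 + ν)) (hs : p 2 - p 3 ≠ 0) :
    z c ν (proj p) = (ν * p 2 + p 3) / (p 2 - p 3) := by
  have : p 3 - p 2 ≠ 0 := by rw [← neg_sub]; exact neg_ne_zero.2 hs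
  simp only [z, proj, hc]
  rw [show p 3 - p 2 = -(p 2 - p 3) by ring]
  field_simp
  ring

theorem metric_toric (hc : c ≠ 0) (n : Nondeg k c ν X₁ X₂ H p) : metric k X₁ X₂ G H p =
    !![(√k / c) ^ 2 / W k c X₁ X₂ H (proj p),
      k / c ^ 2 * (G (proj p) / F X₁ X₂ (proj p)) / W k c X₁ X₂ H (proj p), 0, 0;
      k / c ^ 2 * (G (proj p) / F X₁ X₂ (proj p)) / W k c X₁ X₂ H (proj p),
      ((k / c ^ 2 * (G (proj p) / F X₁ X₂ (proj p))) ^ 2 / W k c X₁ X₂ H (proj p)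
        + W k c X₁ X₂ H (proj p) * expU X₁ X₂ (proj p)) / (√k / c) ^ 2, 0, 0;
      0, 0, k * H (proj p) / ((p 2 - p 3) ^ 3 * X₁ (p 2)), 0;
      0, 0, 0, -(k * H (proj p) / ((p 2 - p 3) ^ 3 * X₂ (p 3)))] := by
  obtain ⟨k_pos, sub_ne, H_ne, F_ne, X₁_ne, X₂_ne, z_ne⟩ := n
  have hk := k_pos.ne'
  have e0 : W k c X₁ X₂ H (proj p) = k / c ^ 2 * ((p 2 - p 3) * H (proj p) / F X₁ X₂ (proj p)) :=
    rfl
  have e1 : expU X₁ X₂ (proj p) = -(X₁ (p 2) * X₂ (p 3)) / (p 2 - p 3) ^ 4 := rfl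
  rw [metric_eq, e0, e1, div_pow, Real.sq_sqrt k_pos.le]
  generalize p 2 - p 3 = s at *
  generalize F X₁ X₂ (proj p) = f at *
  ext i j
  fin_cases i <;> fin_cases j <;> simp [-mul_eq_mul_left_iff, -mul_eq_mul_right_iff] <;>
    field_simp
  ring

theorem J_toric (hc : c ≠ 0) (hdet : IsUnit (metric k X₁ X₂ G H p).det)
    (n : Nondeg k c ν X₁ X₂ H p) {r w α v x₂ x₃ z₂ z₃ γ₂ γ₃ : ℝ}
    (hr : r = √k / c) (hw : w = W k c X₁ X₂ H (proj p))
    (hα : α = k / c ^ 2 * (G (proj p) / F X₁ X₂ (proj p))) (hv : v = expU X₁ X₂ (proj p))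
    (hx₂ : x₂ = c * (p 2 / X₁ (p 2))) (hx₃ : x₃ = -(c * (p 3 / X₂ (p 3))))
    (hz₂ : z₂ = c * p 3 / (p 2 - p 3) ^ 2) (hz₃ : z₃ = -(c * p 2 / (p 2 - p 3) ^ 2))
    (hγ₂ : γ₂ = k * H (proj p) / ((p 2 - p 3) ^ 3 * X₁ (p 2)))
    (hγ₃ : γ₃ = -(k * H (proj p) / ((p 2 - p 3) ^ 3 * X₂ (p 3)))) :
    J k c X₁ X₂ G H p = !![0, 0, -(w * z₂ + α * x₂) / r, -(w * z₃ + α * x₃) / r;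
      0, 0, r * x₂, r * x₃;
      r * z₂ / γ₂, (α * z₂ - w * v * x₂) / (γ₂ * r), 0, 0;
      r * z₃ / γ₃, (α * z₃ - w * v * x₃) / (γ₃ * r), 0, 0] := by
  refine J_eq_of_kappa _ _ _ _ _ _ hdet ?_
  rw [metric_toric hc n]
  obtain ⟨k_pos, sub_ne, H_ne, F_ne, X₁_ne, X₂_ne, z_ne⟩ := n
  have hk := k_pos.ne'
  have hk2 := (Real.sqrt_pos.2 k_pos).ne'
  have e : κ k c X₁ X₂ G H p = !![0, 0, r * z₂, r * z₃;
      0, 0, (α * z₂ - w * v * x₂) / r, (α * z₃ - w * v * x₃) / r;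
      -(r * z₂), -((α * z₂ - w * v * x₂) / r), 0, 0;
      -(r * z₃), -((α * z₃ - w * v * x₃) / r), 0, 0] := by
    rw [kappa_eq, ← hw, ← hα, ← hv, hr, hx₂, hx₃, hz₂, hz₃]
    generalize p 2 - p 3 = s at *
    ext i j
    fin_cases i <;> fin_cases j <;> simp [-mul_eq_mul_left_iff, -mul_eq_mul_right_iff] <;>
      field_simp <;> ring
  have hr0 : r ≠ 0 := by rw [hr]; exact div_ne_zero hk2 hc
  have hw0 : w ≠ 0 := by
    rw [hw]
    exact mul_ne_zero (div_ne_zero hk (pow_ne_zero 2 hc))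
      (div_ne_zero (mul_ne_zero sub_ne H_ne) F_ne)
  have hγ₂0 : γ₂ ≠ 0 := by
    rw [hγ₂]
    exact div_ne_zero (mul_ne_zero hk H_ne) (mul_ne_zero (pow_ne_zero 3 sub_ne) X₁_ne)
  have hγ₃0 : γ₃ ≠ 0 := by
    rw [hγ₃]
    exact neg_ne_zero.2 (div_ne_zero (mul_ne_zero hk H_ne)
      (mul_ne_zero (pow_ne_zero 3 sub_ne) X₂_ne))
  rw [e, ← hw, ← hα, ← hv, ← hr, ← hγ₂, ← hγ₃]
  ext i j
  fin_cases i <;> fin_cases j <;>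
    simp [-mul_eq_mul_left_iff, -mul_eq_mul_right_iff, Matrix.mul_apply, Fin.sum_univ_four] <;>
    field_simp <;> ring

theorem isUnit_det (h : IsConformallyKahlerFamily k c ν X₁ X₂ G H U) (hp : p ∈ domain U) :
    IsUnit (metric k X₁ X₂ G H p).det := (h.posDef p hp).det_pos.ne'.isUnit

/-- The metrics of the family are instances of the toric ansatz. -/
theorem toricAnsatz (h : IsConformallyKahlerFamily k c ν X₁ X₂ G H U) (hk : 0 < k) :
    ToricAnsatz (metric k X₁ X₂ G H) (J k c X₁ X₂ G H) (domain U) (√k / c)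
      (fun p => W k c X₁ X₂ H (proj p)) (fun p => k / c ^ 2 * (G (proj p) / F X₁ X₂ (proj p)))
      (fun p => expU X₁ X₂ (proj p)) (fun p => z c ν (proj p))
      (fun p => c * (p 2 / X₁ (p 2))) (fun p => -(c * (p 3 / X₂ (p 3))))
      (fun p => c * p 3 / (p 2 - p 3) ^ 2) (fun p => -(c * p 2 / (p 2 - p 3) ^ 2))
      (fun p => k * H (proj p) / ((p 2 - p 3) ^ 3 * X₁ (p 2)))
      (fun p => -(k * H (proj p) / ((p 2 - p 3) ^ 3 * X₂ (p 3)))) := by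
  have hc := h.c_ne
  have hX₁ := h.contDiffOn_X₁
  have hX₂ := h.contDiffOn_X₂
  have hG := h.contDiffOn_G
  have hH := h.contDiffOn_H
  have hF := h.contDiffOn_F
  have hs : ContDiffOn ℝ ∞ (fun p : Pt => p 2 - p 3) (domain U) := contDiffOn_sub
  have hs' : ContDiffOn ℝ ∞ (fun p : Pt => p 3 - p 2) (domain U) :=
    (contDiffOn_coord 3).sub (contDiffOn_coord 2)
  have sub_ne' : ∀ p ∈ domain U, p 3 - p 2 ≠ 0 := fun p hp =>
    sub_ne_zero.2 (sub_ne_zero.1 (h.nondeg hp).sub_ne).symm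
  have den₂ : ∀ p ∈ domain U, (p 2 - p 3) ^ 3 * X₁ (p 2) ≠ 0 := fun p hp =>
    mul_ne_zero (pow_ne_zero 3 (h.nondeg hp).sub_ne) (h.nondeg hp).X₁_ne
  have den₃ : ∀ p ∈ domain U, (p 2 - p 3) ^ 3 * X₂ (p 3) ≠ 0 := fun p hp =>
    mul_ne_zero (pow_ne_zero 3 (h.nondeg hp).sub_ne) (h.nondeg hp).X₂_ne
  have inv : ∀ {f : Field2} (i : Fin 4), (i = 0 ∨ i = 1) →
      (∀ p q : Pt, proj p = proj q → f p = f q) → Invariant i f := fun i hi hf t p =>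
    hf _ _ (proj_add_single i hi t p)
  have hgp : ∀ p q : Pt, proj p = proj q → metric k X₁ X₂ G H p = metric k X₁ X₂ G H q :=
    fun p q e => by simp only [metric, e]
  have hJp : ∀ p q : Pt, proj p = proj q → J k c X₁ X₂ G H p = J k c X₁ X₂ G H q :=
    fun p q e => by simp only [J, κ, hgp p q e, e]
  have pdz : ∀ p ∈ domain U, ∀ i, pd i (fun p => z c ν (proj p)) p
      = c * (pd i (fun p => p 3) p * (p 3 - p 2)
        - p 3 * (pd i (fun p => p 3) p - pd i (fun p => p 2) p)) / (p 3 - p 2) ^ 2 := by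
    intro p hp i
    have := sub_ne' p hp
    change pd i (fun q => c * q 3 / (q 3 - q 2) + ν) p = _
    simp (disch := first | assumption | fun_prop (disch := assumption)) only
      [pd_add, pd_div, pd_mul, pd_sub, pd_const]
    ring
  exact
    { isOpen := h.isOpen_domain
      r_ne := div_ne_zero (Real.sqrt_pos.2 hk).ne' hc
      inv_g₀ := inv 0 (Or.inl rfl) hgp
      inv_g₁ := inv 1 (Or.inr rfl) hgp
      inv_J₀ := inv 0 (Or.inl rfl) hJp
      inv_J₁ := inv 1 (Or.inr rfl) hJp
      inv_z₀ := fun t p => by simp only [proj_add_single 0 (Or.inl rfl)]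
      inv_z₁ := fun t p => by simp only [proj_add_single 1 (Or.inr rfl)]
      smooth_w := contDiffOn_const.mul ((hs.mul hH).div hF fun p hp => (h.nondeg hp).F_ne)
      smooth_α := contDiffOn_const.mul (hG.div hF fun p hp => (h.nondeg hp).F_ne)
      smooth_v := (hX₁.mul hX₂).neg.div (hs.pow 4) fun p hp =>
        pow_ne_zero 4 (h.nondeg hp).sub_ne
      smooth_z := ((contDiffOn_const.mul (contDiffOn_coord 3)).div hs' sub_ne').add
        contDiffOn_const
      smooth_x₂ := contDiffOn_const.mul ((contDiffOn_coord 2).div hX₁ fun p hp =>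
        (h.nondeg hp).X₁_ne)
      smooth_x₃ := (contDiffOn_const.mul ((contDiffOn_coord 3).div hX₂ fun p hp =>
        (h.nondeg hp).X₂_ne)).neg
      smooth_γ₂ := (contDiffOn_const.mul hH).div ((hs.pow 3).mul hX₁) den₂
      smooth_γ₃ := ((contDiffOn_const.mul hH).div ((hs.pow 3).mul hX₂) den₃).neg
      w_ne := fun p hp => mul_ne_zero (div_ne_zero (h.nondeg hp).k_pos.ne' (pow_ne_zero 2 hc))
        (div_ne_zero (mul_ne_zero (h.nondeg hp).sub_ne (h.nondeg hp).H_ne) (h.nondeg hp).F_ne)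
      v_ne := fun p hp => div_ne_zero (neg_ne_zero.2 (mul_ne_zero (h.nondeg hp).X₁_ne
        (h.nondeg hp).X₂_ne)) (pow_ne_zero 4 (h.nondeg hp).sub_ne)
      z_ne := fun p hp => (h.nondeg hp).z_ne
      γ₂_ne := fun p hp => div_ne_zero (mul_ne_zero (h.nondeg hp).k_pos.ne' (h.nondeg hp).H_ne)
        (den₂ p hp)
      γ₃_ne := fun p hp => neg_ne_zero.2 (div_ne_zero
        (mul_ne_zero (h.nondeg hp).k_pos.ne' (h.nondeg hp).H_ne) (den₃ p hp))
      dz₂ := fun p hp => by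
        rw [pdz p hp, pd_coord, pd_coord, ← neg_sub (p 2) (p 3), neg_sq]
        simp
      dz₃ := fun p hp => by
        rw [pdz p hp, pd_coord, pd_coord, ← neg_sub (p 2) (p 3), neg_sq]
        simp
        ring
      dx₂ := fun p _ => Invariant.pd_eq_zero (fun t p => by simp) p
      dx₃ := fun p _ => Invariant.pd_eq_zero (fun t p => by simp) p
      norm_z := fun p hp => by
        obtain ⟨k_pos, sub_ne, H_ne, F_ne, X₁_ne, X₂_ne, z_ne⟩ := h.nondeg hp
        have hk := k_pos.ne'
        -- The definition of `F` is exactly what gives `dz` the squared norm `1/W`.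
        have hF : F X₁ X₂ (proj p) = p 3 ^ 2 * X₁ (p 2) - p 2 ^ 2 * X₂ (p 3) := rfl
        change k / c ^ 2 * ((p 2 - p 3) * H (proj p) / F X₁ X₂ (proj p)) * _ = 1
        generalize p 2 - p 3 = s at *
        generalize F X₁ X₂ (proj p) = f at *
        field_simp
        linear_combination -hF
      inner_zx := fun p hp => by
        obtain ⟨k_pos, sub_ne, H_ne, F_ne, X₁_ne, X₂_ne, z_ne⟩ := h.nondeg hp
        have hk := k_pos.ne'
        generalize p 2 - p 3 = s at *
        field_simp
        ring
      norm_x := fun p hp => by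
        obtain ⟨k_pos, sub_ne, H_ne, F_ne, X₁_ne, X₂_ne, z_ne⟩ := h.nondeg hp
        have hk := k_pos.ne'
        have hF : F X₁ X₂ (proj p) = p 3 ^ 2 * X₁ (p 2) - p 2 ^ 2 * X₂ (p 3) := rfl
        change k / c ^ 2 * ((p 2 - p 3) * H (proj p) / F X₁ X₂ (proj p))
          * (-(X₁ (p 2) * X₂ (p 3)) / (p 2 - p 3) ^ 4) * _ = 1
        generalize p 2 - p 3 = s at *
        generalize F X₁ X₂ (proj p) = f at *
        field_simp
        linear_combination -hF
      g_eq := fun p hp => metric_toric hc (h.nondeg hp)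
      J_eq := fun p hp => J_toric hc (h.isUnit_det hp) (h.nondeg hp) rfl rfl rfl rfl rfl rfl rfl
        rfl rfl rfl }

end IsConformallyKahlerFamily
end ChenTeo

/-! ### Solving the scalar-flatness equation for the structure functions. -/

namespace ChenTeo

open Set Filter Topology

section ScalarRelation

theorem hasDerivAt_deriv {f : ℝ → ℝ} {S : Set ℝ} (hS : IsOpen S) (hf : ContDiffOn ℝ ∞ f S)
    {a : ℝ} (ha : a ∈ S) : HasDerivAt f (deriv f a) a :=
  ((hf.differentiableOn (by simp)).differentiableAt (hS.mem_nhds ha)).hasDerivAt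

theorem contDiffOn_deriv {f : ℝ → ℝ} {S : Set ℝ} (hS : IsOpen S) (hf : ContDiffOn ℝ ∞ f S) :
    ContDiffOn ℝ ∞ (deriv f) S :=
  ((contDiffOn_infty_iff_deriv_of_isOpen hS).1 hf).2

theorem deriv_eq_of_eqOn {f g : ℝ → ℝ} {S : Set ℝ} (hS : IsOpen S) (h : EqOn f g S) :
    EqOn (deriv f) (deriv g) S := fun _ ha =>
  (h.eventuallyEq_of_mem (hS.mem_nhds ha)).deriv_eq

theorem hasDerivAt_quartic (r₀ r₁ r₂ r₃ r₄ a : ℝ) :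
    HasDerivAt (fun a => r₀ + r₁ * a + r₂ * a ^ 2 + r₃ * a ^ 3 + r₄ * a ^ 4)
      (r₁ + 2 * r₂ * a + 3 * r₃ * a ^ 2 + 4 * r₄ * a ^ 3) a := by
  have h := ((((hasDerivAt_const a r₀).add ((hasDerivAt_id a).const_mul r₁)).add
    ((hasDerivAt_pow 2 a).const_mul r₂)).add ((hasDerivAt_pow 3 a).const_mul r₃)).add
    ((hasDerivAt_pow 4 a).const_mul r₄)
  refine h.congr_deriv ?_
  push_cast
  ring

theorem deriv_quartic_of_eqOn {f : ℝ → ℝ} {S : Set ℝ} (hS : IsOpen S) {r₀ r₁ r₂ r₃ r₄ : ℝ}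
    (h : ∀ a ∈ S, f a = r₀ + r₁ * a + r₂ * a ^ 2 + r₃ * a ^ 3 + r₄ * a ^ 4) {a : ℝ} (ha : a ∈ S) :
    deriv f a = r₁ + (2 * r₂) * a + (3 * r₃) * a ^ 2 + (4 * r₄) * a ^ 3 + 0 * a ^ 4 := by
  rw [deriv_eq_of_eqOn hS h ha, (hasDerivAt_quartic r₀ r₁ r₂ r₃ r₄ a).deriv]
  ring

/-- Five successive integrations; connectedness of the domain makes each integration constant
global. -/
theorem exists_quartic {f : ℝ → ℝ} {S : Set ℝ} (hS : IsOpen S) (hSc : IsPreconnected S)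
    (hf : ContDiffOn ℝ ∞ f S)
    (h : ∀ a ∈ S, deriv (deriv (deriv (deriv (deriv f)))) a = 0) :
    ∃ a₀ a₁ a₂ a₃ a₄ : ℝ, ∀ a ∈ S, f a = a₀ + a₁ * a + a₂ * a ^ 2 + a₃ * a ^ 3 + a₄ * a ^ 4 := by
  have h1 := contDiffOn_deriv hS hf
  have h2 := contDiffOn_deriv hS h1
  have h3 := contDiffOn_deriv hS h2
  have h4 := contDiffOn_deriv hS h3
  have key : ∀ {f : ℝ → ℝ} {r₁ r₂ r₃ r₄ : ℝ}, ContDiffOn ℝ ∞ f S →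
      (∀ a ∈ S, deriv f a = r₁ + 2 * r₂ * a + 3 * r₃ * a ^ 2 + 4 * r₄ * a ^ 3) →
      ∃ r₀, ∀ a ∈ S, f a = r₀ + r₁ * a + r₂ * a ^ 2 + r₃ * a ^ 3 + r₄ * a ^ 4 := by
    intro f r₁ r₂ r₃ r₄ hf hd
    have hq := fun a => hasDerivAt_quartic 0 r₁ r₂ r₃ r₄ a
    obtain ⟨r, hr⟩ := hS.exists_eq_add_of_deriv_eq hSc (hf.differentiableOn (by simp))
      (fun a _ => (hq a).differentiableAt.differentiableWithinAt)
      (fun a ha => (hd a ha).trans (hq a).deriv.symm)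
    exact ⟨r, fun a ha => (hr ha).trans (by simp only; ring)⟩
  obtain ⟨r₄, e4⟩ := key (r₁ := 0) (r₂ := 0) (r₃ := 0) (r₄ := 0) h4
    fun a ha => (h a ha).trans (by ring)
  obtain ⟨r₃, e3⟩ := key (r₁ := r₄) (r₂ := 0) (r₃ := 0) (r₄ := 0) h3
    fun a ha => (e4 a ha).trans (by ring)
  obtain ⟨r₂, e2⟩ := key (r₁ := r₃) (r₂ := r₄ / 2) (r₃ := 0) (r₄ := 0) h2
    fun a ha => (e3 a ha).trans (by ring)
  obtain ⟨r₁, e1⟩ := key (r₁ := r₂) (r₂ := r₃ / 2) (r₃ := r₄ / 6) (r₄ := 0) h1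
    fun a ha => (e2 a ha).trans (by ring)
  obtain ⟨r₀, e0⟩ := key (r₁ := r₁) (r₂ := r₂ / 2) (r₃ := r₃ / 6) (r₄ := r₄ / 24) hf
    fun a ha => (e1 a ha).trans (by ring)
  exact ⟨r₀, _, _, _, _, e0⟩

/-- Horizontal slices of an open set are open, so a relation holding on `U` may be differentiated in
the first variable. The slices need not be connected. -/
theorem deriv_fst_eq_zero {U : Set (ℝ × ℝ)} (hU : IsOpen U) {Φ : ℝ → ℝ → ℝ}
    (h : ∀ x ∈ U, Φ x.1 x.2 = 0) {a b d : ℝ} (hx : (a, b) ∈ U)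
    (hd : HasDerivAt (fun t => Φ t b) d a) : d = 0 := by
  have hV : IsOpen {t : ℝ | (t, b) ∈ U} := hU.preimage (by fun_prop)
  have : (fun t => Φ t b) =ᶠ[𝓝 a] fun _ => 0 := by
    filter_upwards [hV.mem_nhds hx] with t ht using h _ ht
  rw [← hd.deriv, this.deriv_eq, deriv_const]

/-- The vanishing of the scalar curvature of the Kähler metric, as a relation between `X₁` and
`X₂`. -/
def scalarRel (ν : ℝ) (X₁ X₂ : ℝ → ℝ) (a b : ℝ) : ℝ :=
  (ν * a + b) ^ 2 * (deriv (deriv X₁) a - deriv (deriv X₂) b)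
    - 6 * (ν * a + b) * (ν * deriv X₁ a - deriv X₂ b) + 12 * (ν ^ 2 * X₁ a - X₂ b)

/-- The coefficients of `X₂` and its derivatives have degree at most two in `a`, so three
derivatives in `a` eliminate `X₂`. The remaining terms collapse to `(ν a + b)² X₁⁽⁵⁾`. The resulting
equation concerns `X₁` alone, on the connected projection of `U`, so its coefficients are global
constants even if the slices of `U` are disconnected. -/
theorem scalarRel_eq_zero_iff {ν : ℝ} (hν : ν ≠ 0) {U : Set (ℝ × ℝ)} (hU : IsOpen U)
    (hUc : IsPreconnected U) {X₁ X₂ : ℝ → ℝ} (hX₁ : ContDiffOn ℝ ∞ X₁ (Prod.fst '' U))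
    (hs : ∀ x ∈ U, ν * x.1 + x.2 ≠ 0) :
    (∀ x ∈ U, scalarRel ν X₁ X₂ x.1 x.2 = 0) ↔
      ∃ a₀ a₁ a₂ a₃ a₄ : ℝ, ∀ x ∈ U,
        X₁ x.1 = a₀ + a₁ * x.1 + a₂ * x.1 ^ 2 + a₃ * x.1 ^ 3 + a₄ * x.1 ^ 4 ∧
        X₂ x.2 = a₀ * ν ^ 2 - a₁ * ν * x.2 + a₂ * x.2 ^ 2 - a₃ / ν * x.2 ^ 3
          + a₄ / ν ^ 2 * x.2 ^ 4 := by
  have hS : IsOpen (Prod.fst '' U) := isOpenMap_fst U hU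
  have hT : IsOpen (Prod.snd '' U) := isOpenMap_snd U hU
  have d1 := contDiffOn_deriv hS hX₁
  have d2 := contDiffOn_deriv hS d1
  have d3 := contDiffOn_deriv hS d2
  have d4 := contDiffOn_deriv hS d3
  constructor
  · intro h
    have sd : ∀ a b : ℝ, HasDerivAt (fun t => ν * t + b) ν a := fun a b => by
      simpa using ((hasDerivAt_id a).const_mul ν).add_const b
    have r1 : ∀ x ∈ U, (ν * x.1 + x.2) ^ 2 * deriv (deriv (deriv X₁)) x.1
        - 4 * ν * (ν * x.1 + x.2) * deriv (deriv X₁) x.1 + 6 * ν ^ 2 * deriv X₁ x.1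
        - 2 * ν * (ν * x.1 + x.2) * deriv (deriv X₂) x.2 + 6 * ν * deriv X₂ x.2 = 0 := by
      rintro ⟨a, b⟩ hx
      have ha : a ∈ Prod.fst '' U := ⟨_, hx, rfl⟩
      have e := ((((sd a b).pow 2).mul ((hasDerivAt_deriv hS d2 ha).sub_const
        (deriv (deriv X₂) b))).sub (((sd a b).const_mul 6).mul
        (((hasDerivAt_deriv hS d1 ha).const_mul ν).sub_const (deriv X₂ b)))).add
        ((((hasDerivAt_deriv hS hX₁ ha).const_mul (ν ^ 2)).sub_const (X₂ b)).const_mul 12)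
      have e := deriv_fst_eq_zero hU h hx e
      simp only [Pi.pow_apply] at e
      push_cast at e
      linear_combination e
    have r2 : ∀ x ∈ U, (ν * x.1 + x.2) ^ 2 * deriv (deriv (deriv (deriv X₁))) x.1
        - 2 * ν * (ν * x.1 + x.2) * deriv (deriv (deriv X₁)) x.1
        + 2 * ν ^ 2 * deriv (deriv X₁) x.1 - 2 * ν ^ 2 * deriv (deriv X₂) x.2 = 0 := by
      rintro ⟨a, b⟩ hx
      have ha : a ∈ Prod.fst '' U := ⟨_, hx, rfl⟩
      have e := (((((sd a b).pow 2).mul (hasDerivAt_deriv hS d3 ha)).sub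
        (((sd a b).const_mul (4 * ν)).mul (hasDerivAt_deriv hS d2 ha))).add
        ((hasDerivAt_deriv hS d1 ha).const_mul (6 * ν ^ 2))).sub
        (((sd a b).const_mul (2 * ν)).mul_const (deriv (deriv X₂) b))
      have e := deriv_fst_eq_zero (Φ := fun a b => (ν * a + b) ^ 2 * deriv (deriv (deriv X₁)) a
        - 4 * ν * (ν * a + b) * deriv (deriv X₁) a + 6 * ν ^ 2 * deriv X₁ a
        - 2 * ν * (ν * a + b) * deriv (deriv X₂) b + 6 * ν * deriv X₂ b)
        hU r1 hx (e.add_const (6 * ν * deriv X₂ b))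
      simp only [Pi.pow_apply] at e
      push_cast at e
      linear_combination e
    have r3 : ∀ a ∈ Prod.fst '' U,
        deriv (deriv (deriv (deriv (deriv X₁)))) a = 0 := by
      rintro _ ⟨⟨a, b⟩, hx, rfl⟩
      have ha : a ∈ Prod.fst '' U := ⟨_, hx, rfl⟩
      have e := ((((sd a b).pow 2).mul (hasDerivAt_deriv hS d4 ha)).sub
        (((sd a b).const_mul (2 * ν)).mul (hasDerivAt_deriv hS d3 ha))).add
        ((hasDerivAt_deriv hS d2 ha).const_mul (2 * ν ^ 2))
      have e := deriv_fst_eq_zero (Φ := fun a b => (ν * a + b) ^ 2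
        * deriv (deriv (deriv (deriv X₁))) a - 2 * ν * (ν * a + b) * deriv (deriv (deriv X₁)) a
        + 2 * ν ^ 2 * deriv (deriv X₁) a - 2 * ν ^ 2 * deriv (deriv X₂) b)
        hU r2 hx (e.sub_const (2 * ν ^ 2 * deriv (deriv X₂) b))
      simp only [Pi.pow_apply] at e
      push_cast at e
      have e : (ν * a + b) ^ 2 * deriv (deriv (deriv (deriv (deriv X₁)))) a = 0 := by
        linear_combination e
      exact (mul_eq_zero.1 e).resolve_left (pow_ne_zero 2 (hs _ hx))
    obtain ⟨a₀, a₁, a₂, a₃, a₄, hq⟩ := exists_quartic hS (hUc.image _ continuous_fst.continuousOn)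
      hX₁ r3
    refine ⟨a₀, a₁, a₂, a₃, a₄, fun x hx => ?_⟩
    have ha : x.1 ∈ Prod.fst '' U := ⟨_, hx, rfl⟩
    have q0 := hq _ ha
    have q1 := deriv_quartic_of_eqOn hS hq ha
    have q2 := deriv_quartic_of_eqOn hS (fun a ha => deriv_quartic_of_eqOn hS hq ha) ha
    have q3 := deriv_quartic_of_eqOn hS (fun a ha => deriv_quartic_of_eqOn hS
      (fun a ha => deriv_quartic_of_eqOn hS hq ha) ha) ha
    have q4 := deriv_quartic_of_eqOn hS (fun a ha => deriv_quartic_of_eqOn hS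
      (fun a ha => deriv_quartic_of_eqOn hS
      (fun a ha => deriv_quartic_of_eqOn hS hq ha) ha) ha) ha
    refine ⟨q0, ?_⟩
    have s0 := h x hx
    have s1 := r1 x hx
    have s2 := r2 x hx
    rw [scalarRel] at s0
    rw [q1, q2, q0] at s0
    rw [q1, q2, q3] at s1
    rw [q2, q3, q4] at s2
    -- Now `X₂` follows pointwise, without integration. For a quartic `X₁`, the relation `r2` is the
    -- Taylor expansion of `X₁''` from `a` to `a - (ν a + b)/ν = -b/ν`, so it says `X₂''(b) =
    -- X₁''(-b/ν)`. Next `r1` gives `X₂'`, and the original relation gives `X₂`.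
    have y2 : deriv (deriv X₂) x.2
        = 2 * a₂ - 6 * (a₃ / ν) * x.2 + 12 * (a₄ / ν ^ 2) * x.2 ^ 2 := by
      field_simp
      linear_combination (-1 / 2) * s2
    have y1 : deriv X₂ x.2
        = -a₁ * ν + 2 * a₂ * x.2 - 3 * (a₃ / ν) * x.2 ^ 2 + 4 * (a₄ / ν ^ 2) * x.2 ^ 3 := by
      rw [y2] at s1
      field_simp at s1 ⊢
      linear_combination (1 / 6) * s1
    rw [y2, y1] at s0
    field_simp at s0 ⊢
    linear_combination (-1 / 12) * s0
  · rintro ⟨a₀, a₁, a₂, a₃, a₄, h⟩ x hx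
    have ha : x.1 ∈ Prod.fst '' U := ⟨_, hx, rfl⟩
    have hb : x.2 ∈ Prod.snd '' U := ⟨_, hx, rfl⟩
    have hq : ∀ a ∈ Prod.fst '' U,
        X₁ a = a₀ + a₁ * a + a₂ * a ^ 2 + a₃ * a ^ 3 + a₄ * a ^ 4 := by
      rintro _ ⟨y, hy, rfl⟩
      exact (h y hy).1
    have hr : ∀ b ∈ Prod.snd '' U, X₂ b = a₀ * ν ^ 2 + (-(a₁ * ν)) * b + a₂ * b ^ 2
        + (-(a₃ / ν)) * b ^ 3 + a₄ / ν ^ 2 * b ^ 4 := by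
      rintro _ ⟨y, hy, rfl⟩
      rw [(h y hy).2]
      ring
    rw [scalarRel, deriv_quartic_of_eqOn hS (fun a ha => deriv_quartic_of_eqOn hS hq ha) ha,
      deriv_quartic_of_eqOn hS hq ha, hq _ ha,
      deriv_quartic_of_eqOn hT (fun a ha => deriv_quartic_of_eqOn hT hr ha) hb,
      deriv_quartic_of_eqOn hT hr hb, hr _ hb]
    field_simp
    ring

end ScalarRelation

end ChenTeo

/-! ### Reduction of the scalar curvature to a relation between the structure functions. -/

namespace ChenTeo

open Chart

section Reduction

/-- The algebraic identity reducing the scalar curvature to `scalarRel`. -/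
theorem curvature_identity {a b ν c X Y X' Y' X'' Y'' f s t : ℝ} (hc : c = -(1 + ν))
    (hc0 : c ≠ 0) (hs : s ≠ 0) (ht : t ≠ 0) (hf0 : f ≠ 0) (hs' : s = a - b)
    (ht' : t = ν * a + b) (hf : f = b ^ 2 * X - a ^ 2 * Y) {q q₂ q₃ P₂ P₃ Q₂ Q₃ : ℝ}
    (hq : q = 4 * (ν * b * X + a * Y) - (b * X' + a * Y') * t)
    (hq₂ : q₂ = 4 * (ν * b * X' + Y) - (b * X'' + Y') * t - (b * X' + a * Y') * ν)
    (hq₃ : q₃ = 4 * (ν * X + a * Y') - (X' + a * Y'') * t - (b * X' + a * Y'))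
    (hP₂ : P₂ = -((2 * s * q + s ^ 2 * q₂) * (t * (c * f))
      - s ^ 2 * q * (ν * (c * f) + t * (c * (b ^ 2 * X' - 2 * a * Y)))) / (t * (c * f)) ^ 2)
    (hP₃ : P₃ = -((-2 * s * q + s ^ 2 * q₃) * (t * (c * f))
      - s ^ 2 * q * (c * f + t * (c * (2 * b * X - a ^ 2 * Y')))) / (t * (c * f)) ^ 2)
    (hQ₂ : Q₂ = -((X' * Y + a * X'' * Y + b * X' * Y' - 4 * X' * Y) * (c * f)
      - (a * X' * Y + b * X * Y' - 4 * X * Y) * (c * (b ^ 2 * X' - 2 * a * Y))) / (c * f) ^ 2)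
    (hQ₃ : Q₃ = -((a * X' * Y' + X * Y' + b * X * Y'' - 4 * X * Y') * (c * f)
      - (a * X' * Y + b * X * Y' - 4 * X * Y) * (c * (2 * b * X - a ^ 2 * Y'))) / (c * f) ^ 2) :
    s ^ 2 / (c * f) * (b * X * P₂ + a * Y * P₃)
      + -(s ^ 2 * q / (t * (c * f))) * (-(s ^ 2 * q / (t * (c * f))) + 2 / (t / s))
      + s ^ 4 / (c * f) * (a * Q₂ + b * Q₃)
      = s ^ 4 / (c ^ 2 * f * t ^ 2)
        * (t ^ 2 * (X'' - Y'') - 6 * t * (ν * X' - Y') + 12 * (ν ^ 2 * X - Y)) := by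
  rw [hP₂, hP₃, hQ₂, hQ₃]
  field_simp
  rw [hq₂, hq₃, hq, hf, ht', hs', hc]
  ring

end Reduction

end ChenTeo

namespace Chart.ToricAnsatz

open Chart

variable {g J : Field2} {D : Set Pt} {r : ℝ} {w α v z x₂ x₃ z₂ z₃ γ₂ γ₃ : Pt → ℝ} {p : Pt}

theorem smooth_g (h : ToricAnsatz g J D r w α v z x₂ x₃ z₂ z₃ γ₂ γ₃) : SmoothField g D := by
  have hw := h.smooth_w
  have hα := h.smooth_α
  have hv := h.smooth_v
  intro a b
  refine ContDiffOn.congr (f := fun p => (!![r ^ 2 / w p, α p / w p, 0, 0;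
    α p / w p, (α p ^ 2 / w p + w p * v p) / r ^ 2, 0, 0; 0, 0, γ₂ p, 0; 0, 0, 0, γ₃ p] : Mat) a b)
    ?_ fun p hp => by rw [h.g_eq p hp]
  fin_cases a <;> fin_cases b <;> simp <;> first
    | exact contDiffOn_const
    | exact contDiffOn_const.div hw h.w_ne
    | exact hα.div hw h.w_ne
    | exact (((hα.pow 2).div hw h.w_ne).add (hw.mul hv)).div_const _
    | exact h.smooth_γ₂
    | exact h.smooth_γ₃

theorem isOffDiagonal (h : ToricAnsatz g J D r w α v z x₂ x₃ z₂ z₃ γ₂ γ₃) (hp : p ∈ D) :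
    IsOffDiagonal (J p) := by
  simp [IsOffDiagonal, h.J_eq p hp]

end Chart.ToricAnsatz

/-! ### Self-duality of the Chen–Teo family. -/

namespace ChenTeo

open Chart

namespace IsConformallyKahlerFamily

variable {k c ν : ℝ} {X₁ X₂ : ℝ → ℝ} {G H : ℝ × ℝ → ℝ} {U : Set (ℝ × ℝ)} {p : Pt}

theorem isMetricOn (h : IsConformallyKahlerFamily k c ν X₁ X₂ G H U) (hk : 0 < k) :
    IsMetricOn (metric k X₁ X₂ G H) (domain U) where
  isOpen := h.isOpen_domain
  smooth := (h.toricAnsatz hk).smooth_g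
  symm p hp := by simpa using (h.posDef p hp).isHermitian.eq
  isUnit_det _ hp := h.isUnit_det hp

theorem kappa_eq_transpose (h : IsConformallyKahlerFamily k c ν X₁ X₂ G H U) (hk : 0 < k)
    (hp : p ∈ domain U) :
    κ k c X₁ X₂ G H p = (metric k X₁ X₂ G H p * J k c X₁ X₂ G H p).transpose := by
  have : J k c X₁ X₂ G H p
      = (κ k c X₁ X₂ G H p * (metric k X₁ X₂ G H p)⁻¹).transpose := by
    ext a b
    simp only [J, Matrix.of_apply, Matrix.transpose_apply, Matrix.mul_apply]
  rw [this, Matrix.transpose_mul, Matrix.transpose_transpose, (h.isMetricOn hk).symm p hp,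
    Matrix.mul_assoc, Matrix.nonsing_inv_mul _ (h.isUnit_det hp), Matrix.mul_one]

/-- The general formula of the ansatz, with `P` and `Q` made explicit. They involve only `X₁`, `X₂`
and their first derivatives, since `H` cancels between `W` and the coefficients `γ₂`, `γ₃`. -/
theorem scal_eq (h : IsConformallyKahlerFamily k c ν X₁ X₂ G H U) (hk : 0 < k)
    (hcν : c = -(1 + ν)) (hp : p ∈ domain U) :
    scal ((z c ν (proj p))⁻¹ ^ 2 • metric k X₁ X₂ G H p)
        (curv (fun q => (z c ν (proj q))⁻¹ ^ 2 • metric k X₁ X₂ G H q) p)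
      = -(z c ν (proj p) ^ 2 / W k c X₁ X₂ H (proj p))
        * ((p 2 - p 3) ^ 4 / (c ^ 2 * F X₁ X₂ (proj p) * (ν * p 2 + p 3) ^ 2)
          * scalarRel ν X₁ X₂ (p 2) (p 3)) := by
  have hc := h.c_ne
  have hD := h.isOpen_domain
  have hS : IsOpen (Prod.fst '' U) := isOpenMap_fst U h.isOpen
  have hT : IsOpen (Prod.snd '' U) := isOpenMap_snd U h.isOpen
  have t_ne : ∀ p ∈ domain U, ν * p 2 + p 3 ≠ 0 := fun p hp e => by
    have := (h.nondeg hp).z_ne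
    rw [z_proj hcν (h.nondeg hp).sub_ne, e, zero_div] at this
    exact this rfl
  have dX : ∀ p ∈ domain U, DifferentiableAt ℝ X₁ (p 2) := fun p hp =>
    (hasDerivAt_deriv hS h.smooth_X₁ ⟨_, hp, rfl⟩).differentiableAt
  have dX' : ∀ p ∈ domain U, DifferentiableAt ℝ (deriv X₁) (p 2) := fun p hp =>
    (hasDerivAt_deriv hS (contDiffOn_deriv hS h.smooth_X₁) ⟨_, hp, rfl⟩).differentiableAt
  have dY : ∀ p ∈ domain U, DifferentiableAt ℝ X₂ (p 3) := fun p hp =>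
    (hasDerivAt_deriv hT h.smooth_X₂ ⟨_, hp, rfl⟩).differentiableAt
  have dY' : ∀ p ∈ domain U, DifferentiableAt ℝ (deriv X₂) (p 3) := fun p hp =>
    (hasDerivAt_deriv hT (contDiffOn_deriv hT h.smooth_X₂) ⟨_, hp, rfl⟩).differentiableAt
  have dc : ∀ (i : Fin 4) (p : Pt), DifferentiableAt ℝ (fun q : Pt => q i) p := fun i p => by
    fun_prop
  have d2 : ∀ {φ : ℝ → ℝ} {p : Pt}, DifferentiableAt ℝ φ (p 2) →
      DifferentiableAt ℝ (fun q : Pt => φ (q 2)) p := fun {φ p} hφ =>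
    DifferentiableAt.comp (g := φ) (f := fun q : Pt => q 2) p hφ (dc 2 p)
  have d3 : ∀ {φ : ℝ → ℝ} {p : Pt}, DifferentiableAt ℝ φ (p 3) →
      DifferentiableAt ℝ (fun q : Pt => φ (q 3)) p := fun {φ p} hφ =>
    DifferentiableAt.comp (g := φ) (f := fun q : Pt => q 3) p hφ (dc 3 p)
  have pv : ∀ p ∈ domain U, ∀ i, pd i (fun p => expU X₁ X₂ (proj p)) p
      = -(((deriv X₁ (p 2) * pd i (fun q => q 2) p) * X₂ (p 3)
        + X₁ (p 2) * (deriv X₂ (p 3) * pd i (fun q => q 3) p)) * (p 2 - p 3)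
        - 4 * (X₁ (p 2) * X₂ (p 3)) * (pd i (fun q => q 2) p - pd i (fun q => q 3) p))
        / (p 2 - p 3) ^ 5 := by
    intro p hp i
    have e1 := d2 (dX p hp)
    have e2 := d3 (dY p hp)
    have e3 := dc 2 p
    have e4 := dc 3 p
    have e5 := dX p hp
    have e6 := dY p hp
    have e7 := (h.nondeg hp).sub_ne
    have e8 := pow_ne_zero 4 e7
    change pd i (fun q => -(X₁ (q 2) * X₂ (q 3)) / (q 2 - q 3) ^ 4) p = _
    simp (disch := first | assumption | fun_prop (disch := assumption)) only
      [pd_div, pd_neg, pd_mul, pd_sub, pd_pow, pd_comp]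
    generalize p 2 - p 3 = s at *
    push_cast
    field_simp
    ring
  have c22 := pd_coord 2 2
  have c23 := pd_coord 2 3
  have c32 := pd_coord 3 2
  have c33 := pd_coord 3 3
  simp only [if_true, Fin.reduceEq, if_false] at c22 c23 c32 c33
  have e1 := d2 (dX p hp)
  have e1' := d2 (dX' p hp)
  have e2 := d3 (dY p hp)
  have e2' := d3 (dY' p hp)
  have e3 := dc 2 p
  have e4 := dc 3 p
  have e5 := dX p hp
  have e5' := dX' p hp
  have e6 := dY p hp
  have e6' := dY' p hp
  have den : (ν * p 2 + p 3) * (c * (p 3 ^ 2 * X₁ (p 2) - p 2 ^ 2 * X₂ (p 3))) ≠ 0 :=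
    mul_ne_zero (t_ne p hp) (mul_ne_zero hc (h.nondeg hp).F_ne)
  have den' : c * (p 3 ^ 2 * X₁ (p 2) - p 2 ^ 2 * X₂ (p 3)) ≠ 0 :=
    mul_ne_zero hc (h.nondeg hp).F_ne
  -- These are `u_z - 4/z` and `u_x` in the coordinates `x₁`, `x₂`; they are kept opaque so that
  -- they unfold only on demand.
  obtain ⟨P, hP⟩ : ∃ P : Pt → ℝ, P = fun p => -((p 2 - p 3) ^ 2 * (4 * (ν * p 3 * X₁ (p 2) + p 2 * X₂ (p 3))
      - (p 3 * deriv X₁ (p 2) + p 2 * deriv X₂ (p 3)) * (ν * p 2 + p 3))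
      / ((ν * p 2 + p 3) * (c * (p 3 ^ 2 * X₁ (p 2) - p 2 ^ 2 * X₂ (p 3))))) := ⟨_, rfl⟩
  obtain ⟨Q, hQ⟩ : ∃ Q : Pt → ℝ, Q = fun p => -((p 2 * deriv X₁ (p 2) * X₂ (p 3)
      + p 3 * X₁ (p 2) * deriv X₂ (p 3) - 4 * X₁ (p 2) * X₂ (p 3))
      / (c * (p 3 ^ 2 * X₁ (p 2) - p 2 ^ 2 * X₂ (p 3)))) := ⟨_, rfl⟩
  have hmain := (h.toricAnsatz hk).scal_eq h.kahler (h.isMetricOn hk) (p := p) (P := P) (Q := Q)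
    (by
      intro p hp
      obtain ⟨k_pos, sub_ne, H_ne, F_ne, X₁_ne, X₂_ne, z_ne⟩ := h.nondeg hp
      have t_ne := t_ne p hp
      have hk := k_pos.ne'
      rw [hP, pv p hp, pv p hp, c22, c23, c32, c33, z_proj hcν sub_ne]
      change _ = k / c ^ 2 * ((p 2 - p 3) * H (proj p) / F X₁ X₂ (proj p))
        / (-(X₁ (p 2) * X₂ (p 3)) / (p 2 - p 3) ^ 4) * _ - _
      have hF : F X₁ X₂ (proj p) = p 3 ^ 2 * X₁ (p 2) - p 2 ^ 2 * X₂ (p 3) := rfl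
      simp only [← hF]
      generalize hs : p 2 - p 3 = s at *
      generalize ht : ν * p 2 + p 3 = t at *
      generalize F X₁ X₂ (proj p) = f at *
      field_simp
      rw [hF, ← ht, ← hs, hcν]
      ring)
    (by
      intro p hp
      obtain ⟨k_pos, sub_ne, H_ne, F_ne, X₁_ne, X₂_ne, z_ne⟩ := h.nondeg hp
      have hk := k_pos.ne'
      rw [hQ, pv p hp, pv p hp, c22, c23, c32, c33]
      change _ = k / c ^ 2 * ((p 2 - p 3) * H (proj p) / F X₁ X₂ (proj p)) * _
      have hF : F X₁ X₂ (proj p) = p 3 ^ 2 * X₁ (p 2) - p 2 ^ 2 * X₂ (p 3) := rfl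
      simp only [← hF]
      generalize hs : p 2 - p 3 = s at *
      generalize F X₁ X₂ (proj p) = f at *
      field_simp
      rw [← hs]
      ring)
    hp (by rw [hP]; fun_prop (disch := assumption)) (by rw [hQ]; fun_prop (disch := assumption))
  refine hmain.trans ?_
  have hPp : P p = -((p 2 - p 3) ^ 2 * (4 * (ν * p 3 * X₁ (p 2) + p 2 * X₂ (p 3))
      - (p 3 * deriv X₁ (p 2) + p 2 * deriv X₂ (p 3)) * (ν * p 2 + p 3))
      / ((ν * p 2 + p 3) * (c * (p 3 ^ 2 * X₁ (p 2) - p 2 ^ 2 * X₂ (p 3))))) := by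
    rw [hP]
  have id := curvature_identity (a := p 2) (b := p 3) (X := X₁ (p 2)) (Y := X₂ (p 3))
    (X' := deriv X₁ (p 2)) (Y' := deriv X₂ (p 3)) (X'' := deriv (deriv X₁) (p 2))
    (Y'' := deriv (deriv X₂) (p 3)) (P₂ := pd 2 P p) (P₃ := pd 3 P p) (Q₂ := pd 2 Q p)
    (Q₃ := pd 3 Q p) hcν hc (h.nondeg hp).sub_ne (t_ne p hp) (h.nondeg hp).F_ne rfl rfl rfl
    rfl rfl rfl
    (by
      rw [hP, neg_div]
      simp (disch := first | assumption | fun_prop (disch := assumption)) only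
        [pd_div, pd_neg, pd_add, pd_mul, pd_sub, pd_pow, pd_comp, pd_const, c22, c23]
      congr 2
      push_cast
      simp only [F, proj]
      ring)
    (by
      rw [hP, neg_div]
      simp (disch := first | assumption | fun_prop (disch := assumption)) only
        [pd_div, pd_neg, pd_add, pd_mul, pd_sub, pd_pow, pd_comp, pd_const, c32, c33]
      congr 2
      push_cast
      simp only [F, proj]
      ring)
    (by
      rw [hQ, neg_div]
      simp (disch := first | assumption | fun_prop (disch := assumption)) only
        [pd_div, pd_neg, pd_add, pd_mul, pd_sub, pd_pow, pd_comp, pd_const, c22, c23]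
      congr 2
      push_cast
      simp only [F, proj]
      ring)
    (by
      rw [hQ, neg_div]
      simp (disch := first | assumption | fun_prop (disch := assumption)) only
        [pd_div, pd_neg, pd_add, pd_mul, pd_sub, pd_pow, pd_comp, pd_const, c32, c33]
      congr 2
      push_cast
      simp only [F, proj]
      ring)
  congr 1
  rw [scalarRel, ← id, hPp]
  obtain ⟨k_pos, sub_ne, H_ne, F_ne, X₁_ne, X₂_ne, z_ne⟩ := h.nondeg hp
  have hk := k_pos.ne'
  have hF : F X₁ X₂ (proj p) = p 3 ^ 2 * X₁ (p 2) - p 2 ^ 2 * X₂ (p 3) := rfl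
  have hW : W k c X₁ X₂ H (proj p) = k / c ^ 2 * ((p 2 - p 3) * H (proj p) / F X₁ X₂ (proj p)) :=
    rfl
  rw [← hF, z_proj hcν sub_ne, hW]
  clear id hmain hPp hP hQ pv
  generalize p 2 - p 3 = s at *
  generalize F X₁ X₂ (proj p) = f at *
  -- The four coefficients express the operators `∂_z` and `e^{-u} ∂_x` in the coordinates `x₁`,
  -- `x₂`.
  have C₁ : k / c ^ 2 * (s * H (proj p) / f)
      * (c * p 3 / s ^ 2 / (k * H (proj p) / (s ^ 3 * X₁ (p 2))))
      = s ^ 2 / (c * f) * (p 3 * X₁ (p 2)) := by field_simp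
  have C₂ : k / c ^ 2 * (s * H (proj p) / f)
      * (-(c * p 2 / s ^ 2) / -(k * H (proj p) / (s ^ 3 * X₂ (p 3))))
      = s ^ 2 / (c * f) * (p 2 * X₂ (p 3)) := by field_simp
  have C₃ : k / c ^ 2 * (s * H (proj p) / f)
      * (c * (p 2 / X₁ (p 2)) / (k * H (proj p) / (s ^ 3 * X₁ (p 2))))
      = s ^ 4 / (c * f) * p 2 := by field_simp
  have C₄ : k / c ^ 2 * (s * H (proj p) / f)
      * (-(c * (p 3 / X₂ (p 3))) / -(k * H (proj p) / (s ^ 3 * X₂ (p 3))))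
      = s ^ 4 / (c * f) * p 3 := by field_simp
  linear_combination pd 2 P p * C₁ + pd 3 P p * C₂ + pd 2 Q p * C₃ + pd 3 Q p * C₄

theorem selfDual_iff_scalarRel (h : IsConformallyKahlerFamily k c ν X₁ X₂ G H U)
    (hcν : c = -(1 + ν)) (hp : p ∈ domain U) :
    (∀ a b d e, dualWeyl (metric k X₁ X₂ G H) (volumeForm k c X₁ X₂ G H) p a b d e
      = weyl (metric k X₁ X₂ G H) p a b d e) ↔ scalarRel ν X₁ X₂ (p 2) (p 3) = 0 := by
  have n := h.nondeg hp
  have hk := n.k_pos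
  have T := h.toricAnsatz hk
  -- The conformal factor is `z⁻² = e^{2u}` with `u = -log |z|`; `Real.log` already includes the
  -- absolute value, so either sign of `z` is covered.
  have dlog : ∀ p ∈ domain U, ∀ i, pd i (fun q => (z c ν (proj q))⁻¹ ^ 2) p
      = 2 * (z c ν (proj p))⁻¹ ^ 2 * pd i (fun q => -Real.log (z c ν (proj q))) p := by
    intro p hp i
    have hz := T.z_ne p hp
    have dz := T.smooth_z.diffAt T.isOpen hp
    rw [pd_neg, pd_comp (φ := Real.log) (Real.differentiableAt_log hz) dz, Real.deriv_log,
      pd_pow (f := fun q => (z c ν (proj q))⁻¹) 2 (dz.fun_inv hz), pd_inv dz hz]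
    push_cast
    field_simp
  refine (selfDual_iff_scal_eq_zero (h.isMetricOn hk) T.smooth_factor
    (fun p hp => pow_ne_zero 2 (inv_ne_zero (T.z_ne p hp)))
    (T.smooth_z.log T.z_ne).neg dlog h.kahler T.smooth_J hp (T.isOffDiagonal hp)
    (h.kappa_eq_transpose hk hp)).trans ?_
  rw [h.scal_eq hk hcν hp]
  have t_ne : ν * p 2 + p 3 ≠ 0 := fun e => n.z_ne (by rw [z_proj hcν n.sub_ne, e, zero_div])
  have h1 : -(z c ν (proj p) ^ 2 / W k c X₁ X₂ H (proj p)) ≠ 0 :=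
    neg_ne_zero.2 (div_ne_zero (pow_ne_zero 2 n.z_ne) (T.w_ne p hp))
  have h2 : (p 2 - p 3) ^ 4 / (c ^ 2 * F X₁ X₂ (proj p) * (ν * p 2 + p 3) ^ 2) ≠ 0 :=
    div_ne_zero (pow_ne_zero 4 n.sub_ne)
      (mul_ne_zero (mul_ne_zero (pow_ne_zero 2 h.c_ne) n.F_ne) (pow_ne_zero 2 t_ne))
  simp only [mul_eq_zero, h1, h2, false_or]

end IsConformallyKahlerFamily

end ChenTeo

end

theorem mainTheorem6 (k c ν : ℝ) (hc : c = -(1 + ν)) (hc0 : c ≠ 0) (hν : ν ≠ 0)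
    (U : Set (ℝ × ℝ)) (hU : IsOpen U) (hUc : IsPreconnected U)
    (X₁ X₂ : ℝ → ℝ) (G H : ℝ × ℝ → ℝ)
    (hX₁ : ContDiffOn ℝ ∞ X₁ (Prod.fst '' U)) (hX₂ : ContDiffOn ℝ ∞ X₂ (Prod.snd '' U))
    (hG : ContDiffOn ℝ ∞ G U) (hH : ContDiffOn ℝ ∞ H U)
    (hg : ∀ p ∈ ChenTeo.domain U, (ChenTeo.metric k X₁ X₂ G H p).PosDef)
    (hK : ChenTeo.IsConformallyKahlerOn k c ν X₁ X₂ G H U) :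
    Chart.IsConformallySelfDualOn (ChenTeo.metric k X₁ X₂ G H)
        (ChenTeo.volumeForm k c X₁ X₂ G H) (ChenTeo.domain U) ↔
      ∃ a₀ a₁ a₂ a₃ a₄ : ℝ, ∀ x ∈ U,
        X₁ x.1 = a₀ + a₁ * x.1 + a₂ * x.1 ^ 2 + a₃ * x.1 ^ 3 + a₄ * x.1 ^ 4 ∧
        X₂ x.2 = a₀ * ν ^ 2 - a₁ * ν * x.2 + a₂ * x.2 ^ 2 - a₃ / ν * x.2 ^ 3
          + a₄ / ν ^ 2 * x.2 ^ 4 := by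
  have h : ChenTeo.IsConformallyKahlerFamily k c ν X₁ X₂ G H U :=
    ⟨hc0, hU, hX₁, hX₂, hG, hH, hg, hK⟩
  -- Since `scalarRel` depends only on the orbit-space point, the lift with `τ = φ = 0` suffices.
  have lift : ∀ x ∈ U, (![0, 0, x.1, x.2] : Chart.Pt) ∈ ChenTeo.domain U := fun x hx => hx
  have hs : ∀ x ∈ U, ν * x.1 + x.2 ≠ 0 := by
    intro x hx e
    have n := h.nondeg (lift x hx)
    refine n.z_ne ?_
    rw [ChenTeo.IsConformallyKahlerFamily.z_proj hc n.sub_ne]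
    exact (congrArg (· / (x.1 - x.2)) e).trans (zero_div _)
  rw [← ChenTeo.scalarRel_eq_zero_iff hν hU hUc hX₁ hs]
  exact ⟨fun hd x hx => (h.selfDual_iff_scalarRel hc (lift x hx)).1 (hd _ (lift x hx)),
    fun hr p hp => (h.selfDual_iff_scalarRel hc hp).2 (hr _ hp)⟩
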